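/- **Model.** Wi-Fi access points (APs) $\Phi_W=\{x_i\}$ and LTE base stations (eNBs) $\Phi_L=\{y_k\}$ are independent homogeneous Poisson point processes on $\mathbb{R}^2$ with intensities $\lambda_W,\lambda_L>0$. The path loss is $l(d)=(4\pi/\lambda_c)^2d^{\alpha}$ with $\lambda_c,\alpha>0$. The transmit powers $P_W,P_L$ and the thresholds $\Gamma_{cs},\Gamma_{ed},\Gamma^L$ are positive. All fading variables ($G^W_{ji}$ from AP $x_j$ to AP $x_i$, $G^{LW}_{mi}$ from eNB $y_m$ to AP $x_i$, $G^{WL}_{jk}$ from AP $x_j$ to eNB $y_k$, $G^L_{mk}$ from eNB $y_m$ to eNB $y_k$) are exponential with parameter $\mu>0$, and all back-off timers $t^W_i$ and $t^L_k$ are uniform on $[0,1]$ (listen-before-talk with LTE back-off window $(a,b)=(0,1)$). Fadings and timers are mutually independent and independent of all locations. The indicators $e_i^W,e_k^L\in\{0,1\}$ that AP $x_i$, respectively eNB $y_k$, transmits are $$e_i^W=\prod_{x_j\in\Phi_W\setminus\{x_i\}}\Bigl(1_{t_j^W\ge t_i^W}+1_{t_j^W<t_i^W}1_{G^W_{ji}/l(\|x_j-x_i\|)\le\Gamma_{cs}/P_W}\Bigr)\prod_{y_m\in\Phi_L}\Bigl(1_{t_m^L\ge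 t_i^W}+1_{t_m^L<t_i^W}1_{G^{LW}_{mi}/l(\|y_m-x_i\|)\le\Gamma_{ed}/P_L}\Bigr),$$ $$e_k^L=\prod_{x_j\in\Phi_W}\Bigl(1_{t_j^W\ge t_k^L}+1_{t_j^W<t_k^L}1_{G^{WL}_{jk}/l(\|y_k-x_j\|)\le\Gamma^L/P_W}\Bigr)\prod_{y_m\in\Phi_L\setminus\{y_k\}}\Bigl(1_{t_m^L\ge t_k^L}+1_{t_m^L<t_k^L}1_{G^L_{mk}/l(\|y_m-y_k\|)\le\Gamma^L/P_L}\Bigr).$$ The tagged AP $x_0$ is the AP closest to the origin, and $e_0^W$ is its indicator. **Functions.** Let $B(0,r)$ be the closed disc of radius $r$ about the origin $o$, and for $S\in\{W,L\}$ put $$N^S_0(y,r,\Gamma)=\lambda_S\int_{\mathbb{R}^2\setminus B(0,r)}e^{-\mu\frac{\Gamma}{P_S}l(\|x-y\|)}\,dx,\qquad C^S_0(y_1,\Gamma_1,y_2,\Gamma_2)=\lambda_S\int_{\mathbb{R}^2\setminus B(0,\|y_2\|)}e^{-\mu\frac{\Gamma_1}{P_S}l(\|x-y_1\|)-\mu\frac{\Gamma_2}{P_S}l(\|x-y_2\|)}\,dx,$$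 $N^W_2(r)=N^W_0((r,0),r,\Gamma_{cs})$, $N^L_3(\Gamma)=N^L_0(o,0,\Gamma)$, $N^L=N^L_0(o,0,\Gamma_{ed})$, $$M(N_1,N_2,N_3)=\frac{1}{N_2-N_3}\left(\frac{1-e^{-N_1}}{N_1}-\frac{1-e^{-N_1-N_2+N_3}}{N_1+N_2-N_3}\right),$$ $$V(x,s_1,s_2,N_1,N_2,N_3)=(1-e^{-\mu s_1l(\|x\|)})M(N_1,N_2,N_3)+(1-e^{-\mu s_2l(\|x\|)})M(N_2,N_1,N_3),$$ $$U(x,s,N_1)=\frac{1-e^{-N_1}}{N_1}-e^{-\mu s\,l(\|x\|)}\left(\frac{1-e^{-N_1}}{N_1^2}-\frac{e^{-N_1}}{N_1}\right).$$ **Claim.** Conditionally on the tagged AP being at $x_0=(r_0,0)$ and transmitting, an eNB of $\Phi_L$ located at $y_k$ transmits with probability $$h_2^L(r_0,y_k)=\frac{V\bigl(y_k-x_0,\tfrac{\Gamma^L}{P_W},\tfrac{\Gamma_{ed}}{P_L},N_4,N_5,N_6\bigr)}{U\bigl(y_k-x_0,\tfrac{\Gamma_{ed}}{P_L},N_5\bigr)},$$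 where $N_4=N^W_0(y_k,r_0,\Gamma^L)+N^L_3(\Gamma^L)$, $N_5=N^W_2(r_0)+N^L$ and $N_6=C^W_0(y_k,\Gamma^L,x_0,\Gamma_{cs})+C^L_0(y_k-x_0,\Gamma^L,o,\Gamma_{ed})$. The conditional probability is the Palm one, $\mathbb{P}^{y_k}_{\Phi_L}(e_k^L=1\mid e_0^W=1,\,x_0=(r_0,0))$. Precisely, for $x,y\in\mathbb{R}^2$ let $h(x,y)$ be the same expression with $x_0=x$ (at any angle) and $r_0=\|x\|$. Then $h$ is nonnegative and measurable, and for every Borel set $S\subseteq\mathbb{R}^2\times\mathbb{R}^2$, $$\mathbb{E}\sum_{k}1_{\{(x_0,y_k)\in S\}}e_0^We_k^L=\mathbb{E}\sum_{k}1_{\{(x_0,y_k)\in S\}}e_0^W\,h(x_0,y_k).$$ Moreover, for every $r_0\ge0$ and $y\in\mathbb{R}^2$, with $B_\varepsilon(z)$ the open disc of radius $\varepsilon$ about $z$, $$\frac{\mathbb{E}\sum_k1_{\{x_0\in B_\varepsilon((r_0,0)),\,y_k\in B_\varepsilon(y)\}}e_0^We_k^L}{\mathbb{E}\sum_k1_{\{x_0\in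 B_\varepsilon((r_0,0)),\,y_k\in B_\varepsilon(y)\}}e_0^W}\longrightarrow h_2^L(r_0,y)\qquad(\varepsilon\downarrow0),$$ the denominator being positive and finite for every $\varepsilon>0$. -/

import Mathlib

open MeasureTheory ProbabilityTheory Filter Topology

noncomputable section

namespace Coexistence

/-- The plane `ℝ²` with its Euclidean norm and Lebesgue measure. -/
abbrev Plane : Type := EuclideanSpace ℝ (Fin 2)

/-- System parameters: intensities of the AP and eNB processes, transmit powers, the carrier
sensing threshold `Γ_cs` and energy detection threshold `Γ_ed` of Wi-Fi, the common sensing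
threshold `Γ^L` of LTE, the Rayleigh fading parameter `μ`, the path loss exponent `α`
and the wavelength. -/
structure Params where
  lamW : ℝ
  lamL : ℝ
  powW : ℝ
  powL : ℝ
  gamCS : ℝ
  gamED : ℝ
  gamL : ℝ
  mu : ℝ
  alpha : ℝ
  wavelength : ℝ
  lamW_pos : 0 < lamW
  lamL_pos : 0 < lamL
  powW_pos : 0 < powW
  powL_pos : 0 < powL
  gamCS_pos : 0 < gamCS
  gamED_pos : 0 < gamED
  gamL_pos : 0 < gamL
  mu_pos : 0 < mu
  alpha_pos : 0 < alpha
  wavelength_pos : 0 < wavelength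

/-- The path loss `l(d) = (4π/λ_c)² d^α`, which in dB reads
`20 log₁₀ (4π/λ_c) + 10 α log₁₀ d`. -/
def Params.pathLoss (p : Params) (d : ℝ) : ℝ :=
  (4 * Real.pi / p.wavelength) ^ 2 * d ^ p.alpha

/-! ### The special functions -/

/-- `N^L_0(y, r, Γ)`. -/
def N0L (p : Params) (y : Plane) (r g : ℝ) : ℝ :=
  p.lamL * ∫ x in (Metric.closedBall (0 : Plane) r)ᶜ,
    Real.exp (-(p.mu * (g / p.powL) * p.pathLoss ‖x - y‖))

/-- `N^W_0(y, r, Γ)`. -/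
def N0W (p : Params) (y : Plane) (r g : ℝ) : ℝ :=
  p.lamW * ∫ x in (Metric.closedBall (0 : Plane) r)ᶜ,
    Real.exp (-(p.mu * (g / p.powW) * p.pathLoss ‖x - y‖))

/-- `N^W_2(r) = N^W_0((r,0), r, Γ_cs)`. -/
def N2W (p : Params) (r : ℝ) : ℝ := N0W p !₂[r, 0] r p.gamCS

/-- `N^L_3(Γ) = N^L_0(o, 0, Γ)`. -/
def N3L (p : Params) (g : ℝ) : ℝ := N0L p 0 0 g

/-- `N^L = N^L_0(o, 0, Γ_ed)`. -/
def NL (p : Params) : ℝ := N0L p 0 0 p.gamED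

/-- `C^L_0(y₁, Γ₁, y₂, Γ₂)`. -/
def C0L (p : Params) (y₁ : Plane) (g₁ : ℝ) (y₂ : Plane) (g₂ : ℝ) : ℝ :=
  p.lamL * ∫ x in (Metric.closedBall (0 : Plane) ‖y₂‖)ᶜ,
    Real.exp (-(p.mu * (g₁ / p.powL) * p.pathLoss ‖x - y₁‖)
      - p.mu * (g₂ / p.powL) * p.pathLoss ‖x - y₂‖)

/-- `C^W_0(y₁, Γ₁, y₂, Γ₂)`. -/
def C0W (p : Params) (y₁ : Plane) (g₁ : ℝ) (y₂ : Plane) (g₂ : ℝ) : ℝ :=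
  p.lamW * ∫ x in (Metric.closedBall (0 : Plane) ‖y₂‖)ᶜ,
    Real.exp (-(p.mu * (g₁ / p.powW) * p.pathLoss ‖x - y₁‖)
      - p.mu * (g₂ / p.powW) * p.pathLoss ‖x - y₂‖)

/-- `M(N₁, N₂, N₃)`. -/
def funM (n₁ n₂ n₃ : ℝ) : ℝ :=
  ((1 - Real.exp (-n₁)) / n₁ - (1 - Real.exp (-n₁ - n₂ + n₃)) / (n₁ + n₂ - n₃)) / (n₂ - n₃)

/-- `V(x, s₁, s₂, N₁, N₂, N₃)`. -/
def funV (p : Params) (x : Plane) (s₁ s₂ n₁ n₂ n₃ : ℝ) : ℝ :=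
  (1 - Real.exp (-(p.mu * s₁ * p.pathLoss ‖x‖))) * funM n₁ n₂ n₃
    + (1 - Real.exp (-(p.mu * s₂ * p.pathLoss ‖x‖))) * funM n₂ n₁ n₃

/-- `U(x, s, N₁)`. -/
def funU (p : Params) (x : Plane) (s n₁ : ℝ) : ℝ :=
  (1 - Real.exp (-n₁)) / n₁
    - Real.exp (-(p.mu * s * p.pathLoss ‖x‖))
      * ((1 - Real.exp (-n₁)) / n₁ ^ 2 - Real.exp (-n₁) / n₁)

/-- `N₄ = N^W_0(y, r₀, Γ^L) + N^L_3(Γ^L)`. -/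
def N4 (p : Params) (r₀ : ℝ) (y : Plane) : ℝ := N0W p y r₀ p.gamL + N3L p p.gamL

/-- `N₅ = N^W_2(r₀) + N^L`. -/
def N5 (p : Params) (r₀ : ℝ) : ℝ := N2W p r₀ + NL p

/-- `N₆ = C^W_0(y, Γ^L, x₀, Γ_cs) + C^L_0(y - x₀, Γ^L, o, Γ_ed)`. -/
def N6 (p : Params) (x₀ y : Plane) : ℝ :=
  C0W p y p.gamL x₀ p.gamCS + C0L p (y - x₀) p.gamL 0 p.gamED

/-- The closed-form conditional medium access probability of an eNB at `y`, the tagged AP being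
at `x₀` (at distance `r₀ = ‖x₀‖` from the origin, with arbitrary angle). -/
def h2L (p : Params) (x₀ y : Plane) : ℝ :=
  funV p (y - x₀) (p.gamL / p.powW) (p.gamED / p.powL) (N4 p ‖x₀‖ y) (N5 p ‖x₀‖) (N6 p x₀ y)
    / funU p (y - x₀) (p.gamED / p.powL) (N5 p ‖x₀‖)

/-! ### The random network -/

section Network

variable {Ω : Type*} [MeasurableSpace Ω]

/-- The counting measure `B ↦ #{i | X i ω ∈ B}` of the points of an enumerated point process. -/
def pointMeasure (X : ℕ → Ω → Plane) (ω : Ω) : Measure Plane :=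
  Measure.sum fun i => Measure.dirac (X i ω)

/-- `(X i)` enumerates a homogeneous Poisson point process of intensity `lam` on the plane. -/
structure IsPoissonProcess (P : Measure Ω) (lam : ℝ) (X : ℕ → Ω → Plane) : Prop where
  measurable : ∀ i, Measurable (X i)
  law : ∀ B : Set Plane, MeasurableSet B → volume B ≠ ⊤ → ∀ n : ℕ,
    P {ω | pointMeasure X ω B = n} =
      ENNReal.ofReal (Real.exp (-(lam * (volume B).toReal)) * (lam * (volume B).toReal) ^ n
        / n.factorial)
  indep : ∀ (n : ℕ) (B : Fin n → Set Plane), (∀ i, MeasurableSet (B i)) →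
    Pairwise (Function.onFun Disjoint B) →
    iIndepFun (fun i ω => pointMeasure X ω (B i)) P

/-- The random quantities of the network. `x i` are the APs, `y k` the eNBs; `tW`, `tL` the
back-off timers; `gW j i`, `gLW m i`, `gWL j k`, `gL m k` the fading of the channel
from AP `j` to AP `i`, eNB `m` to AP `i`, AP `j` to eNB `k`, eNB `m` to eNB `k`. -/
structure Network (Ω : Type*) where
  x : ℕ → Ω → Plane
  y : ℕ → Ω → Plane
  tW : ℕ → Ω → ℝ
  tL : ℕ → Ω → ℝ
  gW : ℕ → ℕ → Ω → ℝ
  gLW : ℕ → ℕ → Ω → ℝ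
  gWL : ℕ → ℕ → Ω → ℝ
  gL : ℕ → ℕ → Ω → ℝ

/-- Indices of all the real random marks. -/
inductive MarkIndex where
  | tW (i : ℕ)
  | tL (k : ℕ)
  | gW (j i : ℕ)
  | gLW (m i : ℕ)
  | gWL (j k : ℕ)
  | gL (m k : ℕ)

/-- All timers and fading variables as one family. -/
def Network.mark (N : Network Ω) : MarkIndex → Ω → ℝ
  | .tW i => N.tW i
  | .tL k => N.tL k
  | .gW j i => N.gW j i
  | .gLW m i => N.gLW m i
  | .gWL j k => N.gWL j k
  | .gL m k => N.gL m k

/-- The probabilistic model, with LTE back-off window `(a,b)`: APs and eNBs form independent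
homogeneous Poisson processes; the marks are mutually independent and independent of all
locations; Wi-Fi timers are uniform on `[0,1]`, LTE timers uniform on `[a,b]`, fadings
exponential with parameter `μ`. The AP with index `0` is the tagged one, that is the AP
closest to the typical station, which sits at the origin. -/
structure Network.IsModel (N : Network Ω) (p : Params) (a b : ℝ) (P : Measure Ω) : Prop where
  poissonW : IsPoissonProcess P p.lamW N.x
  poissonL : IsPoissonProcess P p.lamL N.y
  measurable_mark : ∀ s, Measurable (N.mark s)
  law_tW : ∀ i, P.map (N.tW i) = cond volume (Set.Icc 0 1)
  law_tL : ∀ k, P.map (N.tL k) = cond volume (Set.Icc a b)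
  law_gW : ∀ j i, P.map (N.gW j i) = expMeasure p.mu
  law_gLW : ∀ m i, P.map (N.gLW m i) = expMeasure p.mu
  law_gWL : ∀ j k, P.map (N.gWL j k) = expMeasure p.mu
  law_gL : ∀ m k, P.map (N.gL m k) = expMeasure p.mu
  indep_locations : IndepFun (fun ω i => N.x i ω) (fun ω k => N.y k ω) P
  indep_marks : iIndepFun N.mark P
  indep_locations_marks :
    IndepFun (fun ω => ((fun i => N.x i ω), (fun k => N.y k ω))) (fun ω s => N.mark s ω) P
  tagged : ∀ᵐ ω ∂P, ∀ j, ‖N.x 0 ω‖ ≤ ‖N.x j ω‖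

/-- `e_i^W = 1`: every other AP (every eNB) either has a timer that is not smaller than that of
AP `i`, or is received by it with power at most `Γ_cs` (at most `Γ_ed`). -/
def Network.APTransmits (N : Network Ω) (p : Params) (i : ℕ) (ω : Ω) : Prop :=
  (∀ j, j ≠ i → N.tW i ω ≤ N.tW j ω ∨
    N.gW j i ω / p.pathLoss ‖N.x j ω - N.x i ω‖ ≤ p.gamCS / p.powW) ∧
  (∀ m, N.tW i ω ≤ N.tL m ω ∨
    N.gLW m i ω / p.pathLoss ‖N.y m ω - N.x i ω‖ ≤ p.gamED / p.powL)

/-- `e_k^L = 1`: every AP and every other eNB either has a timer that is not smaller than that of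
eNB `k`, or is received by it with power at most `Γ^L`. -/
def Network.ENBTransmits (N : Network Ω) (p : Params) (k : ℕ) (ω : Ω) : Prop :=
  (∀ j, N.tL k ω ≤ N.tW j ω ∨
    N.gWL j k ω / p.pathLoss ‖N.y k ω - N.x j ω‖ ≤ p.gamL / p.powW) ∧
  (∀ m, m ≠ k → N.tL k ω ≤ N.tL m ω ∨
    N.gL m k ω / p.pathLoss ‖N.y m ω - N.y k ω‖ ≤ p.gamL / p.powL)

/-- The Campbell measure `S ↦ E[∑ₖ 1{(x₀, yₖ) ∈ S} 1{e₀^W = 1}]` of the pairs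
(tagged AP, eNB) on the event that the tagged AP transmits. -/
def Network.campbellTagged (N : Network Ω) (p : Params) (P : Measure Ω) :
    Measure (Plane × Plane) :=
  Measure.sum fun k =>
    (P.restrict {ω | N.APTransmits p 0 ω}).map fun ω => (N.x 0 ω, N.y k ω)

/-- The Campbell measure `S ↦ E[∑ₖ 1{(x₀, yₖ) ∈ S} 1{e₀^W = 1} 1{eₖ^L = 1}]`. -/
def Network.campbellBoth (N : Network Ω) (p : Params) (P : Measure Ω) :
    Measure (Plane × Plane) :=
  Measure.sum fun k =>
    (P.restrict {ω | N.APTransmits p 0 ω ∧ N.ENBTransmits p k ω}).map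
      fun ω => (N.x 0 ω, N.y k ω)

/-- `h` is (a version of) the Palm conditional probability
`(x, z) ↦ P^z_{Φ_L}(e^L_z = 1 | e_0^W = 1, x_0 = x)`: it disintegrates the Campbell measure of the
pairs that both transmit with respect to that of the pairs in which the tagged AP does. -/
def Network.IsPalmCondProb (N : Network Ω) (p : Params) (P : Measure Ω)
    (h : Plane → Plane → ℝ) : Prop :=
  Measurable (Function.uncurry h) ∧ (∀ x z, 0 ≤ h x z) ∧
  N.campbellBoth p P =
    (N.campbellTagged p P).withDensity fun q => ENNReal.ofReal (h q.1 q.2)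

/-- `c` is the conditional probability that an eNB at `z` transmits, given that the tagged AP
is at `x` and transmits, in the pointwise sense: small neighbourhoods of `x` and `z` have positive
and finite conditioning mass, and the ratios of the expected numbers of eNBs near `z` converge
to `c` as the neighbourhoods shrink. -/
def Network.HasLocalCondProb (N : Network Ω) (p : Params) (P : Measure Ω)
    (x z : Plane) (c : ℝ) : Prop :=
  (∀ ε > 0, N.campbellTagged p P (Metric.ball x ε ×ˢ Metric.ball z ε) ≠ 0 ∧
    N.campbellTagged p P (Metric.ball x ε ×ˢ Metric.ball z ε) ≠ ⊤) ∧
  Tendsto (fun ε : ℝ =>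
      (N.campbellBoth p P (Metric.ball x ε ×ˢ Metric.ball z ε) /
        N.campbellTagged p P (Metric.ball x ε ×ˢ Metric.ball z ε)).toReal)
    (𝓝[>] 0) (𝓝 c)

end Network

end Coexistence

end

noncomputable section

namespace Coexistence

/-! ### The functions `e^{-a}` and `-log q` with values in `[0, ∞]`. -/

open scoped ENNReal NNReal BoundedContinuousFunction

/-! Fix all locations and the two tagged timers, `t` of the AP at `x` and `s` of the eNB at `y`.
Every remaining mark belongs to exactly one transmitter, so the event that nobody silences the pair
is an intersection of independent events, one per transmitter (`measure_coexist`). An untagged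
transmitter silences the pair with probability `t q₁ + s q₂ - min t s * q₁ q₂`, where `q₁`, `q₂` are
the probabilities that its signal is too strong at `x` and at `y`. The two tagged devices contribute
only the factor `pairWeight`.

Averaging this product over the locations turns it into exponentials of integrals of the silencing
probability. Mecke's formula treats the eNB at `y`; its analogue for the nearest point treats the
tagged AP and adds the probability that the disc through `x` is empty (`campbell_pair`). Hence the
Campbell measure has a density (`campbell_eq_withDensity`): the void probability times the integral
over the unit square of `pairWeight` times `exp (-(t N₅ + s N₄ - min t s * N₆))`. On each side of
the diagonal the weight is constant and the exponent linear, which gives `V`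
(`campbellDensity_true`). If only the AP is required to transmit, the exponent is `t N₅` and the
integral is `U` (`campbellDensity_false`). The void probability cancels in the quotient. Finally
`h2L` is continuous, because `N₆ < N₄`, `N₆ < N₅` and `0 < U` keep all denominators away from zero,
so the ratios over shrinking discs converge at every point.

The Poisson processes are given through their counts only, so the Laplace functional and Mecke's
formula are derived from the counts. For functions constant on finitely many cells they are
identities between Poisson generating functions. The Laplace functional extends by monotone limits.
Mecke's formula involves functions `φ (y, z)` of two points; it is first obtained for rectangles,
and since joint Laplace transforms of the masses of rectangles determine the law of a random finite
measure (`law_ext_of_laplace`), it follows for every measurable `φ` in a window, and then on the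
whole plane. -/

/-- The function `a ↦ e^{-a}` on `[0, ∞]`. -/
def negExp (a : ℝ≥0∞) : ℝ≥0∞ := EReal.exp (-(a : EReal))

/-- The function `q ↦ -log q` on `[0, 1]`, a right inverse of `negExp`. -/
def negLog (q : ℝ≥0∞) : ℝ≥0∞ := (-(ENNReal.log q)).toENNReal

lemma continuous_negExp : Continuous negExp :=
  ENNReal.continuous_exp.comp (continuous_neg.comp continuous_coe_ennreal_ereal)

@[fun_prop]
lemma measurable_negExp : Measurable negExp := continuous_negExp.measurable

@[fun_prop]
lemma measurable_negLog : Measurable negLog := by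
  unfold negLog; fun_prop

lemma antitone_negExp : Antitone negExp := fun a b h => by
  unfold negExp
  exact EReal.exp_monotone (EReal.neg_le_neg_iff.2 (by exact_mod_cast h))

@[simp] lemma negExp_zero : negExp 0 = 1 := by simp [negExp]

@[simp] lemma negExp_top : negExp ∞ = 0 := by simp [negExp]

lemma negExp_le_one (a : ℝ≥0∞) : negExp a ≤ 1 := by
  simpa using antitone_negExp (zero_le (a := a))

lemma negExp_ne_top (a : ℝ≥0∞) : negExp a ≠ ∞ :=
  ((negExp_le_one a).trans_lt ENNReal.one_lt_top).ne

lemma negExp_add (a b : ℝ≥0∞) : negExp (a + b) = negExp a * negExp b := by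
  unfold negExp
  rw [← EReal.exp_add, EReal.coe_ennreal_add, EReal.neg_add, sub_eq_add_neg] <;> simp

lemma negExp_sum {ι : Type*} (s : Finset ι) (f : ι → ℝ≥0∞) :
    negExp (∑ i ∈ s, f i) = ∏ i ∈ s, negExp (f i) := by
  classical
  induction s using Finset.induction_on with
  | empty => simp
  | insert a s ha ih => rw [Finset.sum_insert ha, Finset.prod_insert ha, negExp_add, ih]

lemma negExp_ofReal {x : ℝ} (hx : 0 ≤ x) :
    negExp (ENNReal.ofReal x) = ENNReal.ofReal (Real.exp (-x)) := by
  rw [negExp, EReal.coe_ennreal_ofReal, max_eq_left hx, ← EReal.coe_neg, EReal.exp_coe]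

lemma negExp_eq_ofReal {a : ℝ≥0∞} (ha : a ≠ ∞) :
    negExp a = ENNReal.ofReal (Real.exp (-a.toReal)) := by
  rw [← negExp_ofReal ENNReal.toReal_nonneg, ENNReal.ofReal_toReal ha]

lemma negExp_pos {a : ℝ≥0∞} (ha : a ≠ ∞) : 0 < negExp a := by
  rw [negExp_eq_ofReal ha]
  simp [Real.exp_pos]

/-- Allows a product of probabilities to be written as `negExp` of a sum, the form to which Laplace
functionals apply. Zero probabilities are covered by the value `∞`. -/
lemma negExp_negLog {q : ℝ≥0∞} (hq : q ≤ 1) : negExp (negLog q) = q := by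
  have : 0 ≤ -(ENNReal.log q) := by
    rw [EReal.neg_nonneg, ← ENNReal.log_one]
    exact ENNReal.log_monotone hq
  rw [negExp, negLog, EReal.coe_toENNReal this, neg_neg, ENNReal.exp_log]

lemma negExp_iSup {f : ℕ → ℝ≥0∞} (hf : Monotone f) : negExp (⨆ n, f n) = ⨅ n, negExp (f n) :=
  tendsto_nhds_unique ((continuous_negExp.tendsto _).comp (tendsto_atTop_iSup hf))
    (tendsto_atTop_iInf (antitone_negExp.comp_monotone hf))

lemma negExp_tsum {ι : Type*} (f : ι → ℝ≥0∞) :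
    Tendsto (fun s : Finset ι => ∏ i ∈ s, negExp (f i)) atTop (𝓝 (negExp (∑' i, f i))) := by
  simp_rw [← negExp_sum]
  exact (continuous_negExp.tendsto _).comp ENNReal.summable.hasSum

/-! ### Uniqueness of Laplace transforms on `[0, ∞]^ι`. -/

section Laplace

variable {ι : Type*} [Fintype ι]

/-- The bounded continuous function `x ↦ exp (-∑ aᵢ xᵢ)` on `[0, ∞]^ι`. -/
def laplaceKernel (a : ι → ℕ) : (ι → ℝ≥0∞) →ᵇ ℝ :=
  BoundedContinuousFunction.ofNormedAddCommGroup (fun x => (negExp (∑ i, a i * x i)).toReal)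
    (by
      rw [continuous_iff_continuousAt]
      intro x
      have : Continuous fun x : ι → ℝ≥0∞ => negExp (∑ i, a i * x i) :=
        continuous_negExp.comp (continuous_finsetSum _ fun i _ =>
          (ENNReal.continuous_const_mul (by simp)).comp (continuous_apply i))
      exact (ENNReal.tendsto_toReal (negExp_ne_top _)).comp this.continuousAt) 1
    (fun x => by
      rw [Real.norm_of_nonneg ENNReal.toReal_nonneg]
      exact ENNReal.toReal_mono (by simp) (negExp_le_one _))

lemma laplaceKernel_apply (a : ι → ℕ) (x : ι → ℝ≥0∞) :
    laplaceKernel a x = (negExp (∑ i, a i * x i)).toReal := rfl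

/-- Multiplicativity in the exponent makes the linear span of the kernels an algebra. -/
lemma laplaceKernel_add (a b : ι → ℕ) :
    laplaceKernel (a + b) = laplaceKernel a * laplaceKernel b := by
  ext x
  simp only [laplaceKernel_apply, BoundedContinuousFunction.coe_mul, Pi.mul_apply]
  rw [← ENNReal.toReal_mul, ← negExp_add, ← Finset.sum_add_distrib]
  simp [add_mul]

lemma laplaceKernel_zero : laplaceKernel (0 : ι → ℕ) = 1 := by
  ext x
  simp [laplaceKernel_apply]

/-- The algebra of finite linear combinations of the functions `x ↦ exp (-∑ aᵢ xᵢ)`. -/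
def laplaceAlgebra (ι : Type*) [Fintype ι] : StarSubalgebra ℝ ((ι → ℝ≥0∞) →ᵇ ℝ) where
  carrier := Submodule.span ℝ (Set.range (laplaceKernel (ι := ι)))
  add_mem' := Submodule.add_mem _
  mul_mem' := by
    intro f g hf hg
    have h := Submodule.mul_mem_mul hf hg
    rw [Submodule.span_mul_span] at h
    refine Submodule.span_mono ?_ h
    rintro _ ⟨_, ⟨a, rfl⟩, _, ⟨b, rfl⟩, rfl⟩
    exact ⟨a + b, laplaceKernel_add a b⟩
  algebraMap_mem' := by
    intro r
    rw [Algebra.algebraMap_eq_smul_one]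
    exact Submodule.smul_mem _ _ (Submodule.subset_span ⟨0, laplaceKernel_zero⟩)
  star_mem' := by
    intro f hf
    have : star f = f := by ext x; simp
    rwa [this]

/-- Finite measures on `[0, ∞]^ι` with the same Laplace transform are equal. -/
theorem ext_of_laplace {μ ν : Measure (ι → ℝ≥0∞)} [IsFiniteMeasure μ] [IsFiniteMeasure ν]
    (h : ∀ a : ι → ℕ, ∫⁻ x, negExp (∑ i, a i * x i) ∂μ = ∫⁻ x, negExp (∑ i, a i * x i) ∂ν) :
    μ = ν := by
  have hmeas : ∀ a : ι → ℕ, Measurable fun x : ι → ℝ≥0∞ => negExp (∑ i, a i * x i) := by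
    intro a; fun_prop
  -- Stone–Weierstrass: a point-separating algebra of bounded continuous functions determines a
  -- finite measure on a Polish space.
  refine ext_of_forall_mem_subalgebra_integral_eq_of_polish (A := laplaceAlgebra ι) ?_ ?_
  · intro x y hxy
    obtain ⟨i, hi⟩ := Function.ne_iff.1 hxy
    classical
    refine ⟨_, ⟨_, ⟨laplaceKernel (Pi.single i 1), Submodule.subset_span ⟨_, rfl⟩, rfl⟩, rfl⟩, ?_⟩
    change laplaceKernel (Pi.single i 1) x ≠ laplaceKernel (Pi.single i 1) y
    have key : ∀ z : ι → ℝ≥0∞, ∑ j, ((Pi.single i 1 : ι → ℕ) j : ℝ≥0∞) * z j = z i := by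
      intro z
      rw [Finset.sum_eq_single i] <;> simp +contextual
    rw [laplaceKernel_apply, laplaceKernel_apply, key, key]
    intro heq
    rw [ENNReal.toReal_eq_toReal_iff' (negExp_ne_top _) (negExp_ne_top _)] at heq
    have := EReal.exp_strictMono.injective heq
    exact hi (by simpa using this)
  · intro g hg
    change g ∈ Submodule.span ℝ (Set.range (laplaceKernel (ι := ι))) at hg
    induction hg using Submodule.span_induction with
    | mem g hg =>
      obtain ⟨a, rfl⟩ := hg
      simp only [laplaceKernel_apply]
      rw [integral_toReal (hmeas a).aemeasurable (by simp [(negExp_ne_top _).lt_top]),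
        integral_toReal (hmeas a).aemeasurable (by simp [(negExp_ne_top _).lt_top]), h a]
    | zero => simp
    | add f g _ _ hf hg =>
      simp only [BoundedContinuousFunction.coe_add, Pi.add_apply]
      rw [integral_add (f.integrable _) (g.integrable _),
        integral_add (f.integrable _) (g.integrable _), hf, hg]
    | smul c f _ hf =>
      simp only [BoundedContinuousFunction.coe_smul]
      rw [integral_smul, integral_smul, hf]

end Laplace

/-! ### Laws of random finite measures. -/

section RandomMeasure

variable {E : Type*} [mE : MeasurableSpace E]

/-- Two finite measures on the space of measures on `E`, both carried by the finite measures, are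
equal as soon as the joint Laplace transforms of the masses of finitely many members of a
generating π-system agree. -/
theorem law_ext_of_laplace {S : Set (Set E)} (hgen : mE = MeasurableSpace.generateFrom S)
    (hpi : IsPiSystem S) (huniv : Set.univ ∈ S) {m₁ m₂ : Measure (Measure E)}
    [IsFiniteMeasure m₁] [IsFiniteMeasure m₂]
    (h₁ : ∀ᵐ ξ ∂m₁, ξ Set.univ ≠ ∞) (h₂ : ∀ᵐ ξ ∂m₂, ξ Set.univ ≠ ∞)
    (h : ∀ (I : Finset S) (a : I → ℕ), ∫⁻ ξ, negExp (∑ i, a i * ξ i.1.1) ∂m₁ =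
      ∫⁻ ξ, negExp (∑ i, a i * ξ i.1.1) ∂m₂) : m₁ = m₂ := by
  have hSm : ∀ s ∈ S, MeasurableSet s := fun s hs => by
    rw [hgen]; exact MeasurableSpace.measurableSet_generateFrom hs
  let J : Measure E → (S → ℝ≥0∞) := fun ξ s => ξ s.1
  have hJ : Measurable J := measurable_pi_lambda _ fun s => Measure.measurable_coe (hSm _ s.2)
  have hmap : m₁.map J = m₂.map J := by
    -- The finite-dimensional marginals determine the law of the family of masses, and each marginal
    -- is determined by its Laplace transform.
    refine IsProjectiveLimit.unique (P := fun I => (m₂.map J).map I.restrict) ?_ (fun I => rfl)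
    intro I
    change _ = (m₂.map J).map I.restrict
    rw [Measure.map_map (by fun_prop) hJ, Measure.map_map (by fun_prop) hJ]
    have hIJ : Measurable (I.restrict ∘ J) := (by fun_prop : Measurable I.restrict).comp hJ
    refine ext_of_laplace fun a => ?_
    rw [lintegral_map (by fun_prop) hIJ, lintegral_map (by fun_prop) hIJ]
    exact h I a
  let F := {ξ : Measure E // ξ Set.univ ≠ ∞}
  have hF : MeasurableSet {ξ : Measure E | ξ Set.univ ≠ ∞} :=
    (Measure.measurable_coe .univ) (MeasurableSet.singleton ∞).compl
  let JF : F → (S → ℝ≥0∞) := fun ξ => J ξ.1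
  -- On finite measures the masses of a generating π-system generate the whole σ-algebra. So every
  -- measurable set of finite measures is a preimage under the family of masses.
  have hval : @Measurable F (Measure E) (MeasurableSpace.comap JF inferInstance) _ Subtype.val := by
    let _ : MeasurableSpace F := MeasurableSpace.comap JF inferInstance
    have : ∀ ξ : F, IsFiniteMeasure ξ.1 := fun ξ => ⟨ξ.2.lt_top⟩
    have hJF : Measurable JF := comap_measurable JF
    have hs : ∀ s (hs : s ∈ S), Measurable fun ξ : F => ξ.1 s := fun s hs =>
      (measurable_pi_apply (⟨s, hs⟩ : S)).comp hJF
    exact Measurable.measure_of_isPiSystem hgen hpi hs (hs _ huniv)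
  ext T hT
  obtain ⟨B, hB, hBT⟩ := hval hT
  have key : ∀ ξ : Measure E, ξ Set.univ ≠ ∞ → (ξ ∈ T ↔ J ξ ∈ B) := fun ξ hξ => by
    have : (⟨ξ, hξ⟩ : F) ∈ JF ⁻¹' B ↔ (⟨ξ, hξ⟩ : F) ∈ Subtype.val ⁻¹' T := by rw [hBT]
    exact this.symm
  have e₁ : m₁ T = m₁ (J ⁻¹' B) := measure_congr (by
    filter_upwards [h₁] with ξ hξ using propext (key ξ hξ))
  have e₂ : m₂ T = m₂ (J ⁻¹' B) := measure_congr (by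
    filter_upwards [h₂] with ξ hξ using propext (key ξ hξ))
  rw [e₁, e₂, ← Measure.map_apply hJ hB, ← Measure.map_apply hJ hB, hmap]

end RandomMeasure

/-! ### Generating functions of the Poisson distribution. -/

lemma negExp_mul_natCast (c : ℝ≥0∞) (n : ℕ) : negExp (c * n) = negExp c ^ n := by
  induction n with
  | zero => simp
  | succ n ih => rw [Nat.cast_succ, mul_add, negExp_add, ih, mul_one, pow_succ]

/-- The probability generating function of the Poisson distribution. -/
lemma tsum_pow_mul_poisson {m : ℝ} (hm : 0 ≤ m) {q : ℝ≥0∞} (hq : q ≤ 1) :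
    ∑' n : ℕ, q ^ n * ENNReal.ofReal (Real.exp (-m) * m ^ n / n.factorial) =
      negExp (ENNReal.ofReal m * (1 - q)) := by
  lift q to ℝ≥0 using (hq.trans_lt ENNReal.one_lt_top).ne
  have hq' : (q : ℝ) ≤ 1 := by exact_mod_cast hq
  have hs : HasSum (fun n : ℕ => Real.exp (-m) * ((q * m) ^ n / n.factorial))
      (Real.exp (-m) * Real.exp (q * m)) := by
    rw [Real.exp_eq_exp_ℝ]
    exact (NormedSpace.expSeries_div_hasSum_exp ((q : ℝ) * m)).mul_left _
  have h1 : ∀ n : ℕ, (q : ℝ≥0∞) ^ n * ENNReal.ofReal (Real.exp (-m) * m ^ n / n.factorial) =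
      ENNReal.ofReal (Real.exp (-m) * ((q * m) ^ n / n.factorial)) := by
    intro n
    rw [← ENNReal.ofReal_coe_nnreal, ← ENNReal.ofReal_pow (by positivity),
      ← ENNReal.ofReal_mul (by positivity)]
    congr 1
    rw [mul_pow]; ring
  simp_rw [h1]
  rw [← ENNReal.ofReal_tsum_of_nonneg (fun n => by positivity) hs.summable, hs.tsum_eq,
    ← Real.exp_add, ← ENNReal.ofReal_coe_nnreal, ← ENNReal.ofReal_one,
    ← ENNReal.ofReal_sub _ q.coe_nonneg, ← ENNReal.ofReal_mul hm,
    negExp_ofReal (mul_nonneg hm (by linarith))]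
  congr 2; ring

/-- The size-biased probability generating function of the Poisson distribution. -/
lemma tsum_mul_pow_mul_poisson {m : ℝ} (hm : 0 ≤ m) {q : ℝ≥0∞} (hq : q ≤ 1) :
    ∑' n : ℕ, n * q ^ (n - 1) * ENNReal.ofReal (Real.exp (-m) * m ^ n / n.factorial) =
      ENNReal.ofReal m * negExp (ENNReal.ofReal m * (1 - q)) := by
  -- The term `n = 0` vanishes, and `n * m^n / n! = m * m^(n-1) / (n-1)!` turns the rest into the
  -- ordinary generating function.
  rw [tsum_eq_zero_add' ENNReal.summable, ← tsum_pow_mul_poisson hm hq, ← ENNReal.tsum_mul_left]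
  simp only [Nat.cast_zero, zero_mul, zero_add, Nat.add_sub_cancel]
  refine tsum_congr fun n => ?_
  rw [mul_comm ((n + 1 : ℕ) : ℝ≥0∞), mul_assoc, mul_left_comm (ENNReal.ofReal m),
    ← ENNReal.ofReal_mul hm, ← ENNReal.ofReal_natCast, ← ENNReal.ofReal_mul (by positivity)]
  congr 2
  rw [Nat.factorial_succ]
  push_cast
  field_simp
  ring

/-! ### Counts of a Poisson process in disjoint sets. -/

section Poisson

variable {Ω : Type*} [MeasurableSpace Ω]

/-- The intensity measure of a homogeneous Poisson process. -/
def intensity (lam : ℝ) : Measure Plane := ENNReal.ofReal lam • volume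

instance (lam : ℝ) : SFinite (intensity lam) := by unfold intensity; infer_instance

lemma intensity_ne_top (lam : ℝ) {B : Set Plane} (hB : volume B ≠ ∞) : intensity lam B ≠ ∞ := by
  simpa [intensity] using ENNReal.mul_ne_top ENNReal.ofReal_ne_top hB

omit [MeasurableSpace Ω] in
lemma pointMeasure_apply (X : ℕ → Ω → Plane) (ω : Ω) {B : Set Plane} (hB : MeasurableSet B) :
    pointMeasure X ω B = ∑' i, B.indicator 1 (X i ω) := by
  simp [pointMeasure, Measure.sum_apply _ hB, Measure.dirac_apply' _ hB]

lemma measurable_pointMeasure {X : ℕ → Ω → Plane} (hX : ∀ i, Measurable (X i)) {B : Set Plane}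
    (hB : MeasurableSet B) : Measurable fun ω => pointMeasure X ω B := by
  simp_rw [pointMeasure_apply X _ hB]
  exact .tsum fun i => (measurable_one.indicator hB).comp (hX i)

namespace IsPoissonProcess

variable {P : Measure Ω} [IsProbabilityMeasure P] {lam : ℝ} {X : ℕ → Ω → Plane}

/-- Expectations of functions of the number of points in a set of finite volume. -/
lemma lintegral_count (hlam : 0 ≤ lam) (hX : IsPoissonProcess P lam X) {B : Set Plane}
    (hB : MeasurableSet B) (hBf : volume B ≠ ∞) (h : ℝ≥0∞ → ℝ≥0∞) :
    ∫⁻ ω, h (pointMeasure X ω B) ∂P = ∑' n : ℕ, h n * ENNReal.ofReal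
      (Real.exp (-(lam * (volume B).toReal)) * (lam * (volume B).toReal) ^ n / n.factorial) := by
  set s : ℕ → Set Ω := fun n => {ω | pointMeasure X ω B = n} with hs
  have hsm : ∀ n, MeasurableSet (s n) := fun n =>
    measurable_pointMeasure hX.measurable hB (MeasurableSet.singleton _)
  have hd : Pairwise (Function.onFun Disjoint s) := by
    intro i j hij
    refine Set.disjoint_left.2 fun ω hi hj => hij ?_
    have : (i : ℝ≥0∞) = j := hi.symm.trans hj
    exact_mod_cast this
  have hm : 0 ≤ lam * (volume B).toReal := mul_nonneg hlam ENNReal.toReal_nonneg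
  -- The Poisson weights sum to `1` (the generating function at `q = 1`), so the count is almost
  -- surely a natural number.
  have hfull : P (⋃ n, s n)ᶜ = 0 := by
    rw [prob_compl_eq_zero_iff (MeasurableSet.iUnion hsm), measure_iUnion hd hsm]
    simp_rw [hs, hX.law B hB hBf]
    simpa using tsum_pow_mul_poisson hm le_rfl
  have : ∫⁻ ω, h (pointMeasure X ω B) ∂P = ∫⁻ ω in ⋃ n, s n, h (pointMeasure X ω B) ∂P := by
    rw [Measure.restrict_eq_self_of_ae_mem]
    exact measure_eq_zero_iff_ae_notMem.1 hfull |>.mono fun ω hω => by simpa using hω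
  rw [this, lintegral_iUnion hsm hd]
  refine tsum_congr fun n => ?_
  rw [setLIntegral_congr_fun (hsm n) (g := fun _ => h n) (fun ω hω => by
    have : pointMeasure X ω B = n := hω
    simp only [this]), setLIntegral_const, hX.law B hB hBf]

lemma ofReal_mul_volume (hlam : 0 ≤ lam) {B : Set Plane} (hBf : volume B ≠ ∞) :
    ENNReal.ofReal (lam * (volume B).toReal) = intensity lam B := by
  rw [ENNReal.ofReal_mul hlam, ENNReal.ofReal_toReal hBf]
  rfl

lemma lintegral_negExp_count (hlam : 0 ≤ lam) (hX : IsPoissonProcess P lam X) {B : Set Plane}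
    (hB : MeasurableSet B) (hBf : volume B ≠ ∞) (c : ℝ≥0∞) :
    ∫⁻ ω, negExp (c * pointMeasure X ω B) ∂P = negExp (intensity lam B * (1 - negExp c)) := by
  rw [hX.lintegral_count hlam hB hBf (fun x => negExp (c * x))]
  simp_rw [negExp_mul_natCast]
  rw [tsum_pow_mul_poisson (mul_nonneg hlam ENNReal.toReal_nonneg) (negExp_le_one c),
    ofReal_mul_volume hlam hBf]

/-- Mecke's formula for a single cell: choosing a point and discarding it from the count leaves a
Poisson variable. The truncated difference at count `0` is harmless because the factor in front
vanishes. -/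
lemma lintegral_count_mul_negExp (hlam : 0 ≤ lam) (hX : IsPoissonProcess P lam X) {B : Set Plane}
    (hB : MeasurableSet B) (hBf : volume B ≠ ∞) (c : ℝ≥0∞) :
    ∫⁻ ω, pointMeasure X ω B * negExp (c * (pointMeasure X ω B - 1)) ∂P =
      intensity lam B * negExp (intensity lam B * (1 - negExp c)) := by
  rw [hX.lintegral_count hlam hB hBf (fun x => x * negExp (c * (x - 1)))]
  have : ∀ n : ℕ, (n : ℝ≥0∞) - 1 = ((n - 1 : ℕ) : ℝ≥0∞) := fun n => by
    rw [ENNReal.natCast_sub]; simp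
  simp_rw [this, negExp_mul_natCast]
  rw [tsum_mul_pow_mul_poisson (mul_nonneg hlam ENNReal.toReal_nonneg) (negExp_le_one c),
    ofReal_mul_volume hlam hBf]

/-- At `c = 0` the size-biased identity says that the mean count is the intensity of the set, which
is finite. -/
lemma ae_count_ne_top (hlam : 0 ≤ lam) (hX : IsPoissonProcess P lam X) {B : Set Plane}
    (hB : MeasurableSet B) (hBf : volume B ≠ ∞) : ∀ᵐ ω ∂P, pointMeasure X ω B ≠ ∞ := by
  have h := hX.lintegral_count_mul_negExp hlam hB hBf 0
  simp only [zero_mul, negExp_zero, mul_one, tsub_self, mul_zero] at h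
  refine (ae_lt_top (measurable_pointMeasure hX.measurable hB) ?_).mono fun ω hω => hω.ne
  rw [h]
  exact intensity_ne_top lam hBf

omit [IsProbabilityMeasure P] in
/-- The numbers of points in disjoint sets are independent. -/
lemma lintegral_prod_count (hX : IsPoissonProcess P lam X) {β : Type*} [Fintype β]
    {B : β → Set Plane} (hB : ∀ i, MeasurableSet (B i)) (hd : Pairwise (Function.onFun Disjoint B))
    {h : β → ℝ≥0∞ → ℝ≥0∞} (hh : ∀ i, Measurable (h i)) :
    ∫⁻ ω, ∏ i, h i (pointMeasure X ω (B i)) ∂P =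
      ∏ i, ∫⁻ ω, h i (pointMeasure X ω (B i)) ∂P := by
  let e := Fintype.equivFin β
  have hi := hX.indep _ (fun j => B (e.symm j)) (fun j => hB _)
    (fun i j hij => hd (e.symm.injective.ne hij))
  have hi' : iIndepFun (fun i ω => pointMeasure X ω (B i)) P := by
    have := hi.precomp e.injective
    simpa [Function.comp_def] using this
  exact lintegral_prod_eq_prod_lintegral_of_indepFun Finset.univ _ (hi'.comp h hh)
    fun i => (hh i).comp (measurable_pointMeasure hX.measurable (hB i))

lemma lintegral_negExp_sum_count (hlam : 0 ≤ lam) (hX : IsPoissonProcess P lam X) {β : Type*}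
    [Fintype β] {B : β → Set Plane} (hB : ∀ i, MeasurableSet (B i)) (hBf : ∀ i, volume (B i) ≠ ∞)
    (hd : Pairwise (Function.onFun Disjoint B)) (c : β → ℝ≥0∞) :
    ∫⁻ ω, negExp (∑ i, c i * pointMeasure X ω (B i)) ∂P =
      negExp (∑ i, intensity lam (B i) * (1 - negExp (c i))) := by
  simp_rw [negExp_sum]
  rw [hX.lintegral_prod_count hB hd (h := fun i x => negExp (c i * x)) (fun i => by fun_prop)]
  exact Finset.prod_congr rfl fun i _ => hX.lintegral_negExp_count hlam (hB i) (hBf i) _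

/-- Mecke's formula for the numbers of points in disjoint sets. -/
lemma lintegral_count_mul_negExp_sum (hlam : 0 ≤ lam) (hX : IsPoissonProcess P lam X) {β : Type*}
    [Fintype β] [DecidableEq β] {B : β → Set Plane} (hB : ∀ i, MeasurableSet (B i))
    (hBf : ∀ i, volume (B i) ≠ ∞) (hd : Pairwise (Function.onFun Disjoint B)) (c : β → ℝ≥0∞)
    (i₀ : β) :
    ∫⁻ ω, pointMeasure X ω (B i₀) * negExp (∑ i, c i *
        (if i = i₀ then pointMeasure X ω (B i) - 1 else pointMeasure X ω (B i))) ∂P =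
      intensity lam (B i₀) * ∫⁻ ω, negExp (∑ i, c i * pointMeasure X ω (B i)) ∂P := by
  -- The integrand factorises over the cells, and only the cell `i₀` carries a size-biased factor.
  have h1 : ∀ ω, pointMeasure X ω (B i₀) * negExp (∑ i, c i *
        (if i = i₀ then pointMeasure X ω (B i) - 1 else pointMeasure X ω (B i))) =
      ∏ i, (if i = i₀ then fun x => x * negExp (c i * (x - 1)) else fun x => negExp (c i * x))
        (pointMeasure X ω (B i)) := by
    intro ω
    rw [negExp_sum, ← Finset.mul_prod_erase _ _ (Finset.mem_univ i₀), ← mul_assoc,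
      ← Finset.mul_prod_erase _ _ (Finset.mem_univ i₀)]
    simp only [if_true]
    congr 1
    refine Finset.prod_congr rfl fun i hi => ?_
    simp [Finset.ne_of_mem_erase hi]
  simp_rw [h1]
  rw [hX.lintegral_prod_count hB hd (h := fun i => if i = i₀ then
      fun x => x * negExp (c i * (x - 1)) else fun x => negExp (c i * x))
      (fun i => by split_ifs <;> fun_prop),
    hX.lintegral_negExp_sum_count hlam hB hBf hd, negExp_sum,
    ← Finset.mul_prod_erase _ _ (Finset.mem_univ i₀),
    ← Finset.mul_prod_erase _ _ (Finset.mem_univ i₀), ← mul_assoc]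
  congr 1
  · simp only [if_true]
    exact hX.lintegral_count_mul_negExp hlam (hB _) (hBf _) _
  · refine Finset.prod_congr rfl fun i hi => ?_
    simp only [Finset.ne_of_mem_erase hi, if_false]
    exact hX.lintegral_negExp_count hlam (hB i) (hBf i) _

end IsPoissonProcess

end Poisson

/-! ### Step functions and the Laplace functional. -/

section Poisson

variable {Ω : Type*} [MeasurableSpace Ω]

namespace IsPoissonProcess

variable {P : Measure Ω} [IsProbabilityMeasure P] {lam : ℝ} {X : ℕ → Ω → Plane}

lemma tsum_eq_add_tsum_ite_nat (f : ℕ → ℝ≥0∞) (k : ℕ) :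
    ∑' m, f m = f k + ∑' m, if m = k then 0 else f m := by
  convert ENNReal.tsum_eq_add_tsum_ite (f := f) k

section Cells

variable {β : Type*} [Fintype β] [MeasurableSpace β] [MeasurableSingletonClass β]
  {b : Plane → β} {W : Set Plane}

omit [MeasurableSpace β] [MeasurableSingletonClass β] in
lemma indicator_eq_sum_cells (W : Set Plane) (b : Plane → β) (c : β → ℝ≥0∞) (z : Plane) :
    W.indicator (fun z => c (b z)) z = ∑ i, c i * (W ∩ b ⁻¹' {i}).indicator 1 z := by
  classical
  by_cases hz : z ∈ W
  · rw [Set.indicator_of_mem hz, Finset.sum_eq_single (b z)]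
    · simp [hz]
    · intro i _ hi
      simp [Set.indicator, hi.symm]
    · simp
  · simp [hz]

omit [Fintype β] in
lemma measurableSet_cell (hb : Measurable b) (hW : MeasurableSet W) (i : β) :
    MeasurableSet (W ∩ b ⁻¹' {i}) := hW.inter (hb (measurableSet_singleton i))

omit [Fintype β] [MeasurableSpace β] [MeasurableSingletonClass β] in
lemma disjoint_cells (W : Set Plane) (b : Plane → β) :
    Pairwise (Function.onFun Disjoint fun i => W ∩ b ⁻¹' {i}) := by
  intro i j hij
  refine Set.disjoint_left.2 fun z hz hz' => hij ?_
  exact (hz.2 : b z = i).symm.trans hz'.2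

omit [MeasurableSpace Ω] in
lemma tsum_indicator_eq_sum_count (hb : Measurable b) (hW : MeasurableSet W) (c : β → ℝ≥0∞)
    (ω : Ω) : ∑' m, W.indicator (fun z => c (b z)) (X m ω) =
      ∑ i, c i * pointMeasure X ω (W ∩ b ⁻¹' {i}) := by
  simp_rw [indicator_eq_sum_cells W b c]
  rw [Summable.tsum_finsetSum fun _ _ => ENNReal.summable]
  refine Finset.sum_congr rfl fun i _ => ?_
  rw [ENNReal.tsum_mul_left, pointMeasure_apply X ω (measurableSet_cell hb hW i)]

/-- The Laplace functional of a function with finitely many values on a set of finite volume. -/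
lemma laplace_cells (hlam : 0 ≤ lam) (hX : IsPoissonProcess P lam X) (hb : Measurable b)
    (hW : MeasurableSet W) (hWf : volume W ≠ ∞) (c : β → ℝ≥0∞) :
    ∫⁻ ω, negExp (∑' m, W.indicator (fun z => c (b z)) (X m ω)) ∂P =
      negExp (∫⁻ z, (1 - negExp (W.indicator (fun z => c (b z)) z)) ∂intensity lam) := by
  have hm := measurableSet_cell hb hW
  simp_rw [tsum_indicator_eq_sum_count hb hW]
  rw [hX.lintegral_negExp_sum_count hlam hm
    (fun i => ne_top_of_le_ne_top hWf (measure_mono Set.inter_subset_left)) (disjoint_cells W b)]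
  congr 1
  have : ∀ z, 1 - negExp (W.indicator (fun z => c (b z)) z) =
      ∑ i, (1 - negExp (c i)) * (W ∩ b ⁻¹' {i}).indicator 1 z := by
    intro z
    rw [← indicator_eq_sum_cells W b (fun i => 1 - negExp (c i))]
    by_cases hz : z ∈ W <;> simp [hz]
  simp_rw [this]
  rw [lintegral_finsetSum _ fun i _ => (measurable_one.indicator (hm i)).const_mul _]
  refine Finset.sum_congr rfl fun i _ => ?_
  rw [lintegral_const_mul _ (measurable_one.indicator (hm i)), lintegral_indicator_one (hm i),
    mul_comm]

/-- Mecke's formula for functions with finitely many values on a set of finite volume. -/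
lemma mecke_cells (hlam : 0 ≤ lam) (hX : IsPoissonProcess P lam X) (hb : Measurable b)
    (hW : MeasurableSet W) (hWf : volume W ≠ ∞) (g : β → ℝ≥0∞) (c : β → β → ℝ≥0∞) :
    ∑' k, ∫⁻ ω, W.indicator (fun z => g (b z)) (X k ω) * negExp (∑' m, if m = k then 0 else
        W.indicator (fun z => c (b (X k ω)) (b z)) (X m ω)) ∂P =
      ∫⁻ y, W.indicator (fun y => g (b y) *
        ∫⁻ ω, negExp (∑' m, W.indicator (fun z => c (b y) (b z)) (X m ω)) ∂P) y
          ∂intensity lam := by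
  classical
  have hm := measurableSet_cell hb hW
  have hN := fun i => measurable_pointMeasure hX.measurable (hm i)
  simp_rw [tsum_indicator_eq_sum_count hb hW]
  set B : β → Set Plane := fun i => W ∩ b ⁻¹' {i} with hB
  have hBf : ∀ i, volume (B i) ≠ ∞ := fun i =>
    ne_top_of_le_ne_top hWf (measure_mono Set.inter_subset_left)
  -- Leaving out the index `k` lowers the count of its own cell by one and leaves the other counts
  -- alone. Since indices rather than positions are removed, coinciding points would cause no error.
  have hrest : ∀ k i ω, X k ω ∈ B i → (∑' m, if m = k then 0 else
      W.indicator (fun z => c (b (X k ω)) (b z)) (X m ω)) = ∑ j, c i j *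
        (if j = i then pointMeasure X ω (B j) - 1 else pointMeasure X ω (B j)) := by
    intro k i ω hk
    have hbk : b (X k ω) = i := hk.2
    have h1 : ∀ m, (if m = k then 0 else W.indicator (fun z => c (b (X k ω)) (b z)) (X m ω)) =
        ∑ j, c i j * (if m = k then 0 else (B j).indicator 1 (X m ω)) := by
      intro m
      split_ifs
      · simp
      · rw [hbk]
        exact indicator_eq_sum_cells W b (c i) (X m ω)
    simp_rw [h1]
    rw [Summable.tsum_finsetSum fun _ _ => ENNReal.summable]
    refine Finset.sum_congr rfl fun j _ => ?_
    rw [ENNReal.tsum_mul_left]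
    congr 1
    have hp : pointMeasure X ω (B j) = (B j).indicator 1 (X k ω) +
        ∑' m, if m = k then 0 else (B j).indicator 1 (X m ω) := by
      rw [pointMeasure_apply X ω (hm j)]
      exact tsum_eq_add_tsum_ite_nat (fun m => (B j).indicator 1 (X m ω)) k
    rw [hp]
    split_ifs with hj
    · subst hj
      rw [Set.indicator_of_mem hk, Pi.one_apply, ENNReal.add_sub_cancel_left ENNReal.one_ne_top]
    · rw [Set.indicator_of_notMem, zero_add]
      intro h
      exact hj ((h.2 : b (X k ω) = j).symm.trans hbk)
  have h2 : ∀ k ω, W.indicator (fun z => g (b z)) (X k ω) * negExp (∑' m, if m = k then 0 else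
        W.indicator (fun z => c (b (X k ω)) (b z)) (X m ω)) =
      ∑ i, (B i).indicator 1 (X k ω) * (g i * negExp (∑ j, c i j *
        (if j = i then pointMeasure X ω (B j) - 1 else pointMeasure X ω (B j)))) := by
    intro k ω
    rw [indicator_eq_sum_cells W b g, Finset.sum_mul]
    refine Finset.sum_congr rfl fun i _ => ?_
    by_cases hk : X k ω ∈ B i
    · rw [hrest k i ω hk, mul_comm (g i), mul_assoc]
    · have : (W ∩ b ⁻¹' {i}).indicator (1 : Plane → ℝ≥0∞) (X k ω) = 0 :=
        Set.indicator_of_notMem hk _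
      simp [hB, this]
  have hF : ∀ i, Measurable fun ω => g i * negExp (∑ j, c i j *
        (if j = i then pointMeasure X ω (B j) - 1 else pointMeasure X ω (B j))) := by
    intro i
    refine (measurable_negExp.comp (Finset.measurable_fun_sum _ fun j _ => ?_)).const_mul _
    split_ifs
    · exact ((hN j).sub_const _).const_mul _
    · exact (hN j).const_mul _
  have hI : ∀ k i, Measurable fun ω => (B i).indicator (1 : Plane → ℝ≥0∞) (X k ω) := fun k i =>
    (measurable_one.indicator (hm i)).comp (hX.measurable k)
  simp_rw [h2]
  rw [← lintegral_tsum (f := fun k ω => ∑ i, (B i).indicator 1 (X k ω) *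
      (g i * negExp (∑ j, c i j *
        (if j = i then pointMeasure X ω (B j) - 1 else pointMeasure X ω (B j)))))
    fun k => (Finset.measurable_fun_sum _ fun i _ => (hI k i).mul (hF i)).aemeasurable]
  -- Summed over `k`, the indicators of `X k` lying in a cell give back the count of that cell, so
  -- the identity for counts becomes applicable.
  have h5 : ∀ ω, ∑' k, ∑ i, (B i).indicator 1 (X k ω) * (g i * negExp (∑ j, c i j *
        (if j = i then pointMeasure X ω (B j) - 1 else pointMeasure X ω (B j)))) =
      ∑ i, pointMeasure X ω (B i) * (g i * negExp (∑ j, c i j *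
        (if j = i then pointMeasure X ω (B j) - 1 else pointMeasure X ω (B j)))) := by
    intro ω
    rw [Summable.tsum_finsetSum fun _ _ => ENNReal.summable]
    refine Finset.sum_congr rfl fun i _ => ?_
    rw [ENNReal.tsum_mul_right, pointMeasure_apply X ω (hm i)]
  simp_rw [h5]
  rw [lintegral_finsetSum (f := fun i ω => pointMeasure X ω (B i) * (g i * negExp (∑ j, c i j *
        (if j = i then pointMeasure X ω (B j) - 1 else pointMeasure X ω (B j))))) _
      fun i _ => (hN i).mul (hF i)]
  have h3 : ∀ y, W.indicator (fun y => g (b y) *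
        ∫⁻ ω, negExp (∑ j, c (b y) j * pointMeasure X ω (B j)) ∂P) y =
      ∑ i, (g i * ∫⁻ ω, negExp (∑ j, c i j * pointMeasure X ω (B j)) ∂P) *
        (B i).indicator 1 y := fun y => indicator_eq_sum_cells W b
          (fun i => g i * ∫⁻ ω, negExp (∑ j, c i j * pointMeasure X ω (B j)) ∂P) y
  rw [lintegral_congr h3,
    lintegral_finsetSum _ fun i _ => (measurable_one.indicator (hm i)).const_mul _]
  refine Finset.sum_congr rfl fun i _ => ?_
  rw [lintegral_const_mul _ (measurable_one.indicator (hm i)), lintegral_indicator_one (hm i)]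
  have h4 := hX.lintegral_count_mul_negExp_sum hlam hm hBf (disjoint_cells W b) (c i) i
  rw [mul_assoc, mul_comm _ (intensity lam (B i)), ← h4, ← lintegral_const_mul]
  · refine lintegral_congr fun ω => ?_
    rw [mul_left_comm]
  · refine (hN i).mul (measurable_negExp.comp (Finset.measurable_fun_sum _ fun j _ => ?_))
    split_ifs
    · exact ((hN j).sub_const _).const_mul _
    · exact (hN j).const_mul _

end Cells

/-- Monotone convergence for the counting measure. -/
lemma tsum_iSup {ι : Type*} [Countable ι] {f : ℕ → ι → ℝ≥0∞} (hf : Monotone f) :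
    ∑' i, ⨆ n, f n i = ⨆ n, ∑' i, f n i := by
  let _ : MeasurableSpace ι := ⊤
  simp_rw [← MeasureTheory.lintegral_count]
  exact lintegral_iSup (fun n => measurable_from_top) hf

/-- The exhaustion of the plane by discs. -/
def window (n : ℕ) : Set Plane := Metric.closedBall 0 n

lemma measurableSet_window (n : ℕ) : MeasurableSet (window n) := measurableSet_closedBall

lemma volume_window (n : ℕ) : volume (window n) ≠ ∞ := measure_closedBall_lt_top.ne

lemma window_mono : Monotone window := fun m n h =>
  Metric.closedBall_subset_closedBall (by exact_mod_cast h)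

lemma exists_mem_window (z : Plane) : ∃ n, z ∈ window n := by
  obtain ⟨n, hn⟩ := exists_nat_ge ‖z‖
  exact ⟨n, by simpa [window] using hn⟩

lemma monotone_indicator_window {f : ℕ → Plane → ℝ≥0∞} (hf : Monotone f) :
    Monotone fun n => (window n).indicator (f n) := by
  intro m n h z
  by_cases hz : z ∈ window m
  · simpa [hz, window_mono h hz] using hf h z
  · simp [hz]

lemma iSup_indicator_window {f : ℕ → Plane → ℝ≥0∞} (hf : Monotone f) (z : Plane) :
    ⨆ n, (window n).indicator (f n) z = ⨆ n, f n z := by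
  apply le_antisymm
  · exact iSup_mono fun n => Set.indicator_le_self _ _ _
  · obtain ⟨N, hN⟩ := exists_mem_window z
    refine iSup_le fun n => le_iSup_of_le (max n N) ?_
    rw [Set.indicator_of_mem (window_mono (le_max_right n N) hN)]
    exact hf (le_max_left n N) z

/-- The Laplace functional of a Poisson process. -/
theorem laplace (hlam : 0 ≤ lam) (hX : IsPoissonProcess P lam X) {φ : Plane → ℝ≥0∞}
    (hφ : Measurable φ) :
    ∫⁻ ω, negExp (∑' m, φ (X m ω)) ∂P =
      negExp (∫⁻ z, (1 - negExp (φ z)) ∂intensity lam) := by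
  -- Simple approximations cut off to discs have finitely many values and support of finite volume,
  -- and still increase to `φ`.
  set f : ℕ → Plane → ℝ≥0∞ := fun n => (window n).indicator (SimpleFunc.eapprox φ n) with hf
  have hmono0 : Monotone fun n => (SimpleFunc.eapprox φ n : Plane → ℝ≥0∞) :=
    fun m n h => SimpleFunc.monotone_eapprox φ h
  have hmono : Monotone f := monotone_indicator_window hmono0
  have hsup : ∀ z, φ z = ⨆ n, f n z := fun z => by
    rw [iSup_indicator_window hmono0, SimpleFunc.iSup_eapprox_apply hφ]
  have hfm : ∀ n, Measurable (f n) := fun n =>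
    (SimpleFunc.eapprox φ n).measurable.indicator (measurableSet_window n)
  have hstep : ∀ n, ∫⁻ ω, negExp (∑' m, f n (X m ω)) ∂P =
      negExp (∫⁻ z, (1 - negExp (f n z)) ∂intensity lam) := by
    intro n
    let s := SimpleFunc.eapprox φ n
    -- The cells are the level sets of the simple function, labelled by its values.
    exact hX.laplace_cells hlam (b := fun z => (⟨s z, s.mem_range_self z⟩ : s.range))
      (s.measurable.subtype_mk) (measurableSet_window n) (volume_window n) Subtype.val
  have h1 : ∀ ω, negExp (∑' m, φ (X m ω)) = ⨅ n, negExp (∑' m, f n (X m ω)) := by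
    intro ω
    simp_rw [hsup]
    rw [tsum_iSup (f := fun n m => f n (X m ω)) (fun i j h m => hmono h _), negExp_iSup]
    exact fun i j h => ENNReal.tsum_le_tsum fun m => hmono h _
  have h2 : ∫⁻ z, (1 - negExp (φ z)) ∂intensity lam =
      ⨆ n, ∫⁻ z, (1 - negExp (f n z)) ∂intensity lam := by
    rw [← lintegral_iSup]
    · refine lintegral_congr fun z => ?_
      rw [hsup, negExp_iSup fun i j h => hmono h z, ENNReal.sub_iInf]
    · exact fun n => (measurable_negExp.comp (hfm n)).const_sub _
    · exact fun i j h z => tsub_le_tsub_left (antitone_negExp (hmono h z)) _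
  simp_rw [h1]
  rw [lintegral_iInf, h2, negExp_iSup]
  · simp_rw [hstep]
  · exact fun i j h => lintegral_mono fun z => tsub_le_tsub_left (antitone_negExp (hmono h z)) _
  · exact fun n => measurable_negExp.comp (.tsum fun m => (hfm n).comp (hX.measurable m))
  · exact fun i j h ω => antitone_negExp (ENNReal.tsum_le_tsum fun m => hmono h _)
  · refine ne_top_of_le_ne_top ENNReal.one_ne_top ?_
    calc _ ≤ ∫⁻ _, 1 ∂P := lintegral_mono fun ω => negExp_le_one _
      _ = 1 := by simp

end IsPoissonProcess

end Poisson

/-! ### Configurations whose points are paired with an observer. -/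

section PairMeasure

/-- The measure `∑ₘ wₘ δ_{(y, zₘ)}`. -/
def pairMeasure (y : Plane) (w : ℕ → ℝ≥0∞) (z : ℕ → Plane) : Measure (Plane × Plane) :=
  Measure.sum fun m => w m • Measure.dirac (y, z m)

lemma lintegral_pairMeasure (y : Plane) (w : ℕ → ℝ≥0∞) (z : ℕ → Plane)
    {ψ : Plane × Plane → ℝ≥0∞} (hψ : Measurable ψ) :
    ∫⁻ q, ψ q ∂pairMeasure y w z = ∑' m, w m * ψ (y, z m) := by
  simp [pairMeasure, lintegral_sum_measure, lintegral_dirac' _ hψ]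

lemma pairMeasure_apply (y : Plane) (w : ℕ → ℝ≥0∞) (z : ℕ → Plane) {A : Set (Plane × Plane)}
    (hA : MeasurableSet A) : pairMeasure y w z A = ∑' m, w m * A.indicator 1 (y, z m) := by
  rw [← lintegral_indicator_one hA, lintegral_pairMeasure _ _ _ (measurable_one.indicator hA)]

lemma measurable_pairMeasure {α : Type*} [MeasurableSpace α] {y : α → Plane} {w : ℕ → α → ℝ≥0∞}
    {z : ℕ → α → Plane} (hy : Measurable y) (hw : ∀ m, Measurable (w m))
    (hz : ∀ m, Measurable (z m)) :
    Measurable fun a => pairMeasure (y a) (fun m => w m a) (fun m => z m a) := by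
  refine Measure.measurable_of_measurable_coe _ fun A hA => ?_
  simp_rw [pairMeasure_apply _ _ _ hA]
  exact .tsum fun m => (hw m).mul ((measurable_one.indicator hA).comp (hy.prodMk (hz m)))

end PairMeasure

/-! ### Mecke's formula in a window of finite volume. -/

section Poisson

variable {Ω : Type*} [MeasurableSpace Ω]

namespace IsPoissonProcess

variable {P : Measure Ω} [IsProbabilityMeasure P] {lam : ℝ} {X : ℕ → Ω → Plane}

omit [IsProbabilityMeasure P] in
lemma setLIntegral_eq_indicator_mul {D : Set Plane} (hD : MeasurableSet D) {Y : Ω → Plane}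
    (hY : Measurable Y) (F : Ω → ℝ≥0∞) :
    ∫⁻ ω in {ω | Y ω ∈ D}, F ω ∂P = ∫⁻ ω, D.indicator 1 (Y ω) * F ω ∂P := by
  have hm : MeasurableSet {ω | Y ω ∈ D} := hY hD
  rw [← lintegral_indicator hm]
  refine lintegral_congr fun ω => ?_
  by_cases h : Y ω ∈ D
  · rw [Set.indicator_of_mem (by exact h)]; simp [h]
  · rw [Set.indicator_of_notMem (by exact h)]; simp [h]

/-- The points of the process in `W`, each paired with `y`. -/
abbrev fullConfig (X : ℕ → Ω → Plane) (W : Set Plane) (y : Plane) (ω : Ω) :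
    Measure (Plane × Plane) :=
  pairMeasure y (fun m => W.indicator 1 (X m ω)) (fun m => X m ω)

/-- The points of the process in `W` other than the point with index `k`, each paired with
the latter. -/
abbrev reducedConfig (X : ℕ → Ω → Plane) (W : Set Plane) (k : ℕ) (ω : Ω) :
    Measure (Plane × Plane) :=
  pairMeasure (X k ω) (fun m => if m = k then 0 else W.indicator 1 (X m ω)) (fun m => X m ω)

lemma measurable_fullConfig (hX : ∀ i, Measurable (X i)) {W : Set Plane} (hW : MeasurableSet W) :
    Measurable fun q : Plane × Ω => fullConfig X W q.1 q.2 :=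
  measurable_pairMeasure measurable_fst
    (fun m => (measurable_one.indicator hW).comp ((hX m).comp measurable_snd))
    (fun m => (hX m).comp measurable_snd)

lemma measurable_reducedConfig (hX : ∀ i, Measurable (X i)) {W : Set Plane} (hW : MeasurableSet W)
    (k : ℕ) : Measurable (reducedConfig X W k) :=
  measurable_pairMeasure (w := fun m ω => if m = k then 0 else W.indicator 1 (X m ω)) (hX k)
    (fun m => by
      split_ifs
      · exact measurable_const
      · exact (measurable_one.indicator hW).comp (hX m)) hX

/-- Mecke's formula for the joint Laplace transforms of the masses of rectangles. -/
lemma mecke_rectangles (hlam : 0 ≤ lam) (hX : IsPoissonProcess P lam X) {D W : Set Plane}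
    (hD : MeasurableSet D) (hDW : D ⊆ W) (hW : MeasurableSet W) (hWf : volume W ≠ ∞)
    {I : Type*} [Fintype I] (a : I → ℝ≥0∞) {A : I → Set (Plane × Plane)}
    (hA : ∀ i, ∃ s t : Set Plane, MeasurableSet s ∧ MeasurableSet t ∧ s ×ˢ t = A i) :
    ∑' k, ∫⁻ ω, D.indicator 1 (X k ω) * negExp (∑ i, a i * reducedConfig X W k ω (A i)) ∂P =
      ∫⁻ y in D, ∫⁻ ω, negExp (∑ i, a i * fullConfig X W y ω (A i)) ∂P ∂intensity lam := by
  classical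
  choose s t hs ht hst using hA
  have hAm : ∀ i, MeasurableSet (A i) := fun i => hst i ▸ (hs i).prod (ht i)
  -- Membership in `D` and in the sides `s i`, `t i` labels finitely many cells. The indicator of
  -- each rectangle depends only on the labels of the two points.
  let b : Plane → Prop × (I → Prop × Prop) := fun y => (y ∈ D, fun i => (y ∈ s i, y ∈ t i))
  have hb : Measurable b :=
    (measurable_mem.2 hD).prodMk <| measurable_pi_lambda _ fun i =>
      (measurable_mem.2 (hs i)).prodMk (measurable_mem.2 (ht i))
  let g : Prop × (I → Prop × Prop) → ℝ≥0∞ := fun β => if β.1 then 1 else 0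
  let c : Prop × (I → Prop × Prop) → Prop × (I → Prop × Prop) → ℝ≥0∞ := fun β γ =>
    ∑ i, if (β.2 i).1 ∧ (γ.2 i).2 then a i else 0
  have hg : ∀ y, g (b y) = D.indicator 1 y := fun y => by simp [g, b, Set.indicator]
  have hgW : ∀ y, W.indicator (fun z => g (b z)) y = D.indicator 1 y := fun y => by
    by_cases hy : y ∈ W
    · rw [Set.indicator_of_mem hy, hg]
    · rw [Set.indicator_of_notMem hy, Set.indicator_of_notMem fun h => hy (hDW h)]
  have hc : ∀ y z, c (b y) (b z) = ∑ i, a i * (A i).indicator 1 (y, z) := fun y z => by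
    refine Finset.sum_congr rfl fun i _ => ?_
    rw [← hst i]
    simp [b, Set.indicator, Set.mem_prod]
  have key : ∀ (y : Plane) (w : ℕ → ℝ≥0∞) (z : ℕ → Plane),
      ∑ i, a i * pairMeasure y w z (A i) = ∑' m, w m * c (b y) (b (z m)) := by
    intro y w z
    simp_rw [pairMeasure_apply _ _ _ (hAm _), hc, Finset.mul_sum]
    rw [Summable.tsum_finsetSum fun _ _ => ENNReal.summable]
    refine Finset.sum_congr rfl fun i _ => ?_
    rw [← ENNReal.tsum_mul_left]
    exact tsum_congr fun m => by ring
  have hind : ∀ (y z : Plane), W.indicator 1 z * c (b y) (b z) =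
      W.indicator (fun z => c (b y) (b z)) z := fun y z => by
    by_cases hz : z ∈ W <;> simp [hz]
  have h := hX.mecke_cells hlam hb hW hWf g c
  simp_rw [hgW] at h
  simp_rw [fullConfig, reducedConfig, key, ite_mul, zero_mul, hind]
  rw [h, ← lintegral_indicator hD]
  refine lintegral_congr fun y => ?_
  by_cases hy : y ∈ D
  · rw [Set.indicator_of_mem hy, Set.indicator_of_mem (hDW hy), hg, Set.indicator_of_mem hy]
    simp
  · rw [Set.indicator_of_notMem hy]
    by_cases hyW : y ∈ W
    · rw [Set.indicator_of_mem hyW, hg, Set.indicator_of_notMem hy, zero_mul]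
    · rw [Set.indicator_of_notMem hyW]

/-- Mecke's formula in a window of finite volume. -/
theorem mecke_window (hlam : 0 ≤ lam) (hX : IsPoissonProcess P lam X) {D W : Set Plane}
    (hD : MeasurableSet D) (hDW : D ⊆ W) (hW : MeasurableSet W) (hWf : volume W ≠ ∞)
    {φ : Plane × Plane → ℝ≥0∞} (hφ : Measurable φ) :
    ∑' k, ∫⁻ ω, D.indicator 1 (X k ω) * negExp (∑' m, if m = k then 0 else
        W.indicator (fun z => φ (X k ω, z)) (X m ω)) ∂P =
      ∫⁻ y in D, ∫⁻ ω, negExp (∑' m, W.indicator (fun z => φ (y, z)) (X m ω)) ∂P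
        ∂intensity lam := by
  have hDf : volume D ≠ ∞ := ne_top_of_le_ne_top hWf (measure_mono hDW)
  have hmR := measurable_reducedConfig hX.measurable hW
  have hmF := measurable_fullConfig hX.measurable hW
  have hDk : ∀ k, MeasurableSet {ω | X k ω ∈ D} := fun k => hX.measurable k hD
  -- `m₁` is the law, summed over the points `X k` in `D`, of the remaining configuration; `m₂`
  -- describes the full configuration seen from an unrelated location `y`. Pairing every point with
  -- its observer makes `∑ φ (y, z)` the integral of the single function `φ` against the
  -- configuration, so equality of the two measures is all that is needed.
  let m₁ : Measure (Measure (Plane × Plane)) :=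
    Measure.sum fun k => (P.restrict {ω | X k ω ∈ D}).map (reducedConfig X W k)
  let m₂ : Measure (Measure (Plane × Plane)) :=
    (((intensity lam).restrict D).prod P).map fun q => fullConfig X W q.1 q.2
  have h₁ : ∀ F : Measure (Plane × Plane) → ℝ≥0∞, Measurable F →
      ∫⁻ ξ, F ξ ∂m₁ = ∑' k, ∫⁻ ω, D.indicator 1 (X k ω) * F (reducedConfig X W k ω) ∂P := by
    intro F hF
    rw [lintegral_sum_measure]
    refine tsum_congr fun k => ?_
    rw [lintegral_map hF (hmR k), setLIntegral_eq_indicator_mul hD (hX.measurable k)]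
  have h₂ : ∀ F : Measure (Plane × Plane) → ℝ≥0∞, Measurable F →
      ∫⁻ ξ, F ξ ∂m₂ = ∫⁻ y in D, ∫⁻ ω, F (fullConfig X W y ω) ∂P ∂intensity lam := by
    intro F hF
    rw [lintegral_map hF hmF]
    exact lintegral_prod _ (hF.comp hmF).aemeasurable
  have hrect : ∀ {I : Type} [Fintype I] (a : I → ℝ≥0∞) (A : I → Set (Plane × Plane)),
      (∀ i, ∃ s t : Set Plane, MeasurableSet s ∧ MeasurableSet t ∧ s ×ˢ t = A i) →
      ∫⁻ ξ, negExp (∑ i, a i * ξ (A i)) ∂m₁ = ∫⁻ ξ, negExp (∑ i, a i * ξ (A i)) ∂m₂ := by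
    intro I _ a A hA
    have hm : Measurable fun ξ : Measure (Plane × Plane) => negExp (∑ i, a i * ξ (A i)) :=
      measurable_negExp.comp (Finset.measurable_fun_sum _ fun i _ =>
        (Measure.measurable_coe (by
          obtain ⟨s, t, hs, ht, h⟩ := hA i
          exact h ▸ hs.prod ht)).const_mul _)
    rw [h₁ _ hm, h₂ _ hm]
    exact hX.mecke_rectangles hlam hD hDW hW hWf a hA
  have hf₂ : IsFiniteMeasure m₂ := by
    have : IsFiniteMeasure ((intensity lam).restrict D) :=
      ⟨by simpa using (intensity_ne_top lam hDf).lt_top⟩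
    infer_instance
  have hf₁ : IsFiniteMeasure m₁ := by
    -- With no rectangles both transforms are total masses, so `m₁` is finite because `m₂` is.
    have h := hrect (I := Empty) (fun _ => 0) (fun _ => ∅) (fun i => i.elim)
    simp only [Finset.univ_eq_empty, Finset.sum_empty, negExp_zero, lintegral_const, one_mul] at h
    exact ⟨h ▸ measure_lt_top m₂ _⟩
  have hNf := hX.ae_count_ne_top hlam hW hWf
  have huniv : MeasurableSet {ξ : Measure (Plane × Plane) | ξ Set.univ ≠ ∞} :=
    (Measure.measurable_coe .univ) (MeasurableSet.singleton ∞).compl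
  have hfull : ∀ y ω, fullConfig X W y ω Set.univ = pointMeasure X ω W := fun y ω => by
    rw [pairMeasure_apply _ _ _ .univ, pointMeasure_apply X ω hW]
    simp
  have ha₁ : ∀ᵐ ξ ∂m₁, ξ Set.univ ≠ ∞ := by
    refine Measure.ae_sum_iff.2 fun k => (ae_map_iff (hmR k).aemeasurable huniv).2 ?_
    refine ae_restrict_of_ae (hNf.mono fun ω hω => ne_top_of_le_ne_top hω ?_)
    rw [pairMeasure_apply _ _ _ .univ, pointMeasure_apply X ω hW]
    refine ENNReal.tsum_le_tsum fun m => ?_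
    split_ifs <;> simp
  have ha₂ : ∀ᵐ ξ ∂m₂, ξ Set.univ ≠ ∞ := by
    refine (ae_map_iff hmF.aemeasurable huniv).2 ?_
    simp_rw [hfull]
    exact Measure.quasiMeasurePreserving_snd.ae hNf
  have heq : m₁ = m₂ := by
    refine law_ext_of_laplace generateFrom_prod.symm isPiSystem_prod
      ⟨_, .univ, _, .univ, Set.univ_prod_univ⟩ ha₁ ha₂ fun I a => hrect (fun i => a i) _ fun i => ?_
    obtain ⟨s, hs, t, ht, h⟩ := i.1.2
    exact ⟨s, t, hs, ht, h⟩
  have hmφ : Measurable fun ξ : Measure (Plane × Plane) => negExp (∫⁻ q, φ q ∂ξ) :=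
    measurable_negExp.comp (Measure.measurable_lintegral hφ)
  have hfin : ∫⁻ ξ, negExp (∫⁻ q, φ q ∂ξ) ∂m₁ = ∫⁻ ξ, negExp (∫⁻ q, φ q ∂ξ) ∂m₂ := by rw [heq]
  rw [h₁ _ hmφ, h₂ _ hmφ] at hfin
  have hind : ∀ (y z : Plane), W.indicator 1 z * φ (y, z) =
      W.indicator (fun z => φ (y, z)) z := fun y z => by
    by_cases hz : z ∈ W <;> simp [hz]
  simp_rw [fullConfig, reducedConfig, lintegral_pairMeasure _ _ _ hφ, ite_mul, zero_mul, hind]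
    at hfin
  exact hfin

end IsPoissonProcess

end Poisson

/-! ### Mecke's formula on the plane and the nearest point. -/

section Poisson

variable {Ω : Type*} [MeasurableSpace Ω]

lemma measurable_tsum_ne {α : Type*} [MeasurableSpace α] (k : ℕ) {f : ℕ → α → ℝ≥0∞}
    (hf : ∀ m, Measurable (f m)) : Measurable fun a => ∑' m, if m = k then 0 else f m a :=
  .tsum fun m => by
    split_ifs
    · exact measurable_const
    · exact hf m

lemma ENNReal_tsum_iInf {f : ℕ → ℕ → ℝ≥0∞} (hf : Antitone f) (h0 : ∑' k, f 0 k ≠ ∞) :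
    ∑' k, ⨅ n, f n k = ⨅ n, ∑' k, f n k := by
  simp_rw [← MeasureTheory.lintegral_count] at h0 ⊢
  exact lintegral_iInf (fun n => measurable_from_top) hf h0

namespace IsPoissonProcess

variable {P : Measure Ω} [IsProbabilityMeasure P] {lam : ℝ} {X : ℕ → Ω → Plane}

/-- As the window grows the exponentials decrease, so both sides are infima of their windowed
versions. The exchange with sums and integrals is legitimate because the mean number of points in
the bounded set `D` is finite. -/
lemma mecke_bounded (hlam : 0 ≤ lam) (hX : IsPoissonProcess P lam X) {D : Set Plane}
    (hD : MeasurableSet D) {n₀ : ℕ} (hDW : D ⊆ window n₀)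
    {φ : Plane × Plane → ℝ≥0∞} (hφ : Measurable φ) :
    ∑' k, ∫⁻ ω, D.indicator 1 (X k ω) *
        negExp (∑' m, if m = k then 0 else φ (X k ω, X m ω)) ∂P =
      ∫⁻ y in D, negExp (∫⁻ z, (1 - negExp (φ (y, z))) ∂intensity lam) ∂intensity lam := by
  have hIf : intensity lam D ≠ ∞ := intensity_ne_top lam
    (ne_top_of_le_ne_top (volume_window n₀) (measure_mono hDW))
  set f : ℕ → Plane → Plane → ℝ≥0∞ := fun n y => (window (n + n₀)).indicator fun z => φ (y, z)
    with hf
  have hfm : ∀ n, Measurable fun q : Plane × Plane => f n q.1 q.2 := fun n =>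
    hφ.indicator (measurable_snd (measurableSet_window (n + n₀)))
  have hfy : ∀ n y, Measurable (f n y) := fun n y =>
    (hφ.comp measurable_prodMk_left).indicator (measurableSet_window _)
  have hmono : ∀ y, Monotone fun n => f n y := fun y i j h =>
    monotone_indicator_window (f := fun _ z => φ (y, z)) monotone_const (by omega)
  have hsup : ∀ y z, φ (y, z) = ⨆ n, f n y z := by
    intro y z
    obtain ⟨N, hN⟩ := exists_mem_window z
    refine le_antisymm (le_iSup_of_le N ?_) (iSup_le fun n => Set.indicator_le_self _ _ _)
    rw [hf]
    simp only
    rw [Set.indicator_of_mem (window_mono (by omega) hN)]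
  have hstep : ∀ n, ∑' k, ∫⁻ ω, D.indicator 1 (X k ω) * negExp (∑' m, if m = k then 0 else
        f n (X k ω) (X m ω)) ∂P =
      ∫⁻ y in D, negExp (∫⁻ z, (1 - negExp (f n y z)) ∂intensity lam) ∂intensity lam := by
    intro n
    rw [hX.mecke_window hlam hD (hDW.trans (window_mono (by omega : n₀ ≤ n + n₀)))
      (measurableSet_window _) (volume_window _) hφ]
    refine lintegral_congr fun y => ?_
    exact hX.laplace hlam (hfy n y)
  clear_value f
  have hfX : ∀ n k m, Measurable fun ω => f n (X k ω) (X m ω) := fun n k m =>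
    (hfm n).comp ((hX.measurable k).prodMk (hX.measurable m))
  -- The case `φ = 0` of the windowed formula is the mean number of points in `D`, which dominates
  -- all the decreasing limits below.
  have hmass : ∑' k, ∫⁻ ω, D.indicator 1 (X k ω) ∂P = intensity lam D := by
    have h := hX.mecke_window hlam hD hDW (measurableSet_window _) (volume_window _)
      (φ := fun _ => 0) measurable_const
    simpa using h
  have hDm : ∀ k, Measurable fun ω => D.indicator (1 : Plane → ℝ≥0∞) (X k ω) := fun k =>
    (measurable_one.indicator hD).comp (hX.measurable k)
  have hmonoT : ∀ k ω, Monotone fun n => ∑' m, if m = k then 0 else f n (X k ω) (X m ω) :=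
    fun k ω i j h => ENNReal.tsum_le_tsum fun m => by
      split_ifs
      · exact le_rfl
      · exact hmono _ h _
  have hle : ∀ n k, ∫⁻ ω, D.indicator 1 (X k ω) * negExp (∑' m, if m = k then 0 else
        f n (X k ω) (X m ω)) ∂P ≤ ∫⁻ ω, D.indicator 1 (X k ω) ∂P := fun n k =>
    lintegral_mono fun ω => mul_le_of_le_one_right' (negExp_le_one _)
  have hL : ∀ k, ∫⁻ ω, D.indicator 1 (X k ω) *
        negExp (∑' m, if m = k then 0 else φ (X k ω, X m ω)) ∂P =
      ⨅ n, ∫⁻ ω, D.indicator 1 (X k ω) * negExp (∑' m, if m = k then 0 else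
        f n (X k ω) (X m ω)) ∂P := by
    intro k
    rw [← lintegral_iInf]
    · refine lintegral_congr fun ω => ?_
      by_cases hk : X k ω ∈ D
      · simp only [Set.indicator_of_mem hk, Pi.one_apply, one_mul]
        rw [← negExp_iSup (hmonoT k ω), ← tsum_iSup (fun i j h m => ?_)]
        · congr 2
          funext m
          split_ifs
          · simp
          · exact hsup _ _
        · dsimp only
          split_ifs
          · exact le_rfl
          · exact hmono _ h _
      · simp [Set.indicator_of_notMem hk]
    · exact fun n => (hDm k).mul (measurable_negExp.comp (measurable_tsum_ne k (hfX n k)))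
    · exact fun i j h ω => mul_le_mul_right (antitone_negExp (hmonoT k ω h)) _
    · refine ne_top_of_le_ne_top hIf ?_
      rw [← hmass]
      exact (hle 0 k).trans (ENNReal.le_tsum k)
  have hint : ∀ y, ∫⁻ z, (1 - negExp (φ (y, z))) ∂intensity lam =
      ⨆ n, ∫⁻ z, (1 - negExp (f n y z)) ∂intensity lam := by
    intro y
    rw [← lintegral_iSup]
    · refine lintegral_congr fun z => ?_
      rw [hsup, negExp_iSup fun i j h => hmono y h z, ENNReal.sub_iInf]
    · exact fun n => (measurable_negExp.comp (hfy n y)).const_sub _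
    · exact fun i j h z => tsub_le_tsub_left (antitone_negExp (hmono y h z)) _
  have hmonoI : ∀ y, Monotone fun n => ∫⁻ z, (1 - negExp (f n y z)) ∂intensity lam :=
    fun y i j h => lintegral_mono fun z => tsub_le_tsub_left (antitone_negExp (hmono y h z)) _
  simp_rw [hL]
  rw [ENNReal_tsum_iInf]
  · simp_rw [hstep, hint]
    rw [← lintegral_iInf]
    · exact lintegral_congr fun y => (negExp_iSup (hmonoI y)).symm
    · exact fun n => measurable_negExp.comp
        (((measurable_negExp.comp (hfm n)).const_sub 1).lintegral_prod_right')
    · exact fun i j h y => antitone_negExp (hmonoI y h)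
    · refine ne_top_of_le_ne_top hIf ?_
      calc _ ≤ ∫⁻ _ in D, 1 ∂intensity lam := lintegral_mono fun y => negExp_le_one _
        _ = intensity lam D := by simp
  · exact fun i j h k => lintegral_mono fun ω =>
      mul_le_mul_right (antitone_negExp (hmonoT k ω h)) _
  · refine ne_top_of_le_ne_top hIf ?_
    rw [← hmass]
    exact ENNReal.tsum_le_tsum fun k => hle 0 k

/-- Mecke's formula for the exponential functionals of a Poisson process. -/
theorem mecke (hlam : 0 ≤ lam) (hX : IsPoissonProcess P lam X) {g : Plane → ℝ≥0∞}
    (hg : Measurable g) {φ : Plane × Plane → ℝ≥0∞} (hφ : Measurable φ) :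
    ∑' k, ∫⁻ ω, g (X k ω) * negExp (∑' m, if m = k then 0 else φ (X k ω, X m ω)) ∂P =
      ∫⁻ y, g y * negExp (∫⁻ z, (1 - negExp (φ (y, z))) ∂intensity lam) ∂intensity lam := by
  have hF : ∀ k, Measurable fun ω => negExp (∑' m, if m = k then 0 else φ (X k ω, X m ω)) :=
    fun k => measurable_negExp.comp (measurable_tsum_ne k fun m =>
      hφ.comp ((hX.measurable k).prodMk (hX.measurable m)))
  have hH : Measurable fun y => negExp (∫⁻ z, (1 - negExp (φ (y, z))) ∂intensity lam) :=
    measurable_negExp.comp (((measurable_negExp.comp hφ).const_sub 1).lintegral_prod_right')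
  -- Both sides are integrals of `g` against measures not depending on `g`. These are compared on
  -- bounded Borel sets, where the finiteness required above holds.
  let ν₁ : Measure Plane := Measure.sum fun k => (P.withDensity fun ω =>
    negExp (∑' m, if m = k then 0 else φ (X k ω, X m ω))).map (X k)
  let ν₂ : Measure Plane := (intensity lam).withDensity fun y =>
    negExp (∫⁻ z, (1 - negExp (φ (y, z))) ∂intensity lam)
  have h₁ : ∀ g : Plane → ℝ≥0∞, Measurable g → ∫⁻ y, g y ∂ν₁ = ∑' k, ∫⁻ ω, g (X k ω) *
      negExp (∑' m, if m = k then 0 else φ (X k ω, X m ω)) ∂P := by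
    intro g hg
    rw [lintegral_sum_measure]
    refine tsum_congr fun k => ?_
    rw [lintegral_map hg (hX.measurable k)]
    exact (lintegral_withDensity_eq_lintegral_mul _ (hF k) (hg.comp (hX.measurable k))).trans
      (lintegral_congr fun ω => mul_comm _ _)
  have h₂ : ∀ g : Plane → ℝ≥0∞, Measurable g → ∫⁻ y, g y ∂ν₂ =
      ∫⁻ y, g y * negExp (∫⁻ z, (1 - negExp (φ (y, z))) ∂intensity lam) ∂intensity lam := by
    intro g hg
    rw [lintegral_withDensity_eq_lintegral_mul _ hH hg]
    exact lintegral_congr fun ω => mul_comm _ _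
  have heq : ν₁ = ν₂ := by
    ext D hD
    have hb : ∀ n, ν₁ (D ∩ window n) = ν₂ (D ∩ window n) := by
      intro n
      have hDn := hD.inter (measurableSet_window n)
      rw [← lintegral_indicator_one hDn, ← lintegral_indicator_one hDn,
        h₁ _ (measurable_one.indicator hDn), h₂ _ (measurable_one.indicator hDn),
        hX.mecke_bounded hlam hDn Set.inter_subset_right hφ, ← lintegral_indicator hDn]
      refine lintegral_congr fun y => ?_
      by_cases hy : y ∈ D ∩ window n
      · simp only [Set.indicator_of_mem hy, Pi.one_apply, one_mul]
      · simp only [Set.indicator_of_notMem hy, zero_mul]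
    have hU : D = ⋃ n, D ∩ window n := by
      rw [← Set.inter_iUnion, Set.iUnion_eq_univ_iff.2 exists_mem_window, Set.inter_univ]
    have hm : Monotone fun n => D ∩ window n := fun i j h =>
      Set.inter_subset_inter_right D (window_mono h)
    rw [hU, hm.measure_iUnion, hm.measure_iUnion]
    simp_rw [hb]
  rw [← h₁ g hg, ← h₂ g hg, heq]

/-- The law of the point nearest to the origin, together with the rest of the process. -/
theorem nearest (hlam : 0 ≤ lam) (hX : IsPoissonProcess P lam X)
    (h0 : ∀ᵐ ω ∂P, ∀ j, ‖X 0 ω‖ ≤ ‖X j ω‖) {g : Plane → ℝ≥0∞}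
    (hg : Measurable g) {φ : Plane × Plane → ℝ≥0∞} (hφ : Measurable φ) :
    ∫⁻ ω, g (X 0 ω) * negExp (∑' m, if m = 0 then 0 else φ (X 0 ω, X m ω)) ∂P =
      ∫⁻ x, g x * negExp (∫⁻ z, (if ‖z‖ ≤ ‖x‖ then 1 else 1 - negExp (φ (x, z)))
        ∂intensity lam) ∂intensity lam := by
  classical
  -- The value `∞` kills a term of Mecke's sum as soon as another point lies in the closed disc
  -- (`φ₁`) or the open disc (`φ₂`) through the chosen point. Almost surely `φ₁` leaves at most the
  -- term of index `0`, and `φ₂` leaves that term unchanged. The two sums therefore bound the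
  -- desired expectation from below and above, and no uniqueness of the nearest point has to be
  -- shown.
  let φ₁ : Plane × Plane → ℝ≥0∞ := fun q => if ‖q.2‖ ≤ ‖q.1‖ then ∞ else φ q
  let φ₂ : Plane × Plane → ℝ≥0∞ := fun q => if ‖q.2‖ < ‖q.1‖ then ∞ else φ q
  have hφ₁ : Measurable φ₁ := Measurable.ite
    (measurableSet_le measurable_snd.norm measurable_fst.norm) measurable_const hφ
  have hφ₂ : Measurable φ₂ := Measurable.ite
    (measurableSet_lt measurable_snd.norm measurable_fst.norm) measurable_const hφ
  have e₁ : ∀ x z, 1 - negExp (φ₁ (x, z)) = if ‖z‖ ≤ ‖x‖ then 1 else 1 - negExp (φ (x, z)) := by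
    intro x z
    simp only [φ₁]
    split_ifs <;> simp
  have e₂ : ∀ x z, 1 - negExp (φ₂ (x, z)) = if ‖z‖ < ‖x‖ then 1 else 1 - negExp (φ (x, z)) := by
    intro x z
    simp only [φ₂]
    split_ifs <;> simp
  have m₁ := hX.mecke hlam hg hφ₁
  have m₂ := hX.mecke hlam hg hφ₂
  simp_rw [e₁] at m₁
  simp_rw [e₂] at m₂
  -- The two bounds coincide because circles are null sets.
  have hsph : ∀ x : Plane, ∫⁻ z, (if ‖z‖ < ‖x‖ then 1 else 1 - negExp (φ (x, z))) ∂intensity lam =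
      ∫⁻ z, (if ‖z‖ ≤ ‖x‖ then 1 else 1 - negExp (φ (x, z))) ∂intensity lam := by
    intro x
    refine lintegral_congr_ae ?_
    have : ∀ᵐ z ∂intensity lam, z ∉ Metric.sphere (0 : Plane) ‖x‖ := by
      rw [← measure_eq_zero_iff_ae_notMem, intensity, Measure.smul_apply,
        Measure.addHaar_sphere, smul_zero]
    filter_upwards [this] with z hz
    have hne : ‖z‖ ≠ ‖x‖ := fun h => hz (by simpa using h)
    simp only [lt_iff_le_and_ne, hne, ne_eq, not_false_eq_true, and_true]
  simp_rw [hsph] at m₂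
  refine le_antisymm ?_ ?_
  · rw [← m₂]
    refine le_trans (lintegral_mono_ae ?_) (ENNReal.le_tsum 0)
    filter_upwards [h0] with ω hω
    refine mul_le_mul_right (antitone_negExp (ENNReal.tsum_le_tsum fun m => ?_)) _
    split_ifs with hm
    · exact le_rfl
    · simp [φ₂, (hω m).not_gt]
  · rw [← m₁, tsum_eq_single 0]
    · refine lintegral_mono fun ω => mul_le_mul_right
        (antitone_negExp (ENNReal.tsum_le_tsum fun m => ?_)) _
      split_ifs with hm
      · exact le_rfl
      · simp only [φ₁]
        split_ifs <;> simp
    · intro k hk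
      rw [lintegral_eq_zero_iff']
      · filter_upwards [h0] with ω hω
        have : (∑' m, if m = k then 0 else φ₁ (X k ω, X m ω)) = ∞ := by
          refine ENNReal.tsum_eq_top_of_eq_top ⟨0, ?_⟩
          simp [φ₁, hk.symm, hω k]
        simp [this]
      · exact ((hg.comp (hX.measurable k)).mul (measurable_negExp.comp
          (measurable_tsum_ne k fun m =>
            hφ₁.comp ((hX.measurable k).prodMk (hX.measurable m))))).aemeasurable

end IsPoissonProcess

end Poisson

/-! ### Independent families of marks -/

section Grouping

variable {Ω : Type*} [mΩ : MeasurableSpace Ω] {P : Measure Ω} [IsProbabilityMeasure P]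

/-- The events in an independent family of groups of random variables. -/
lemma measure_biInter_groups {κ ι : Type*} {f : κ → Ω → ℝ} (hf : ∀ s, Measurable (f s))
    (hind : iIndepFun f P) {group : ι → Set κ}
    (hg : Pairwise (Function.onFun Disjoint group)) {C : ι → Set Ω}
    (hC : ∀ i, MeasurableSet[⨆ s ∈ group i, MeasurableSpace.comap (f s) inferInstance] (C i))
    (F : Finset ι) : P (⋂ i ∈ F, C i) = ∏ i ∈ F, P (C i) := by
  classical
  induction F using Finset.induction_on with
  | empty => simp
  | insert a F ha ih =>
    rw [Finset.set_biInter_insert, Finset.prod_insert ha, ← ih]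
    have hdisj : Disjoint (group a) (⋃ i ∈ F, group i) :=
      Set.disjoint_iUnion₂_right.2 fun i hi => hg fun h => ha (h ▸ hi)
    have hi := indep_iSup_of_disjoint (fun s => (hf s).comap_le) hind hdisj
    refine (Indep_iff _ _ P).1 hi _ _ (hC a) ?_
    refine MeasurableSet.biInter F.countable_toSet fun i hi' => ?_
    refine (iSup₂_le fun s hs => ?_ :
      (⨆ s ∈ group i, MeasurableSpace.comap (f s) inferInstance) ≤ _) _ (hC i)
    exact le_iSup₂_of_le s (Set.mem_iUnion₂.2 ⟨i, hi', hs⟩) le_rfl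

/-- The intersection is a decreasing limit over finite sets of indices, along which independence
gives products. Continuity of `negExp` on `[0, ∞]` carries these to the exponential of the full sum,
even if some probability is zero. -/
lemma measure_iInter_groups {κ ι : Type*} [Countable ι] {f : κ → Ω → ℝ}
    (hf : ∀ s, Measurable (f s)) (hind : iIndepFun f P) {group : ι → Set κ}
    (hg : Pairwise (Function.onFun Disjoint group)) {C : ι → Set Ω}
    (hC : ∀ i, MeasurableSet[⨆ s ∈ group i, MeasurableSpace.comap (f s) inferInstance]
      (C i)) : P (⋂ i, C i) = negExp (∑' i, negLog (P (C i))) := by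
  have hm : ∀ i, MeasurableSet (C i) := fun i =>
    (iSup₂_le fun s _ => (hf s).comap_le :
      (⨆ s ∈ group i, MeasurableSpace.comap (f s) inferInstance) ≤ mΩ) _ (hC i)
  have h1 : ⋂ i, C i = ⋂ F : Finset ι, ⋂ i ∈ F, C i := by
    ext ω
    simp only [Set.mem_iInter]
    exact ⟨fun h F i _ => h i, fun h i => h {i} i (by simp)⟩
  have h2 : Tendsto (fun F : Finset ι => P (⋂ i ∈ F, C i)) atTop (𝓝 (P (⋂ i, C i))) := by
    rw [h1]
    refine tendsto_measure_iInter_atTop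
      (fun F => (MeasurableSet.biInter F.countable_toSet fun i _ => hm i).nullMeasurableSet) ?_
      ⟨∅, measure_ne_top _ _⟩
    intro F G h
    exact Set.biInter_subset_biInter_left h
  refine tendsto_nhds_unique h2 ?_
  convert negExp_tsum fun i => negLog (P (C i)) using 2 with F
  rw [measure_biInter_groups hf hind hg hC]
  exact Finset.prod_congr rfl fun i _ => (negExp_negLog prob_le_one).symm

end Grouping

/-! ### Timers and fadings -/

section Clear

variable {Ω : Type*} [MeasurableSpace Ω] {P : Measure Ω} [IsProbabilityMeasure P]

/-- A transmitter with timer `T`, fading `g` and path loss `l` does not silence a receiver with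
timer `t` and threshold `θ`. -/
def Clear (t T g l θ : ℝ) : Prop := t ≤ T ∨ g / l ≤ θ

/-- The probability that the signal of a transmitter at distance `d` exceeds `θ`. -/
def blockProb (p : Params) (θ d : ℝ) : ℝ :=
  if d = 0 then 0 else Real.exp (-(p.mu * θ * p.pathLoss d))

lemma pathLoss_nonneg (p : Params) {d : ℝ} (hd : 0 ≤ d) : 0 ≤ p.pathLoss d :=
  mul_nonneg (sq_nonneg _) (Real.rpow_nonneg hd _)

lemma pathLoss_zero (p : Params) : p.pathLoss 0 = 0 := by
  simp [Params.pathLoss, Real.zero_rpow p.alpha_pos.ne']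

lemma pathLoss_pos (p : Params) {d : ℝ} (hd : 0 < d) : 0 < p.pathLoss d := by
  have := p.wavelength_pos
  exact mul_pos (by positivity) (Real.rpow_pos_of_pos hd _)

lemma blockProb_nonneg (p : Params) (θ d : ℝ) : 0 ≤ blockProb p θ d := by
  unfold blockProb; split_ifs <;> positivity

lemma blockProb_le_one (p : Params) {θ d : ℝ} (hθ : 0 ≤ θ) (hd : 0 ≤ d) :
    blockProb p θ d ≤ 1 := by
  unfold blockProb
  split_ifs
  · exact zero_le_one
  · rw [Real.exp_le_one_iff, neg_nonpos]
    exact mul_nonneg (mul_nonneg p.mu_pos.le hθ) (pathLoss_nonneg p hd)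

@[fun_prop]
lemma measurable_pathLoss (p : Params) : Measurable p.pathLoss := by
  unfold Params.pathLoss; fun_prop

@[fun_prop]
lemma measurable_blockProb (p : Params) (θ : ℝ) : Measurable (blockProb p θ) :=
  Measurable.ite (measurableSet_singleton 0) measurable_const (by fun_prop)

/-- For `d > 0` this is the exponential tail at `θ l(d)`. At `d = 0` the path loss vanishes and the
quotient is `0` by convention, so nothing is blocked; hence the separate value in `blockProb`. -/
lemma real_blocked (p : Params) {G : Ω → ℝ} (hG : Measurable G)
    (hlaw : P.map G = expMeasure p.mu) {θ d : ℝ} (hθ : 0 ≤ θ) (hd : 0 ≤ d) :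
    P.real {ω | θ < G ω / p.pathLoss d} = blockProb p θ d := by
  unfold blockProb
  split_ifs with h
  · simp [h, pathLoss_zero, hθ.not_gt]
  · have hl := pathLoss_pos p (lt_of_le_of_ne hd (Ne.symm h))
    have h1 : {ω | θ < G ω / p.pathLoss d} = (G ⁻¹' Set.Iic (θ * p.pathLoss d))ᶜ := by
      ext ω; simp [lt_div_iff₀ hl]
    have := isProbabilityMeasure_expMeasure p.mu_pos
    rw [h1, probReal_compl_eq_one_sub (hG measurableSet_Iic),
      ← map_measureReal_apply hG measurableSet_Iic, hlaw, ← cdf_eq_real,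
      cdf_expMeasure_eq p.mu_pos, if_pos (mul_nonneg hθ hl.le)]
    ring_nf

lemma cond_Icc : (ProbabilityTheory.cond volume (Set.Icc (0 : ℝ) 1)) = volume.restrict (Set.Icc (0 : ℝ) 1) := by
  simp [ProbabilityTheory.cond]

omit [IsProbabilityMeasure P] in
lemma real_timer_lt {T : Ω → ℝ} (hT : Measurable T)
    (hlaw : P.map T = cond volume (Set.Icc (0 : ℝ) 1)) {t : ℝ} (ht : t ∈ Set.Icc (0 : ℝ) 1) :
    P.real {ω | T ω < t} = t := by
  have h1 : Set.Iio t ∩ Set.Icc (0 : ℝ) 1 = Set.Ico 0 t := by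
    ext u
    simp only [Set.mem_inter_iff, Set.mem_Iio, Set.mem_Icc, Set.mem_Ico]
    constructor
    · rintro ⟨h, h0, _⟩; exact ⟨h0, h⟩
    · rintro ⟨h0, h⟩; exact ⟨h, h0, h.le.trans ht.2⟩
  change P.real (T ⁻¹' Set.Iio t) = t
  rw [← map_measureReal_apply hT measurableSet_Iio, hlaw, cond_Icc, Measure.real,
    Measure.restrict_apply measurableSet_Iio, h1, Real.volume_Ico]
  simp [ht.1]

open scoped Classical in
/-- The probability that a transmitter silences the first receiver or, if `b`, the second one, the
receivers having timers `t` and `s` and being reached with probability `q₁` and `q₂`. -/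
def viol (b : Prop) (t s q₁ q₂ : ℝ) : ℝ := t * q₁ + if b then s * q₂ - min t s * (q₁ * q₂) else 0

open scoped Classical in
/-- The probability that one of the tagged pair silences the other. -/
def pairViol (b : Prop) (q : ℝ) : ℝ := if b then q else 0

lemma measurableSet_clear {α : Type*} {m : MeasurableSpace α} {t T g : α → ℝ} {l θ : ℝ}
    (ht : Measurable t) (hT : Measurable T) (hg : Measurable g) :
    MeasurableSet {a | Clear (t a) (T a) (g a) l θ} :=
  (measurableSet_le ht hT).union (measurableSet_le (hg.div_const _) measurable_const)

lemma measurableSet_imp {α : Type*} {m : MeasurableSpace α} (b : Prop) {A : Set α}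
    (hA : MeasurableSet A) : MeasurableSet {a | b → a ∈ A} := by
  by_cases hb : b <;> simp [hb, hA]

/-- The probability that a transmitter silences neither of two receivers. -/
lemma measure_clear_and (p : Params) {κ : Type*} {f : κ → Ω → ℝ} (hf : ∀ s, Measurable (f s))
    (hind : iIndepFun f P) {i j k : κ} (hij : i ≠ j) (hik : i ≠ k) (hjk : j ≠ k)
    (hi : P.map (f i) = cond volume (Set.Icc (0 : ℝ) 1)) (hj : P.map (f j) = expMeasure p.mu)
    (hk : P.map (f k) = expMeasure p.mu) (b : Prop) {t s θ₁ θ₂ d₁ d₂ : ℝ}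
    (ht : t ∈ Set.Icc (0 : ℝ) 1) (hs : s ∈ Set.Icc (0 : ℝ) 1) (hθ₁ : 0 ≤ θ₁) (hθ₂ : 0 ≤ θ₂)
    (hd₁ : 0 ≤ d₁) (hd₂ : 0 ≤ d₂) :
    P {ω | Clear t (f i ω) (f j ω) (p.pathLoss d₁) θ₁ ∧
        (b → Clear s (f i ω) (f k ω) (p.pathLoss d₂) θ₂)} =
      ENNReal.ofReal (1 - viol b t s (blockProb p θ₁ d₁) (blockProb p θ₂ d₂)) := by
  set A : ℝ → Set Ω := fun t => {ω | f i ω < t} with hA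
  set B : Set Ω := {ω | θ₁ < f j ω / p.pathLoss d₁} with hB
  set C : Set Ω := {ω | θ₂ < f k ω / p.pathLoss d₂} with hC
  have hAm : ∀ t, MeasurableSet (A t) := fun t => measurableSet_lt (hf i) measurable_const
  have hBm : MeasurableSet B := measurableSet_lt measurable_const ((hf j).div_const _)
  have hCm : MeasurableSet C := measurableSet_lt measurable_const ((hf k).div_const _)
  have hBr : P.real B = blockProb p θ₁ d₁ := real_blocked p (hf j) hj hθ₁ hd₁
  have hCr : P.real C = blockProb p θ₂ d₂ := real_blocked p (hf k) hk hθ₂ hd₂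
  have hAr : ∀ t ∈ Set.Icc (0 : ℝ) 1, P.real (A t) = t := fun t ht => real_timer_lt (hf i) hi ht
  let D : ℝ → ℝ → Set ℝ := fun θ d => {u | θ < u / p.pathLoss d}
  have hD : ∀ θ d, MeasurableSet (D θ d) := fun θ d =>
    measurableSet_lt measurable_const (measurable_id.div_const _)
  have hAB : ∀ t, P.real (A t ∩ B) = P.real (A t) * P.real B := by
    intro t
    change (P (f i ⁻¹' Set.Iio t ∩ f j ⁻¹' D θ₁ d₁)).toReal = (P (f i ⁻¹' Set.Iio t)).toReal * (P (f j ⁻¹' D θ₁ d₁)).toReal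
    rw [(hind.indepFun hij).measure_inter_preimage_eq_mul (Set.Iio t) (D θ₁ d₁)
      measurableSet_Iio (hD _ _), ENNReal.toReal_mul]
  have hAC : ∀ t, P.real (A t ∩ C) = P.real (A t) * P.real C := by
    intro t
    change (P (f i ⁻¹' Set.Iio t ∩ f k ⁻¹' D θ₂ d₂)).toReal = (P (f i ⁻¹' Set.Iio t)).toReal * (P (f k ⁻¹' D θ₂ d₂)).toReal
    rw [(hind.indepFun hik).measure_inter_preimage_eq_mul (Set.Iio t) (D θ₂ d₂)
      measurableSet_Iio (hD _ _), ENNReal.toReal_mul]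
  have hBC : P.real (B ∩ C) = P.real B * P.real C := by
    change (P (f j ⁻¹' D θ₁ d₁ ∩ f k ⁻¹' D θ₂ d₂)).toReal = (P (f j ⁻¹' D θ₁ d₁)).toReal * (P (f k ⁻¹' D θ₂ d₂)).toReal
    rw [(hind.indepFun hjk).measure_inter_preimage_eq_mul (D θ₁ d₁) (D θ₂ d₂)
      (hD _ _) (hD _ _), ENNReal.toReal_mul]
  have hABC : ∀ t, P.real (A t ∩ (B ∩ C)) = P.real (A t) * (P.real B * P.real C) := by
    intro t
    have h := (hind.indepFun_prodMk hf j k i hij.symm hik.symm).measure_inter_preimage_eq_mul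
      (D θ₁ d₁ ×ˢ D θ₂ d₂) (Set.Iio t) ((hD _ _).prod (hD _ _)) measurableSet_Iio
    rw [← hBC, mul_comm, Set.inter_comm]
    change (P ((B ∩ C) ∩ A t)).toReal = (P (B ∩ C)).toReal * (P (A t)).toReal
    rw [← ENNReal.toReal_mul]
    exact congrArg _ h
  set E : Set Ω := {ω | Clear t (f i ω) (f j ω) (p.pathLoss d₁) θ₁ ∧
        (b → Clear s (f i ω) (f k ω) (p.pathLoss d₂) θ₂)} with hE
  have hreal : P.real E = 1 - viol b t s (blockProb p θ₁ d₁) (blockProb p θ₂ d₂) := by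
    by_cases hb : b
    · have hEc : E = ((A t ∩ B) ∪ (A s ∩ C))ᶜ := by
        ext ω
        simp only [hE, hb, Clear, hA, hB, hC, Set.mem_ofPred_eq, Set.mem_compl_iff, Set.mem_union,
          Set.mem_inter_iff, true_imp_iff, not_or, not_and_or, not_lt]
      -- Both violations involve the same transmitter timer, so both occur only if it is below the
      -- smaller of `t` and `s`. This is the origin of the minimum in `viol`.
      have hint : (A t ∩ B) ∩ (A s ∩ C) = A (min t s) ∩ (B ∩ C) := by
        ext ω
        simp only [hA, hB, hC, Set.mem_inter_iff, Set.mem_ofPred_eq, lt_min_iff]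
        tauto
      have hU := measureReal_union_add_inter (μ := P) (s := A t ∩ B) ((hAm s).inter hCm)
      have hmin : min t s ∈ Set.Icc (0 : ℝ) 1 := ⟨le_min ht.1 hs.1, (min_le_left _ _).trans ht.2⟩
      rw [hint, hAB, hAC, hABC, hAr t ht, hAr s hs, hAr _ hmin, hBr, hCr] at hU
      rw [hEc, probReal_compl_eq_one_sub (((hAm t).inter hBm).union ((hAm s).inter hCm)), viol,
        if_pos hb]
      linarith
    · have hEc : E = (A t ∩ B)ᶜ := by
        ext ω
        simp only [hE, hb, Clear, hA, hB, Set.mem_ofPred_eq, Set.mem_compl_iff,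
          Set.mem_inter_iff, false_imp_iff, and_true, not_and_or, not_lt]
      rw [hEc, probReal_compl_eq_one_sub ((hAm t).inter hBm), hAB, hAr t ht, hBr, viol, if_neg hb,
        add_zero]
  rw [← hreal, ofReal_measureReal]

/-- The probability that one of the tagged pair does not silence the other. -/
lemma measure_clear_pair (p : Params) {G : Ω → ℝ} (hG : Measurable G)
    (hlaw : P.map G = expMeasure p.mu) (b : Prop) {s t θ d : ℝ} (hθ : 0 ≤ θ) (hd : 0 ≤ d) :
    P {ω | b → Clear s t (G ω) (p.pathLoss d) θ} =
      ENNReal.ofReal (1 - pairViol (b ∧ t < s) (blockProb p θ d)) := by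
  unfold pairViol
  split_ifs with h
  · have : {ω | b → Clear s t (G ω) (p.pathLoss d) θ} = {ω | θ < G ω / p.pathLoss d}ᶜ := by
      ext ω
      simp [Clear, h.1, h.2.not_ge]
    rw [this, ← ofReal_measureReal, probReal_compl_eq_one_sub
      (measurableSet_lt measurable_const (hG.div_const _)), real_blocked p hG hlaw hθ hd]
  · have : {ω | b → Clear s t (G ω) (p.pathLoss d) θ} = Set.univ := by
      ext ω
      simp only [Set.mem_ofPred_eq, Set.mem_univ, iff_true]
      exact fun hb => Or.inl (not_lt.1 fun h' => h ⟨hb, h'⟩)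
    rw [this]
    simp

end Clear

/-! ### The medium access probabilities for given locations -/

/-- The locations of the APs and of the eNBs. -/
abbrev Locations : Type := (ℕ → Plane) × (ℕ → Plane)

/-- The network on the space of all locations and marks. -/
def canonicalNetwork : Network (Locations × (MarkIndex → ℝ)) where
  x i q := q.1.1 i
  y k q := q.1.2 k
  tW i q := q.2 (.tW i)
  tL k q := q.2 (.tL k)
  gW j i q := q.2 (.gW j i)
  gLW m i q := q.2 (.gLW m i)
  gWL j k q := q.2 (.gWL j k)
  gL m k q := q.2 (.gL m k)

/-- The tagged AP transmits and, if `b`, so does the eNB with index `k`. -/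
def Network.Coexist {Ω : Type*} (N : Network Ω) (p : Params) (b : Prop) (k : ℕ) (ω : Ω) : Prop :=
  N.APTransmits p 0 ω ∧ (b → N.ENBTransmits p k ω)

/-- The locations and marks of a network. -/
def Network.locations {Ω : Type*} (N : Network Ω) (ω : Ω) : Locations :=
  (fun i => N.x i ω, fun k => N.y k ω)

/-- The transmitter with the given index (AP or eNB) does not silence the tagged AP with timer `t`
and, if `b`, the eNB with index `k` and timer `s`. -/
def TransmitterClear (p : Params) (b : Prop) (k : ℕ) (l : Locations) (t s : ℝ)
    (u : MarkIndex → ℝ) : ℕ ⊕ ℕ → Prop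
  | .inl j =>
    if j = 0 then
      b → Clear s t (u (.gWL 0 k)) (p.pathLoss ‖l.2 k - l.1 0‖) (p.gamL / p.powW)
    else
      Clear t (u (.tW j)) (u (.gW j 0)) (p.pathLoss ‖l.1 j - l.1 0‖) (p.gamCS / p.powW) ∧
      (b → Clear s (u (.tW j)) (u (.gWL j k)) (p.pathLoss ‖l.2 k - l.1 j‖) (p.gamL / p.powW))
  | .inr m =>
    if m = k then
      True → Clear t s (u (.gLW k 0)) (p.pathLoss ‖l.2 k - l.1 0‖) (p.gamED / p.powL)
    else
      Clear t (u (.tL m)) (u (.gLW m 0)) (p.pathLoss ‖l.2 m - l.1 0‖) (p.gamED / p.powL) ∧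
      (b → Clear s (u (.tL m)) (u (.gL m k)) (p.pathLoss ‖l.2 m - l.2 k‖) (p.gamL / p.powL))

/-- The model lists its conditions by receiver. Regrouped by transmitter, each condition uses the
marks of one device, and the conditions become independent once the two tagged timers are fixed. -/
lemma coexist_iff_transmitterClear (p : Params) (b : Prop) (k : ℕ) (l : Locations)
    (u : MarkIndex → ℝ) : canonicalNetwork.Coexist p b k (l, u) ↔
      ∀ i, TransmitterClear p b k l (u (.tW 0)) (u (.tL k)) u i := by
  constructor
  · rintro ⟨⟨h1, h2⟩, h3⟩ (j | m)
    · simp only [TransmitterClear]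
      split_ifs with hj
      · intro hb
        exact (h3 hb).1 0
      · exact ⟨h1 j hj, fun hb => (h3 hb).1 j⟩
    · simp only [TransmitterClear]
      split_ifs with hm
      · intro _
        exact h2 k
      · exact ⟨h2 m, fun hb => (h3 hb).2 m hm⟩
  · intro h
    have hl : ∀ j, TransmitterClear p b k l (u (.tW 0)) (u (.tL k)) u (.inl j) := fun j => h _
    have hr : ∀ m, TransmitterClear p b k l (u (.tW 0)) (u (.tL k)) u (.inr m) := fun m => h _
    simp only [TransmitterClear] at hl hr
    refine ⟨⟨fun j hj => ?_, fun m => ?_⟩, fun hb => ⟨fun j => ?_, fun m hm => ?_⟩⟩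
    · have := hl j
      rw [if_neg hj] at this
      exact this.1
    · have := hr m
      split_ifs at this with hm
      · subst hm
        exact this trivial
      · exact this.1
    · have := hl j
      split_ifs at this with hj
      · subst hj
        exact this hb
      · exact this.2 hb
    · have := hr m
      rw [if_neg hm] at this
      exact this.2 hb

/-- The transmitter to which a mark other than the two tagged timers belongs. -/
def owner (k : ℕ) : MarkIndex → Option (ℕ ⊕ ℕ)
  | .tW j => if j = 0 then none else some (.inl j)
  | .tL m => if m = k then none else some (.inr m)
  | .gW j _ => some (.inl j)
  | .gLW m _ => some (.inr m)
  | .gWL j _ => some (.inl j)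
  | .gL m _ => some (.inr m)

/-- The marks, with the two tagged timers replaced by `0`. -/
def dropTimers (k : ℕ) (u : MarkIndex → ℝ) (s : MarkIndex) : ℝ :=
  if owner k s = none then 0 else u s

/-- The tagged timers enter only through the arguments `t` and `s`. The marks with these timers
erased are independent of them, which permits conditioning on their values. -/
lemma transmitterClear_dropTimers (p : Params) (b : Prop) (k : ℕ) (l : Locations) (t s : ℝ)
    (u : MarkIndex → ℝ) (i : ℕ ⊕ ℕ) :
    TransmitterClear p b k l t s (dropTimers k u) i ↔ TransmitterClear p b k l t s u i := by
  rcases i with j | m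
  · by_cases hj : j = 0 <;> simp [TransmitterClear, dropTimers, owner, hj]
  · by_cases hm : m = k <;> simp [TransmitterClear, dropTimers, owner, hm]

/-- Only marks owned by `i` are assumed measurable, so the lemma applies to the σ-algebra they
generate and places the event of `i` in its own independent group. -/
lemma measurableSet_transmitterClear (p : Params) (b : Prop) (k : ℕ) (l : Locations)
    {α : Type*} {m : MeasurableSpace α} {t s : α → ℝ} {u : α → MarkIndex → ℝ}
    (ht : Measurable t) (hs : Measurable s) (i : ℕ ⊕ ℕ)
    (hu : ∀ r, owner k r = some i → Measurable fun a => u a r) :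
    MeasurableSet {a | TransmitterClear p b k l (t a) (s a) (u a) i} := by
  rcases i with j | m
  · simp only [TransmitterClear]
    split_ifs with hj
    · exact measurableSet_imp b (measurableSet_clear hs ht (hu _ (by simp [owner, hj])))
    · exact (measurableSet_clear ht (hu _ (by simp [owner, hj])) (hu _ (by simp [owner]))).inter
        (measurableSet_imp b
          (measurableSet_clear hs (hu _ (by simp [owner, hj])) (hu _ (by simp [owner]))))
  · simp only [TransmitterClear]
    split_ifs with hm
    · exact measurableSet_imp True (measurableSet_clear ht hs (hu _ (by simp [owner, hm])))
    · exact (measurableSet_clear ht (hu _ (by simp [owner, hm])) (hu _ (by simp [owner]))).inter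
        (measurableSet_imp b
          (measurableSet_clear hs (hu _ (by simp [owner, hm])) (hu _ (by simp [owner]))))

/-- The probability that an AP at `z` silences the tagged AP at `x` or, if `b`, the eNB at `y`. -/
def violW (p : Params) (b : Prop) (t s : ℝ) (x y z : Plane) : ℝ :=
  viol b t s (blockProb p (p.gamCS / p.powW) ‖z - x‖) (blockProb p (p.gamL / p.powW) ‖y - z‖)

/-- The probability that an eNB at `z` silences the tagged AP at `x` or, if `b`, the eNB
at `y`. -/
def violL (p : Params) (b : Prop) (t s : ℝ) (x y z : Plane) : ℝ :=
  viol b t s (blockProb p (p.gamED / p.powL) ‖z - x‖) (blockProb p (p.gamL / p.powL) ‖z - y‖)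

/-- The probability that the tagged AP at `x` and the eNB at `y` do not silence one another. -/
def pairWeight (p : Params) (b : Prop) (t s : ℝ) (x y : Plane) : ℝ≥0∞ :=
  ENNReal.ofReal (1 - pairViol (b ∧ t < s) (blockProb p (p.gamL / p.powW) ‖y - x‖)) *
    ENNReal.ofReal (1 - pairViol (True ∧ s < t) (blockProb p (p.gamED / p.powL) ‖y - x‖))

/-- The uniform distribution on `[0, 1]`. -/
def unif : Measure ℝ := volume.restrict (Set.Icc 0 1)

instance : IsProbabilityMeasure unif := ⟨by simp [unif]⟩

section Marks

variable {Ω : Type*} [MeasurableSpace Ω] {P : Measure Ω} [IsProbabilityMeasure P]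
  {p : Params} {N : Network Ω}

/-- The probability that no transmitter silences the tagged pair with timers `t` and `s`. -/
lemma measure_forall_transmitterClear (hN : N.IsModel p 0 1 P) (b : Prop) (k : ℕ) (l : Locations)
    {t s : ℝ} (ht : t ∈ Set.Icc (0 : ℝ) 1) (hs : s ∈ Set.Icc (0 : ℝ) 1) :
    P {ω | ∀ i, TransmitterClear p b k l t s (fun r => N.mark r ω) i} =
      pairWeight p b t s (l.1 0) (l.2 k) *
        negExp (∑' j, if j = 0 then 0 else
          negLog (ENNReal.ofReal (1 - violW p b t s (l.1 0) (l.2 k) (l.1 j)))) *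
        negExp (∑' m, if m = k then 0 else
          negLog (ENNReal.ofReal (1 - violL p b t s (l.1 0) (l.2 k) (l.2 m)))) := by
  have h1 := p.powW_pos
  have h2 := p.powL_pos
  have h3 := p.gamCS_pos
  have h4 := p.gamED_pos
  have h5 := p.gamL_pos
  let C : ℕ ⊕ ℕ → Set Ω := fun i => {ω | TransmitterClear p b k l t s (fun r => N.mark r ω) i}
  have hC : ∀ i, MeasurableSet[⨆ r ∈ {r | owner k r = some i},
      MeasurableSpace.comap (N.mark r) inferInstance] (C i) := by
    intro i
    refine measurableSet_transmitterClear p b k l measurable_const measurable_const i fun r hr => ?_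
    exact (comap_measurable (N.mark r)).mono
      (le_iSup₂_of_le (f := fun r (_ : r ∈ {r | owner k r = some i}) =>
        MeasurableSpace.comap (N.mark r) inferInstance) r hr le_rfl) le_rfl
  have hg : Pairwise (Function.onFun Disjoint fun i => {r | owner k r = some i}) := by
    intro i j hij
    refine Set.disjoint_left.2 fun r hi hj => hij ?_
    exact Option.some.inj ((hi : owner k r = some i).symm.trans hj)
  have hset : {ω | ∀ i, TransmitterClear p b k l t s (fun r => N.mark r ω) i} = ⋂ i, C i := by
    ext ω; simp [C]
  -- The indices `inl 0` and `inr k` are the tagged devices; their factors are split off and form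
  -- `pairWeight`.
  rw [hset, measure_iInter_groups hN.measurable_mark hN.indep_marks hg hC,
    Summable.tsum_sum ENNReal.summable ENNReal.summable, IsPoissonProcess.tsum_eq_add_tsum_ite_nat _ 0,
    IsPoissonProcess.tsum_eq_add_tsum_ite_nat (fun m => negLog (P (C (Sum.inr m)))) k]
  have e0 : P (C (.inl 0)) = ENNReal.ofReal (1 - pairViol (b ∧ t < s)
      (blockProb p (p.gamL / p.powW) ‖l.2 k - l.1 0‖)) := by
    simp only [C, TransmitterClear, if_true]
    exact measure_clear_pair p (hN.measurable_mark (.gWL 0 k)) (hN.law_gWL 0 k) b (by positivity)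
      (norm_nonneg _)
  -- The tagged AP is always required to transmit, so the premise is `True`; stating it lets the
  -- same lemma serve both directions within the pair.
  have ek : P (C (.inr k)) = ENNReal.ofReal (1 - pairViol (True ∧ s < t)
      (blockProb p (p.gamED / p.powL) ‖l.2 k - l.1 0‖)) := by
    simp only [C, TransmitterClear, if_true]
    exact measure_clear_pair p (hN.measurable_mark (.gLW k 0)) (hN.law_gLW k 0) True
      (by positivity) (norm_nonneg _)
  have ej : ∀ j, j ≠ 0 → P (C (.inl j)) =
      ENNReal.ofReal (1 - violW p b t s (l.1 0) (l.2 k) (l.1 j)) := by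
    intro j hj
    simp only [C, TransmitterClear, if_neg hj]
    exact measure_clear_and p hN.measurable_mark hN.indep_marks (i := .tW j) (j := .gW j 0)
      (k := .gWL j k) (by simp) (by simp) (by simp) (hN.law_tW j) (hN.law_gW j 0) (hN.law_gWL j k)
      b ht hs (by positivity) (by positivity) (norm_nonneg _) (norm_nonneg _)
  have em : ∀ m, m ≠ k → P (C (.inr m)) =
      ENNReal.ofReal (1 - violL p b t s (l.1 0) (l.2 k) (l.2 m)) := by
    intro m hm
    simp only [C, TransmitterClear, if_neg hm]
    exact measure_clear_and p hN.measurable_mark hN.indep_marks (i := .tL m) (j := .gLW m 0)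
      (k := .gL m k) (by simp) (by simp) (by simp) (hN.law_tL m) (hN.law_gLW m 0) (hN.law_gL m k)
      b ht hs (by positivity) (by positivity) (norm_nonneg _) (norm_nonneg _)
  have s1 : (∑' j, if j = 0 then 0 else negLog (P (C (Sum.inl j)))) =
      ∑' j, if j = 0 then 0 else
          negLog (ENNReal.ofReal (1 - violW p b t s (l.1 0) (l.2 k) (l.1 j))) :=
    tsum_congr fun j => by
      split_ifs with hj
      · rfl
      · rw [ej j hj]
  have s2 : (∑' m, if m = k then 0 else negLog (P (C (Sum.inr m)))) =
      ∑' m, if m = k then 0 else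
          negLog (ENNReal.ofReal (1 - violL p b t s (l.1 0) (l.2 k) (l.2 m))) :=
    tsum_congr fun m => by
      split_ifs with hm
      · rfl
      · rw [em m hm]
  rw [s1, s2, negExp_add, negExp_add, negExp_add, negExp_negLog prob_le_one,
    negExp_negLog prob_le_one, e0, ek, pairWeight]
  ring

/-- The probability that the tagged AP and, if `b`, the eNB with index `k` transmit, for given
locations. -/
theorem measure_coexist (hN : N.IsModel p 0 1 P) (b : Prop) (k : ℕ) (l : Locations) :
    P {ω | canonicalNetwork.Coexist p b k (l, fun s => N.mark s ω)} =
      ∫⁻ z, pairWeight p b z.1 z.2 (l.1 0) (l.2 k) *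
        negExp (∑' j, if j = 0 then 0 else
          negLog (ENNReal.ofReal (1 - violW p b z.1 z.2 (l.1 0) (l.2 k) (l.1 j)))) *
        negExp (∑' m, if m = k then 0 else
          negLog (ENNReal.ofReal (1 - violL p b z.1 z.2 (l.1 0) (l.2 k) (l.2 m))))
        ∂(unif.prod unif) := by
  let Z : Ω → ℝ × ℝ := fun ω => (N.mark (.tW 0) ω, N.mark (.tL k) ω)
  let W : Ω → MarkIndex → ℝ := fun ω => dropTimers k fun r => N.mark r ω
  have hm := hN.measurable_mark
  have hZ : Measurable Z := (hm _).prodMk (hm _)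
  have hW : Measurable W := measurable_pi_lambda _ fun r => by
    simp only [W, dropTimers]
    split_ifs
    · exact measurable_const
    · exact hm r
  have hmapZ : P.map Z = unif.prod unif := by
    have hi : IndepFun (N.mark (.tW 0)) (N.mark (.tL k)) P := hN.indep_marks.indepFun (by simp)
    rw [hi.map_prod_eq_prod_map_map (hm _).aemeasurable (hm _).aemeasurable]
    have e1 : P.map (N.mark (.tW 0)) = unif := (hN.law_tW 0).trans cond_Icc
    have e2 : P.map (N.mark (.tL k)) = unif := (hN.law_tL k).trans cond_Icc
    rw [e1, e2]
  -- The tagged timers are precisely the marks without owner, and `W` is a function of the others.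
  have hZW : IndepFun Z W P := by
    have hdisj : Disjoint {r | owner k r = none} {r | owner k r ≠ none} :=
      Set.disjoint_left.2 fun r h h' => h' h
    have hi := indep_iSup_of_disjoint (fun r => (hm r).comap_le) hN.indep_marks hdisj
    have hle : ∀ (S : Set MarkIndex) (r : MarkIndex), r ∈ S → Measurable[⨆ r ∈ S,
        MeasurableSpace.comap (N.mark r) inferInstance] (N.mark r) := fun S r hr =>
      (comap_measurable (N.mark r)).mono
        (le_iSup₂_of_le (f := fun r (_ : r ∈ S) =>
          MeasurableSpace.comap (N.mark r) inferInstance) r hr le_rfl) le_rfl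
    rw [IndepFun_iff_Indep]
    refine indep_of_indep_of_le hi (Measurable.comap_le ?_) (Measurable.comap_le ?_)
    · exact (hle _ _ (by simp [owner])).prodMk (hle _ _ (by simp [owner]))
    · refine (@measurable_pi_iff Ω MarkIndex (fun _ => ℝ) (_) _ _).2 fun r => ?_
      simp only [W, dropTimers]
      split_ifs with hr
      · exact @measurable_const _ _ _ (_) _
      · exact hle _ _ hr
  let A : Set ((ℝ × ℝ) × (MarkIndex → ℝ)) :=
    {q | ∀ i, TransmitterClear p b k l q.1.1 q.1.2 q.2 i}
  have hA : MeasurableSet A := by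
    have : A = ⋂ i, {q : (ℝ × ℝ) × (MarkIndex → ℝ) |
        TransmitterClear p b k l q.1.1 q.1.2 q.2 i} := by
      ext q; simp [A]
    rw [this]
    exact MeasurableSet.iInter fun i => measurableSet_transmitterClear p b k l
      measurable_fst.fst measurable_fst.snd i
      fun r _ => (measurable_pi_apply r).comp measurable_snd
  have h1 : {ω | canonicalNetwork.Coexist p b k (l, fun s => N.mark s ω)} =
      (fun ω => (Z ω, W ω)) ⁻¹' A := by
    ext ω
    simp only [Set.mem_ofPred_eq, Set.mem_preimage, A, W, Z, transmitterClear_dropTimers]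
    exact coexist_iff_transmitterClear p b k l _
  rw [h1, ← Measure.map_apply (hZ.prodMk hW) hA,
    hZW.map_prod_eq_prod_map_map hZ.aemeasurable hW.aemeasurable, Measure.prod_apply hA, hmapZ]
  have hsupp : ∀ᵐ z ∂(unif.prod unif), z.1 ∈ Set.Icc (0 : ℝ) 1 ∧ z.2 ∈ Set.Icc (0 : ℝ) 1 := by
    have : ∀ᵐ t ∂unif, t ∈ Set.Icc (0 : ℝ) 1 := ae_restrict_mem measurableSet_Icc
    exact (Measure.quasiMeasurePreserving_fst.ae this).and
      (Measure.quasiMeasurePreserving_snd.ae this)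
  refine lintegral_congr_ae (hsupp.mono fun z hz => ?_)
  dsimp only
  rw [Measure.map_apply hW (measurable_prodMk_left hA),
    ← measure_forall_transmitterClear hN b k l hz.1 hz.2]
  congr 1
  ext ω
  simp only [Set.mem_preimage, A, W, Set.mem_ofPred_eq, transmitterClear_dropTimers]

end Marks

/-! ### Two independent Poisson processes. -/

section TwoProcesses

variable {Ω : Type*} [MeasurableSpace Ω] {P : Measure Ω} [IsProbabilityMeasure P]

/-- The joint law is a product, so Tonelli's theorem applies. Both integrals are pulled back to `P`,
for which the Poisson hypotheses are stated. -/
lemma lintegral_indep {α β : Type*} [MeasurableSpace α] [MeasurableSpace β] {f : Ω → α} {g : Ω → β}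
    (hf : Measurable f) (hg : Measurable g) (hfg : IndepFun f g P) {F : α → β → ℝ≥0∞}
    (hF : Measurable fun q : α × β => F q.1 q.2) :
    ∫⁻ ω, F (f ω) (g ω) ∂P = ∫⁻ ω', ∫⁻ ω, F (f ω) (g ω') ∂P ∂P := by
  have h1 : ∫⁻ ω, F (f ω) (g ω) ∂P = ∫⁻ q, F q.1 q.2 ∂P.map fun ω => (f ω, g ω) :=
    (lintegral_map hF (hf.prodMk hg)).symm
  have := Measure.isProbabilityMeasure_map (μ := P) hf.aemeasurable
  have := Measure.isProbabilityMeasure_map (μ := P) hg.aemeasurable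
  rw [h1, hfg.map_prod_eq_prod_map_map hf.aemeasurable hg.aemeasurable,
    lintegral_prod_symm' _ hF, lintegral_map hF.lintegral_prod_left' hg]
  exact lintegral_congr fun ω' => lintegral_map (hF.comp measurable_prodMk_right) hf

variable {a b : ℝ} {X Y : ℕ → Ω → Plane}

lemma measurable_nearestFactor {β : Type*} [MeasurableSpace β] {φ : Plane → β → Plane → ℝ≥0∞}
    (hφ : Measurable fun q : Plane × β × Plane => φ q.1 q.2.1 q.2.2) :
    Measurable fun q : Plane × β => negExp
      (∫⁻ v, (if ‖v‖ ≤ ‖q.1‖ then 1 else 1 - negExp (φ q.1 q.2 v)) ∂intensity a) := by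
  have h : Measurable fun r : (Plane × β) × Plane => φ r.1.1 r.1.2 r.2 :=
    hφ.comp (measurable_fst.fst.prodMk (measurable_fst.snd.prodMk measurable_snd))
  have h' : Measurable fun r : (Plane × β) × Plane =>
      if ‖r.2‖ ≤ ‖r.1.1‖ then 1 else 1 - negExp (φ r.1.1 r.1.2 r.2) :=
    Measurable.ite (measurableSet_le measurable_snd.norm measurable_fst.fst.norm) measurable_const
      ((measurable_negExp.comp h).const_sub 1)
  exact measurable_negExp.comp h'.lintegral_prod_right'

/-- An exponential functional of a Poisson process and an independent random element, seen from the
point of the process nearest to the origin. -/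
lemma nearest_of_indepFun {β : Type*} [MeasurableSpace β] {Z : Ω → β} (ha : 0 ≤ a)
    (hX : IsPoissonProcess P a X) (hZ : Measurable Z) (hXZ : IndepFun (fun ω i => X i ω) Z P)
    (h0 : ∀ᵐ ω ∂P, ∀ j, ‖X 0 ω‖ ≤ ‖X j ω‖) {g : Plane → β → ℝ≥0∞}
    (hg : Measurable fun q : Plane × β => g q.1 q.2) {φ : Plane → β → Plane → ℝ≥0∞}
    (hφ : Measurable fun q : Plane × β × Plane => φ q.1 q.2.1 q.2.2) :
    ∫⁻ ω, g (X 0 ω) (Z ω) * negExp (∑' j, if j = 0 then 0 else φ (X 0 ω) (Z ω) (X j ω)) ∂P =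
      ∫⁻ x, ∫⁻ ω, g x (Z ω) * negExp
        (∫⁻ v, (if ‖v‖ ≤ ‖x‖ then 1 else 1 - negExp (φ x (Z ω) v)) ∂intensity a) ∂P
        ∂intensity a := by
  have hx : ∀ j, Measurable fun q : (ℕ → Plane) × β => q.1 j := fun j =>
    (measurable_pi_apply j).comp measurable_fst
  have hG : Measurable fun q : (ℕ → Plane) × β => g (q.1 0) q.2 * negExp
      (∑' j, if j = 0 then 0 else φ (q.1 0) q.2 (q.1 j)) :=
    (hg.comp ((hx 0).prodMk measurable_snd)).mul
      (measurable_negExp.comp (measurable_tsum_ne 0 fun j =>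
        hφ.comp ((hx 0).prodMk (measurable_snd.prodMk (hx j)))))
  have h1 := lintegral_indep (P := P) (measurable_pi_lambda _ hX.measurable) hZ hXZ
    (F := fun x z => g (x 0) z * negExp (∑' j, if j = 0 then 0 else φ (x 0) z (x j))) hG
  have h2 : ∀ z, ∫⁻ ω, g (X 0 ω) z *
        negExp (∑' j, if j = 0 then 0 else φ (X 0 ω) z (X j ω)) ∂P =
      ∫⁻ x, g x z *
        negExp (∫⁻ v, (if ‖v‖ ≤ ‖x‖ then 1 else 1 - negExp (φ x z v)) ∂intensity a)
        ∂intensity a := fun z =>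
    hX.nearest ha h0 (g := fun x => g x z) (hg.comp measurable_prodMk_right)
      (φ := fun q => φ q.1 z q.2)
      (hφ.comp (measurable_fst.prodMk (measurable_const.prodMk measurable_snd)))
  have h3 : Measurable fun q : Plane × β => g q.1 q.2 * negExp
      (∫⁻ v, (if ‖v‖ ≤ ‖q.1‖ then 1 else 1 - negExp (φ q.1 q.2 v)) ∂intensity a) :=
    hg.mul (measurable_nearestFactor hφ)
  have h4 : Measurable fun q : Ω × Plane => g q.2 (Z q.1) * negExp
      (∫⁻ v, (if ‖v‖ ≤ ‖q.2‖ then 1 else 1 - negExp (φ q.2 (Z q.1) v)) ∂intensity a) :=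
    Measurable.comp (g := fun q : Plane × β => g q.1 q.2 * negExp
      (∫⁻ v, (if ‖v‖ ≤ ‖q.1‖ then 1 else 1 - negExp (φ q.1 q.2 v)) ∂intensity a)) h3
      (f := fun q : Ω × Plane => (q.2, Z q.1)) (measurable_snd.prodMk (hZ.comp measurable_fst))
  exact (h1.trans (lintegral_congr fun ω => h2 (Z ω))).trans
    (lintegral_lintegral_swap h4.aemeasurable)

/-- Expectations of exponential functionals of two independent Poisson processes, seen from the
point of the first process nearest to the origin and from a typical point of the second one. -/
theorem campbell_pair (ha : 0 ≤ a) (hb : 0 ≤ b) (hX : IsPoissonProcess P a X)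
    (hY : IsPoissonProcess P b Y) (hXY : IndepFun (fun ω i => X i ω) (fun ω k => Y k ω) P)
    (h0 : ∀ᵐ ω ∂P, ∀ j, ‖X 0 ω‖ ≤ ‖X j ω‖) {w : Plane → Plane → ℝ≥0∞}
    (hw : Measurable fun q : Plane × Plane => w q.1 q.2) {φ ψ : Plane → Plane → Plane → ℝ≥0∞}
    (hφ : Measurable fun q : Plane × Plane × Plane => φ q.1 q.2.1 q.2.2)
    (hψ : Measurable fun q : Plane × Plane × Plane => ψ q.1 q.2.1 q.2.2) :
    ∑' k, ∫⁻ ω, w (X 0 ω) (Y k ω) *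
        negExp (∑' j, if j = 0 then 0 else φ (X 0 ω) (Y k ω) (X j ω)) *
        negExp (∑' m, if m = k then 0 else ψ (X 0 ω) (Y k ω) (Y m ω)) ∂P =
      ∫⁻ x, ∫⁻ y, w x y *
        negExp (∫⁻ v, (if ‖v‖ ≤ ‖x‖ then 1 else 1 - negExp (φ x y v)) ∂intensity a) *
        negExp (∫⁻ v, (1 - negExp (ψ x y v)) ∂intensity b) ∂intensity b ∂intensity a := by
  have hI := measurable_nearestFactor (a := a) hφ
  set I : Plane × Plane → ℝ≥0∞ := fun q => negExp
    (∫⁻ v, (if ‖v‖ ≤ ‖q.1‖ then 1 else 1 - negExp (φ q.1 q.2 v)) ∂intensity a) with hIdef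
  have hIe : ∀ x y, negExp (∫⁻ v, (if ‖v‖ ≤ ‖x‖ then 1 else 1 - negExp (φ x y v)) ∂intensity a) =
    I (x, y) := fun x y => rfl
  have hy : ∀ k, Measurable fun q : Plane × (ℕ → Plane) => q.2 k := fun k =>
    (measurable_pi_apply k).comp measurable_snd
  have hG : ∀ k, Measurable fun q : Plane × (ℕ → Plane) =>
      w q.1 (q.2 k) * negExp (∑' m, if m = k then 0 else ψ q.1 (q.2 k) (q.2 m)) := fun k =>
    (hw.comp (measurable_fst.prodMk (hy k))).mul (measurable_negExp.comp
      (measurable_tsum_ne k fun m => hψ.comp (measurable_fst.prodMk ((hy k).prodMk (hy m)))))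
  have hYm : Measurable fun ω k => Y k ω := measurable_pi_lambda _ hY.measurable
  have hstep : ∀ k, ∫⁻ ω, w (X 0 ω) (Y k ω) *
        negExp (∑' j, if j = 0 then 0 else φ (X 0 ω) (Y k ω) (X j ω)) *
        negExp (∑' m, if m = k then 0 else ψ (X 0 ω) (Y k ω) (Y m ω)) ∂P =
      ∫⁻ x, ∫⁻ ω, w x (Y k ω) * I (x, Y k ω) *
        negExp (∑' m, if m = k then 0 else ψ x (Y k ω) (Y m ω)) ∂P ∂intensity a := fun k => by
    have hyk : Measurable fun q : Plane × (ℕ → Plane) × Plane => (q.1, q.2.1 k, q.2.2) :=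
      measurable_fst.prodMk (((measurable_pi_apply k).comp measurable_snd.fst).prodMk
        measurable_snd.snd)
    have hφk : Measurable fun q : Plane × (ℕ → Plane) × Plane => φ q.1 (q.2.1 k) q.2.2 :=
      hφ.comp hyk
    -- The whole sequence of eNBs is the independent random element, and `g` absorbs the eNB factor,
    -- which involves the APs only through the tagged one.
    have h := nearest_of_indepFun ha hX hYm hXY h0 (g := fun x y =>
      w x (y k) * negExp (∑' m, if m = k then 0 else ψ x (y k) (y m))) (hG k) (φ := fun x y v => φ x (y k) v) hφk
    calc _ = _ := lintegral_congr fun ω => mul_right_comm _ _ _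
      _ = _ := h
      _ = _ := lintegral_congr fun x => lintegral_congr fun ω => mul_right_comm _ _ _
  clear_value I
  simp_rw [hstep, hIe]
  have hm : ∀ k, Measurable fun q : Plane × Ω => w q.1 (Y k q.2) * I (q.1, Y k q.2) *
      negExp (∑' m, if m = k then 0 else ψ q.1 (Y k q.2) (Y m q.2)) := fun k => by
    have hYq : ∀ m, Measurable fun q : Plane × Ω => Y m q.2 := fun m =>
      (hY.measurable m).comp measurable_snd
    exact ((hw.comp (measurable_fst.prodMk (hYq k))).mul
      (hI.comp (measurable_fst.prodMk (hYq k)))).mul (measurable_negExp.comp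
      (measurable_tsum_ne k fun m => hψ.comp (measurable_fst.prodMk ((hYq k).prodMk (hYq m)))))
  refine (lintegral_tsum fun k => (hm k).lintegral_prod_right'.aemeasurable).symm.trans ?_
  refine lintegral_congr fun x => ?_
  have hx : Measurable fun y : Plane => (x, y) := measurable_prodMk_left
  have hψ' : Measurable fun q : Plane × Plane => ψ x q.1 q.2 :=
    hψ.comp (measurable_const.prodMk (measurable_fst.prodMk measurable_snd))
  -- With the tagged AP frozen at `x`, only the eNB process is random, and the AP factor `I` depends
  -- on the chosen eNB alone.
  exact hY.mecke hb (g := fun y => w x y * I (x, y))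
    ((hw.comp hx).mul (hI.comp hx)) (φ := fun q => ψ x q.1 q.2) hψ'

end TwoProcesses

/-! ### Densities of the Campbell measures. -/

section Campbell

variable {Ω : Type*} [MeasurableSpace Ω] {P : Measure Ω} [IsProbabilityMeasure P]
  {p : Params} {N : Network Ω}

lemma viol_nonneg (b : Prop) {t s q₁ q₂ : ℝ} (ht : 0 ≤ t) (hs : 0 ≤ s) (h₁ : 0 ≤ q₁)
    (h₁' : q₁ ≤ 1) (h₂ : 0 ≤ q₂) : 0 ≤ viol b t s q₁ q₂ := by
  unfold viol
  split_ifs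
  · have h3 : min t s * (q₁ * q₂) ≤ s * (1 * q₂) := by gcongr; exact min_le_right _ _
    have := mul_nonneg ht h₁
    linarith
  · have := mul_nonneg ht h₁
    linarith

/-- Ensures that `ENNReal.ofReal (1 - viol ..)` is not truncated, as `one_sub_negExp_negLog`
requires. -/
lemma viol_le_one (b : Prop) {t s q₁ q₂ : ℝ} (ht : t ∈ Set.Icc (0 : ℝ) 1)
    (hs : s ∈ Set.Icc (0 : ℝ) 1) (h₁ : 0 ≤ q₁) (h₁' : q₁ ≤ 1) (h₂ : 0 ≤ q₂) (h₂' : q₂ ≤ 1) :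
    viol b t s q₁ q₂ ≤ 1 := by
  obtain ⟨ht0, ht1⟩ := ht
  obtain ⟨hs0, hs1⟩ := hs
  unfold viol
  split_ifs
  · rcases le_total t s with h | h
    · rw [min_eq_left h]
      nlinarith [mul_nonneg h₁ (sub_nonneg.2 h₂'), mul_nonneg (sub_nonneg.2 h)
        (mul_nonneg h₁ (sub_nonneg.2 h₂')), mul_nonneg (sub_nonneg.2 hs1)
        (mul_nonneg h₁ (sub_nonneg.2 h₂')), mul_nonneg (sub_nonneg.2 hs1) h₂,
        mul_nonneg (sub_nonneg.2 h₁') (sub_nonneg.2 h₂')]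
    · rw [min_eq_right h]
      nlinarith [mul_nonneg (sub_nonneg.2 h) (mul_nonneg h₂ (sub_nonneg.2 h₁')),
        mul_nonneg (sub_nonneg.2 ht1) (mul_nonneg h₂ (sub_nonneg.2 h₁')),
        mul_nonneg (sub_nonneg.2 ht1) h₁, mul_nonneg (sub_nonneg.2 h₁') (sub_nonneg.2 h₂')]
  · nlinarith [mul_nonneg (sub_nonneg.2 ht1) h₁]

lemma violW_nonneg (p : Params) (b : Prop) {t s : ℝ} (ht : 0 ≤ t) (hs : 0 ≤ s) (x y z : Plane) :
    0 ≤ violW p b t s x y z :=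
  viol_nonneg b ht hs (blockProb_nonneg _ _ _)
    (blockProb_le_one p (div_pos p.gamCS_pos p.powW_pos).le (norm_nonneg _)) (blockProb_nonneg _ _ _)

lemma violL_nonneg (p : Params) (b : Prop) {t s : ℝ} (ht : 0 ≤ t) (hs : 0 ≤ s) (x y z : Plane) :
    0 ≤ violL p b t s x y z :=
  viol_nonneg b ht hs (blockProb_nonneg _ _ _)
    (blockProb_le_one p (div_pos p.gamED_pos p.powL_pos).le (norm_nonneg _)) (blockProb_nonneg _ _ _)

lemma violW_le_one (p : Params) (b : Prop) {t s : ℝ} (ht : t ∈ Set.Icc (0 : ℝ) 1)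
    (hs : s ∈ Set.Icc (0 : ℝ) 1) (x y z : Plane) : violW p b t s x y z ≤ 1 :=
  viol_le_one b ht hs (blockProb_nonneg _ _ _)
    (blockProb_le_one p (div_pos p.gamCS_pos p.powW_pos).le (norm_nonneg _)) (blockProb_nonneg _ _ _)
    (blockProb_le_one p (div_pos p.gamL_pos p.powW_pos).le (norm_nonneg _))

lemma violL_le_one (p : Params) (b : Prop) {t s : ℝ} (ht : t ∈ Set.Icc (0 : ℝ) 1)
    (hs : s ∈ Set.Icc (0 : ℝ) 1) (x y z : Plane) : violL p b t s x y z ≤ 1 :=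
  viol_le_one b ht hs (blockProb_nonneg _ _ _)
    (blockProb_le_one p (div_pos p.gamED_pos p.powL_pos).le (norm_nonneg _)) (blockProb_nonneg _ _ _)
    (blockProb_le_one p (div_pos p.gamL_pos p.powL_pos).le (norm_nonneg _))

lemma measurable_viol {α : Type*} [MeasurableSpace α] (b : Prop) {t s q₁ q₂ : α → ℝ}
    (ht : Measurable t) (hs : Measurable s) (h₁ : Measurable q₁) (h₂ : Measurable q₂) :
    Measurable fun a => viol b (t a) (s a) (q₁ a) (q₂ a) := by
  unfold viol
  by_cases hb : b
  · simp only [hb, if_true]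
    exact (ht.mul h₁).add ((hs.mul h₂).sub ((ht.min hs).mul (h₁.mul h₂)))
  · simp only [hb, if_false, add_zero]
    exact ht.mul h₁

lemma measurable_violW {α : Type*} [MeasurableSpace α] (p : Params) (b : Prop) {t s : α → ℝ}
    {x y z : α → Plane} (ht : Measurable t) (hs : Measurable s) (hx : Measurable x)
    (hy : Measurable y) (hz : Measurable z) :
    Measurable fun a => violW p b (t a) (s a) (x a) (y a) (z a) :=
  measurable_viol b ht hs ((measurable_blockProb p _).comp (hz.sub hx).norm)
    ((measurable_blockProb p _).comp (hy.sub hz).norm)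

lemma measurable_violL {α : Type*} [MeasurableSpace α] (p : Params) (b : Prop) {t s : α → ℝ}
    {x y z : α → Plane} (ht : Measurable t) (hs : Measurable s) (hx : Measurable x)
    (hy : Measurable y) (hz : Measurable z) :
    Measurable fun a => violL p b (t a) (s a) (x a) (y a) (z a) :=
  measurable_viol b ht hs ((measurable_blockProb p _).comp (hz.sub hx).norm)
    ((measurable_blockProb p _).comp (hz.sub hy).norm)

lemma measurable_pairViol {α : Type*} [MeasurableSpace α] (b : Prop) {t s q : α → ℝ}
    (ht : Measurable t) (hs : Measurable s) (hq : Measurable q) :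
    Measurable fun a => pairViol (b ∧ t a < s a) (q a) := by
  unfold pairViol
  by_cases hb : b
  · simp only [hb, true_and]
    exact Measurable.ite (measurableSet_lt ht hs) hq measurable_const
  · simp [hb]

lemma measurable_pairWeight {α : Type*} [MeasurableSpace α] (p : Params) (b : Prop) {t s : α → ℝ}
    {x y : α → Plane} (ht : Measurable t) (hs : Measurable s) (hx : Measurable x)
    (hy : Measurable y) : Measurable fun a => pairWeight p b (t a) (s a) (x a) (y a) :=
  ((measurable_pairViol b ht hs
    ((measurable_blockProb p _).comp (hy.sub hx).norm)).const_sub 1).ennreal_ofReal.mul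
  ((measurable_pairViol True hs ht
    ((measurable_blockProb p _).comp (hy.sub hx).norm)).const_sub 1).ennreal_ofReal

/-- The probability that the tagged AP at `x` with timer `t` and, if `b`, the eNB at `y` with
timer `s` transmit, times the probability that there is no AP in the disc through `x`. -/
def timedDensity (p : Params) (b : Prop) (t s : ℝ) (x y : Plane) : ℝ≥0∞ :=
  pairWeight p b t s x y *
    negExp (∫⁻ v, (if ‖v‖ ≤ ‖x‖ then 1 else ENNReal.ofReal (violW p b t s x y v))
      ∂intensity p.lamW) *
    negExp (∫⁻ v, ENNReal.ofReal (violL p b t s x y v) ∂intensity p.lamL)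

lemma measurable_timedDensity (p : Params) (b : Prop) :
    Measurable fun q : (Plane × Plane) × (ℝ × ℝ) =>
      timedDensity p b q.2.1 q.2.2 q.1.1 q.1.2 := by
  refine ((measurable_pairWeight p b (by fun_prop) (by fun_prop) (by fun_prop)
    (by fun_prop)).mul (measurable_negExp.comp (Measurable.lintegral_prod_right' (f := fun r :
      ((Plane × Plane) × (ℝ × ℝ)) × Plane => if ‖r.2‖ ≤ ‖r.1.1.1‖ then 1 else
        ENNReal.ofReal (violW p b r.1.2.1 r.1.2.2 r.1.1.1 r.1.1.2 r.2)) ?_))).mul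
    (measurable_negExp.comp (Measurable.lintegral_prod_right' (f := fun r :
      ((Plane × Plane) × (ℝ × ℝ)) × Plane =>
        ENNReal.ofReal (violL p b r.1.2.1 r.1.2.2 r.1.1.1 r.1.1.2 r.2)) ?_))
  · exact Measurable.ite (measurableSet_le (by fun_prop) (by fun_prop)) measurable_const
      (measurable_violW p b (by fun_prop) (by fun_prop) (by fun_prop) (by fun_prop)
        (by fun_prop)).ennreal_ofReal
  · exact (measurable_violL p b (by fun_prop) (by fun_prop) (by fun_prop) (by fun_prop)
      (by fun_prop)).ennreal_ofReal

/-- The density of the Campbell measure of the pairs (tagged AP, eNB). -/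
def campbellDensity (p : Params) (b : Prop) (x y : Plane) : ℝ≥0∞ :=
  ∫⁻ z, timedDensity p b z.1 z.2 x y ∂(unif.prod unif)

lemma measurableSet_forall_nat {α : Type*} [MeasurableSpace α] {q : ℕ → α → Prop}
    (h : ∀ j, MeasurableSet {a | q j a}) : MeasurableSet {a | ∀ j, q j a} := by
  have : {a | ∀ j, q j a} = ⋂ j, {a | q j a} := by
    ext
    simp
  rw [this]
  exact .iInter h

lemma measurableSet_coexist (p : Params) (b : Prop) (k : ℕ) :
    MeasurableSet {q | canonicalNetwork.Coexist p b k q} := by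
  have hx : ∀ i, Measurable (canonicalNetwork.x i) := fun i =>
    (measurable_pi_apply i).comp measurable_fst.fst
  have hy : ∀ i, Measurable (canonicalNetwork.y i) := fun i =>
    (measurable_pi_apply i).comp measurable_fst.snd
  have hu : ∀ r : MarkIndex, Measurable fun q : Locations × (MarkIndex → ℝ) => q.2 r := fun r =>
    (measurable_pi_apply r).comp measurable_snd
  have key : ∀ (r₁ r₂ r₃ : MarkIndex) (v v' : Locations × (MarkIndex → ℝ) → Plane) (θ : ℝ),
      Measurable v → Measurable v' → MeasurableSet {q : Locations × (MarkIndex → ℝ) |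
        q.2 r₁ ≤ q.2 r₂ ∨ q.2 r₃ / p.pathLoss ‖v q - v' q‖ ≤ θ} := fun r₁ r₂ r₃ v v' θ hv hv' =>
    (measurableSet_le (hu r₁) (hu r₂)).union (measurableSet_le
      ((hu r₃).div ((measurable_pathLoss p).comp (hv.sub hv').norm)) measurable_const)
  refine MeasurableSet.inter (MeasurableSet.inter ?_ ?_) (measurableSet_imp b
    (MeasurableSet.inter ?_ ?_))
  · exact measurableSet_forall_nat fun j => measurableSet_imp _ (key _ _ _ _ _ _ (hx j) (hx 0))
  · exact measurableSet_forall_nat fun m => key _ _ _ _ _ _ (hy m) (hx 0)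
  · exact measurableSet_forall_nat fun j => key _ _ _ _ _ _ (hy k) (hx j)
  · exact measurableSet_forall_nat fun m => measurableSet_imp _ (key _ _ _ _ _ _ (hy m) (hy k))

/-- The Campbell measure of the pairs (tagged AP, eNB) on the event that the tagged AP and, if `b`,
the eNB transmit. -/
def Network.campbell (N : Network Ω) (p : Params) (P : Measure Ω) (b : Prop) :
    Measure (Plane × Plane) :=
  Measure.sum fun k => (P.restrict {ω | N.Coexist p b k ω}).map fun ω => (N.x 0 ω, N.y k ω)

/-- For `φ = -log (1 - v)` the integrand `1 - e^{-φ}` of the Laplace functional collapses to the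
silencing probability `v`. -/
lemma one_sub_negExp_negLog {v : ℝ} (hv : 0 ≤ v) (hv1 : v ≤ 1) :
    1 - negExp (negLog (ENNReal.ofReal (1 - v))) = ENNReal.ofReal v := by
  rw [negExp_negLog (by rw [ENNReal.ofReal_le_one]; linarith), ← ENNReal.ofReal_one,
    ← ENNReal.ofReal_sub _ (by linarith)]
  congr 1
  ring

/-- For frozen timers the conditional probability is a product of exponential sums over the two
processes, so `campbell_pair` applies with `-log (1 - viol)` as exponents. -/
lemma campbell_timed (hN : N.IsModel p 0 1 P) (b : Prop) {S : Set (Plane × Plane)}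
    (hS : MeasurableSet S) {t s : ℝ} (ht : t ∈ Set.Icc (0 : ℝ) 1) (hs : s ∈ Set.Icc (0 : ℝ) 1) :
    ∑' k, ∫⁻ ω, (S.indicator 1 (N.x 0 ω, N.y k ω) * pairWeight p b t s (N.x 0 ω) (N.y k ω)) *
        negExp (∑' j, if j = 0 then 0 else negLog (ENNReal.ofReal
          (1 - violW p b t s (N.x 0 ω) (N.y k ω) (N.x j ω)))) *
        negExp (∑' m, if m = k then 0 else negLog (ENNReal.ofReal
          (1 - violL p b t s (N.x 0 ω) (N.y k ω) (N.y m ω)))) ∂P =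
      ∫⁻ q, S.indicator 1 q * timedDensity p b t s q.1 q.2
        ∂((intensity p.lamW).prod (intensity p.lamL)) := by
  have hφ : Measurable fun q : Plane × Plane × Plane => negLog (ENNReal.ofReal
      (1 - violW p b t s q.1 q.2.1 q.2.2)) :=
    measurable_negLog.comp ((measurable_violW p b measurable_const measurable_const measurable_fst
      measurable_snd.fst measurable_snd.snd).const_sub 1).ennreal_ofReal
  have hψ : Measurable fun q : Plane × Plane × Plane => negLog (ENNReal.ofReal
      (1 - violL p b t s q.1 q.2.1 q.2.2)) :=
    measurable_negLog.comp ((measurable_violL p b measurable_const measurable_const measurable_fst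
      measurable_snd.fst measurable_snd.snd).const_sub 1).ennreal_ofReal
  have hSind : Measurable (S.indicator (1 : Plane × Plane → ℝ≥0∞)) := measurable_one.indicator hS
  have hw : Measurable fun q : Plane × Plane =>
      S.indicator 1 (q.1, q.2) * pairWeight p b t s q.1 q.2 :=
    hSind.mul (measurable_pairWeight p b measurable_const measurable_const measurable_fst
      measurable_snd)
  refine (campbell_pair p.lamW_pos.le p.lamL_pos.le hN.poissonW hN.poissonL
    hN.indep_locations hN.tagged (w := fun x y => S.indicator 1 (x, y) * pairWeight p b t s x y) hw
    (φ := fun x y v => negLog (ENNReal.ofReal (1 - violW p b t s x y v))) hφ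
    (ψ := fun x y v => negLog (ENNReal.ofReal (1 - violL p b t s x y v))) hψ).trans ?_
  have hD : Measurable fun q : Plane × Plane => timedDensity p b t s q.1 q.2 :=
    Measurable.comp (g := fun q : (Plane × Plane) × (ℝ × ℝ) =>
      timedDensity p b q.2.1 q.2.2 q.1.1 q.1.2) (measurable_timedDensity p b)
      (f := fun q : Plane × Plane => (q, (t, s))) measurable_prodMk_right
  refine Eq.trans ?_ (lintegral_prod (fun q : Plane × Plane => S.indicator 1 q *
    timedDensity p b t s q.1 q.2) (hSind.mul hD).aemeasurable).symm
  refine lintegral_congr fun x => lintegral_congr fun y => ?_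
  have h1 : ∀ v, 1 - negExp (negLog (ENNReal.ofReal (1 - violW p b t s x y v))) =
      ENNReal.ofReal (violW p b t s x y v) := fun v =>
    one_sub_negExp_negLog (violW_nonneg p b ht.1 hs.1 x y v) (violW_le_one p b ht hs x y v)
  have h2 : ∀ v, 1 - negExp (negLog (ENNReal.ofReal (1 - violL p b t s x y v))) =
      ENNReal.ofReal (violL p b t s x y v) := fun v =>
    one_sub_negExp_negLog (violL_nonneg p b ht.1 hs.1 x y v) (violL_le_one p b ht hs x y v)
  simp only [h1, h2, timedDensity, mul_assoc]

/-- The Campbell measure has a density with respect to the product of the intensities. -/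
theorem campbell_eq_withDensity (hN : N.IsModel p 0 1 P) (b : Prop) :
    N.campbell p P b = ((intensity p.lamW).prod (intensity p.lamL)).withDensity
      fun q => campbellDensity p b q.1 q.2 := by
  ext S hS
  have hx := hN.poissonW.measurable
  have hy := hN.poissonL.measurable
  have hlocX : Measurable fun ω i => N.x i ω := measurable_pi_lambda _ hx
  have hlocY : Measurable fun ω i => N.y i ω := measurable_pi_lambda _ hy
  have hloc : Measurable N.locations := hlocX.prodMk hlocY
  have hmark : Measurable fun ω s => N.mark s ω := measurable_pi_lambda _ hN.measurable_mark
  have hSind : Measurable (S.indicator (1 : Plane × Plane → ℝ≥0∞)) := measurable_one.indicator hS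
  have hD := measurable_timedDensity p b
  -- The marks are integrated out at fixed locations. Independence is used on the product of
  -- locations and marks, where the event is the one of `canonicalNetwork`.
  have hterm : ∀ k, ((P.restrict {ω | N.Coexist p b k ω}).map fun ω => (N.x 0 ω, N.y k ω)) S =
      ∫⁻ ω, ∫⁻ z, (S.indicator 1 (N.x 0 ω, N.y k ω) *
        pairWeight p b z.1 z.2 (N.x 0 ω) (N.y k ω)) *
        negExp (∑' j, if j = 0 then 0 else negLog (ENNReal.ofReal
          (1 - violW p b z.1 z.2 (N.x 0 ω) (N.y k ω) (N.x j ω)))) *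
        negExp (∑' m, if m = k then 0 else negLog (ENNReal.ofReal
          (1 - violL p b z.1 z.2 (N.x 0 ω) (N.y k ω) (N.y m ω)))) ∂(unif.prod unif) ∂P := by
    intro k
    have hxy : Measurable fun ω => (N.x 0 ω, N.y k ω) := (hx 0).prodMk (hy k)
    have hco := measurableSet_coexist p b k
    have hco' : MeasurableSet {ω | N.Coexist p b k ω} := (hloc.prodMk hmark) hco
    rw [Measure.map_apply hxy hS, Measure.restrict_apply (hxy hS)]
    have h1 : P ((fun ω => (N.x 0 ω, N.y k ω)) ⁻¹' S ∩ {ω | N.Coexist p b k ω}) =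
        ∫⁻ ω, S.indicator 1 (N.x 0 ω, N.y k ω) *
          {q | canonicalNetwork.Coexist p b k q}.indicator 1
            (N.locations ω, fun s => N.mark s ω) ∂P := by
      rw [← lintegral_indicator_one ((hxy hS).inter hco')]
      refine lintegral_congr fun ω => ?_
      rw [Set.inter_indicator_one]
      rfl
    refine h1.trans (Eq.trans (lintegral_indep (F := fun l u => S.indicator 1 (l.1 0, l.2 k) *
      {q | canonicalNetwork.Coexist p b k q}.indicator 1 (l, u)) hloc hmark
        hN.indep_locations_marks ?_) ((lintegral_lintegral_swap ?_).trans ?_))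
    rotate_left 2
    · refine lintegral_congr fun ω => ?_
      have h2 : ∫⁻ ω', {q | canonicalNetwork.Coexist p b k q}.indicator 1
          (N.locations ω, fun s => N.mark s ω') ∂P =
          P {ω' | canonicalNetwork.Coexist p b k (N.locations ω, fun s => N.mark s ω')} := by
        have hm : Measurable fun ω' => (N.locations ω, fun s => N.mark s ω') :=
          measurable_const.prodMk hmark
        exact lintegral_indicator_one (hm hco)
      have hSf : S.indicator (1 : Plane × Plane → ℝ≥0∞) (N.x 0 ω, N.y k ω) ≠ ∞ := by
        by_cases h : (N.x 0 ω, N.y k ω) ∈ S <;> simp [h]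
      rw [lintegral_const_mul' _ _ (by exact hSf), h2, measure_coexist hN b k,
        ← lintegral_const_mul' _ _ (by exact hSf)]
      refine lintegral_congr fun z => ?_
      simp only [mul_assoc]
      rfl
    · exact (hSind.comp ((((measurable_pi_apply 0).comp measurable_fst).comp measurable_fst).prodMk
        (((measurable_pi_apply k).comp measurable_snd).comp measurable_fst))).mul
        (measurable_one.indicator hco)
    · refine Measurable.aemeasurable ?_
      exact (hSind.comp (hxy.comp measurable_snd)).mul ((measurable_one.indicator hco).comp
        ((hloc.comp measurable_snd).prodMk (hmark.comp measurable_fst)))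
  have hjoint : ∀ k, Measurable fun q : Ω × (ℝ × ℝ) => (S.indicator 1 (N.x 0 q.1, N.y k q.1) *
        pairWeight p b q.2.1 q.2.2 (N.x 0 q.1) (N.y k q.1)) *
        negExp (∑' j, if j = 0 then 0 else negLog (ENNReal.ofReal
          (1 - violW p b q.2.1 q.2.2 (N.x 0 q.1) (N.y k q.1) (N.x j q.1)))) *
        negExp (∑' m, if m = k then 0 else negLog (ENNReal.ofReal
          (1 - violL p b q.2.1 q.2.2 (N.x 0 q.1) (N.y k q.1) (N.y m q.1)))) := by
    intro k
    have hX : ∀ j, Measurable fun q : Ω × (ℝ × ℝ) => N.x j q.1 := fun j =>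
      (hx j).comp measurable_fst
    have hY : ∀ j, Measurable fun q : Ω × (ℝ × ℝ) => N.y j q.1 := fun j =>
      (hy j).comp measurable_fst
    refine (((hSind.comp ((hX 0).prodMk (hY k))).mul (measurable_pairWeight p b
      measurable_snd.fst measurable_snd.snd (hX 0) (hY k))).mul
      (measurable_negExp.comp (measurable_tsum_ne 0 fun j => ?_))).mul
      (measurable_negExp.comp (measurable_tsum_ne k fun m => ?_))
    · exact measurable_negLog.comp ((measurable_violW p b measurable_snd.fst measurable_snd.snd
        (hX 0) (hY k) (hX j)).const_sub 1).ennreal_ofReal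
    · exact measurable_negLog.comp ((measurable_violL p b measurable_snd.fst measurable_snd.snd
        (hX 0) (hY k) (hY m)).const_sub 1).ennreal_ofReal
  -- The timers become the outermost variables, since the Poisson formulas are applied for each
  -- fixed pair of timers.
  have hswap : ∀ k, ((P.restrict {ω | N.Coexist p b k ω}).map fun ω => (N.x 0 ω, N.y k ω)) S =
      ∫⁻ z, ∫⁻ ω, (S.indicator 1 (N.x 0 ω, N.y k ω) *
        pairWeight p b z.1 z.2 (N.x 0 ω) (N.y k ω)) *
        negExp (∑' j, if j = 0 then 0 else negLog (ENNReal.ofReal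
          (1 - violW p b z.1 z.2 (N.x 0 ω) (N.y k ω) (N.x j ω)))) *
        negExp (∑' m, if m = k then 0 else negLog (ENNReal.ofReal
          (1 - violL p b z.1 z.2 (N.x 0 ω) (N.y k ω) (N.y m ω)))) ∂P ∂(unif.prod unif) := fun k =>
    (hterm k).trans (lintegral_lintegral_swap (hjoint k).aemeasurable)
  rw [Network.campbell, Measure.sum_apply _ hS]
  simp_rw [hswap]
  have hsupp : ∀ᵐ z ∂(unif.prod unif), z.1 ∈ Set.Icc (0 : ℝ) 1 ∧ z.2 ∈ Set.Icc (0 : ℝ) 1 := by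
    have : ∀ᵐ t ∂unif, t ∈ Set.Icc (0 : ℝ) 1 := ae_restrict_mem measurableSet_Icc
    exact (Measure.quasiMeasurePreserving_fst.ae this).and
      (Measure.quasiMeasurePreserving_snd.ae this)
  have hz := fun z (hz : z ∈ {z : ℝ × ℝ | z.1 ∈ Set.Icc (0 : ℝ) 1 ∧ z.2 ∈ Set.Icc (0 : ℝ) 1}) =>
    campbell_timed hN b hS hz.1 hz.2
  refine ((lintegral_tsum fun k => ((hjoint k).comp
    measurable_swap).lintegral_prod_right'.aemeasurable).symm.trans
      (lintegral_congr_ae (hsupp.mono hz))).trans ?_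
  rw [lintegral_lintegral_swap, withDensity_apply _ hS, ← lintegral_indicator hS]
  · refine lintegral_congr fun q => ?_
    by_cases hq : q ∈ S
    · simp [hq, campbellDensity]
    · simp [hq]
  · exact ((hSind.comp measurable_snd).mul
      (hD.comp (measurable_snd.prodMk measurable_fst))).aemeasurable

end Campbell

/-! ### The special functions -/

section SpecialFunctions

variable (p : Params)

/-- The probability that the signal from displacement `u` exceeds `θ`. -/
def decay (θ : ℝ) (u : Plane) : ℝ := Real.exp (-(p.mu * θ * p.pathLoss ‖u‖))

lemma continuous_pathLoss : Continuous p.pathLoss := by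
  unfold Params.pathLoss
  exact continuous_const.mul (Real.continuous_rpow_const p.alpha_pos.le)

@[fun_prop]
lemma continuous_decay (θ : ℝ) : Continuous (decay p θ) := by
  have := continuous_pathLoss p
  unfold decay
  fun_prop

lemma decay_pos (θ : ℝ) (u : Plane) : 0 < decay p θ u := Real.exp_pos _

lemma decay_nonneg (θ : ℝ) (u : Plane) : 0 ≤ decay p θ u := (decay_pos p θ u).le

variable {p} in
lemma decay_le_one {θ : ℝ} (hθ : 0 < θ) (u : Plane) : decay p θ u ≤ 1 := by
  rw [decay, Real.exp_le_one_iff, neg_nonpos]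
  exact mul_nonneg (mul_pos p.mu_pos hθ).le (pathLoss_nonneg p (norm_nonneg _))

variable {p} in
lemma decay_lt_one {θ : ℝ} (hθ : 0 < θ) {u : Plane} (hu : u ≠ 0) : decay p θ u < 1 := by
  rw [decay, Real.exp_lt_one_iff, neg_lt_zero]
  exact mul_pos (mul_pos p.mu_pos hθ) (pathLoss_pos p (norm_pos_iff.2 hu))

lemma blockProb_eq_decay (θ : ℝ) {u : Plane} (hu : u ≠ 0) : blockProb p θ ‖u‖ = decay p θ u := by
  rw [blockProb, if_neg (norm_ne_zero_iff.2 hu), decay]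

-- In polar coordinates this is the integral of `d * exp (-c d^α)` over the half-line, finite
-- because `c` and `α` are positive.
variable {p} in
lemma integrable_decay {θ : ℝ} (hθ : 0 < θ) : Integrable (decay p θ) := by
  have hw := p.wavelength_pos
  have hc : 0 < p.mu * θ * (4 * Real.pi / p.wavelength) ^ 2 :=
    mul_pos (mul_pos p.mu_pos hθ) (by positivity)
  have h := (integrable_fun_norm_addHaar (E := Plane) volume (f := fun d : ℝ =>
    Real.exp (-(p.mu * θ * p.pathLoss d)))).2 (by
      refine (integrableOn_rpow_mul_exp_neg_mul_rpow (s := 1) (by norm_num) p.alpha_pos hc).congr_fun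
        (fun d _ => ?_) measurableSet_Ioi
      simp [Params.pathLoss, mul_assoc])
  exact h

variable {p} in
lemma integrable_decay_sub {θ : ℝ} (hθ : 0 < θ) (z : Plane) :
    Integrable fun v => decay p θ (v - z) := (integrable_decay hθ).comp_sub_right z

variable {p} in
lemma integrable_decay_mul {θ₁ θ₂ : ℝ} (h₁ : 0 < θ₁) (h₂ : 0 < θ₂) (z₁ z₂ : Plane) :
    Integrable fun v => decay p θ₁ (v - z₁) * decay p θ₂ (v - z₂) := by
  refine (integrable_decay_sub (p := p) h₁ z₁).mono' (by fun_prop) (.of_forall fun v => ?_)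
  rw [Real.norm_of_nonneg (mul_nonneg (decay_nonneg _ _ _) (decay_nonneg _ _ _))]
  exact mul_le_of_le_one_right (decay_nonneg _ _ _) (decay_le_one h₂ _)

/-- The integral of a decaying kernel over the complement of a disc depends continuously on
parameters. -/
lemma continuous_setIntegral_decay {β : Type*} [TopologicalSpace β] [FirstCountableTopology β]
    {θ : ℝ} (hθ : 0 < θ) {r : β → ℝ} {z : β → Plane} {K : β → Plane → ℝ} (hr : Continuous r)
    (hz : Continuous z) (hK : Continuous fun q : β × Plane => K q.1 q.2)
    (hK1 : ∀ q v, |K q v| ≤ 1) :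
    Continuous fun q => ∫ v in (Metric.closedBall (0 : Plane) (r q))ᶜ,
      decay p θ (v - z q) * K q v := by
  -- After translation by `z q` the kernel `decay p θ` no longer depends on `q` and dominates all
  -- the integrands.
  have h1 : ∀ q, ∫ v in (Metric.closedBall (0 : Plane) (r q))ᶜ, decay p θ (v - z q) * K q v =
      ∫ u, if r q < ‖u + z q‖ then decay p θ u * K q (u + z q) else 0 := by
    intro q
    rw [← integral_indicator Metric.isClosed_closedBall.measurableSet.compl,
      ← integral_add_right_eq_self _ (z q)]
    refine integral_congr_ae (.of_forall fun u => ?_)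
    simp only [Set.indicator, Set.mem_compl_iff, mem_closedBall_zero_iff, not_le,
      add_sub_cancel_right]
  simp_rw [h1]
  refine continuous_iff_continuousAt.2 fun q₀ => continuousAt_of_dominated
    (bound := fun u => decay p θ u) (.of_forall fun q => ?_)
    (.of_forall fun q => .of_forall fun u => ?_) (integrable_decay hθ) ?_
  · have hKq : Continuous (K q) := hK.comp (by fun_prop : Continuous fun v => (q, v))
    exact (Measurable.ite (measurableSet_lt (by fun_prop) (by fun_prop))
      (by fun_prop) measurable_const).aestronglyMeasurable
  · split_ifs
    · rw [norm_mul, Real.norm_of_nonneg (decay_nonneg _ _ _)]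
      exact mul_le_of_le_one_right (decay_nonneg _ _ _) (hK1 _ _)
    · simpa using decay_nonneg p θ u
  · have hs : ∀ᵐ u : Plane, u ∉ Metric.sphere (-z q₀) (r q₀) :=
      measure_eq_zero_iff_ae_notMem.1 (Measure.addHaar_sphere _ _ _)
    filter_upwards [hs] with u hu
    have hu' : ‖u + z q₀‖ ≠ r q₀ := by simpa [dist_eq_norm] using hu
    have hn : Continuous fun q => ‖u + z q‖ := by fun_prop
    have hc : Continuous fun q => decay p θ u * K q (u + z q) :=
      continuous_const.mul (hK.comp (by fun_prop : Continuous fun q => (q, u + z q)))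
    rcases lt_or_gt_of_ne hu' with h | h
    · refine (continuousAt_const (y := (0 : ℝ))).congr ?_
      filter_upwards [hn.continuousAt.eventually_lt hr.continuousAt h] with q hq
      rw [if_neg hq.not_gt]
    · refine hc.continuousAt.congr ?_
      filter_upwards [hr.continuousAt.eventually_lt hn.continuousAt h] with q hq
      rw [if_pos hq]

lemma N0L_eq (y : Plane) (r g : ℝ) : N0L p y r g =
    p.lamL * ∫ v in (Metric.closedBall (0 : Plane) r)ᶜ, decay p (g / p.powL) (v - y) := rfl

lemma N0W_eq (y : Plane) (r g : ℝ) : N0W p y r g =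
    p.lamW * ∫ v in (Metric.closedBall (0 : Plane) r)ᶜ, decay p (g / p.powW) (v - y) := rfl

lemma C0L_eq (y₁ : Plane) (g₁ : ℝ) (y₂ : Plane) (g₂ : ℝ) : C0L p y₁ g₁ y₂ g₂ =
    p.lamL * ∫ v in (Metric.closedBall (0 : Plane) ‖y₂‖)ᶜ,
      decay p (g₁ / p.powL) (v - y₁) * decay p (g₂ / p.powL) (v - y₂) := by
  simp only [C0L, decay, ← Real.exp_add, sub_eq_add_neg]

lemma C0W_eq (y₁ : Plane) (g₁ : ℝ) (y₂ : Plane) (g₂ : ℝ) : C0W p y₁ g₁ y₂ g₂ =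
    p.lamW * ∫ v in (Metric.closedBall (0 : Plane) ‖y₂‖)ᶜ,
      decay p (g₁ / p.powW) (v - y₁) * decay p (g₂ / p.powW) (v - y₂) := by
  simp only [C0W, decay, ← Real.exp_add, sub_eq_add_neg]

lemma setIntegral_compl_closedBall_zero (f : Plane → ℝ) :
    ∫ v in (Metric.closedBall (0 : Plane) 0)ᶜ, f v = ∫ v, f v := by
  rw [Metric.closedBall_zero, setIntegral_congr_set (t := Set.univ), setIntegral_univ]
  exact eventuallyEq_univ.2 (compl_mem_ae_iff.2 (by simp))

lemma N3L_eq (g : ℝ) (y : Plane) :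
    N3L p g = p.lamL * ∫ v, decay p (g / p.powL) (v - y) := by
  rw [N3L, N0L_eq, setIntegral_compl_closedBall_zero, integral_sub_right_eq_self (decay p _),
    integral_sub_right_eq_self (decay p _)]

/-- A disc of radius `0` excludes only a null set, and translation by `x` moves the kernels to the
actual positions of the eNB and the AP. -/
lemma C0L_zero_eq (x y : Plane) (g₁ g₂ : ℝ) : C0L p (y - x) g₁ 0 g₂ =
    p.lamL * ∫ v, decay p (g₁ / p.powL) (v - y) * decay p (g₂ / p.powL) (v - x) := by
  rw [C0L_eq, norm_zero, setIntegral_compl_closedBall_zero,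
    ← integral_sub_right_eq_self _ x]
  simp

/-- Rotational invariance. -/
lemma N2W_norm (x : Plane) : N2W p ‖x‖ = N0W p x ‖x‖ p.gamCS := by
  have hn : ‖x‖ = ‖(!₂[‖x‖, 0] : Plane)‖ := by
    simp [EuclideanSpace.norm_eq, Fin.sum_univ_two]
  -- The reflection exchanging `x` and `(‖x‖, 0)` preserves Lebesgue measure and the discs about the
  -- origin.
  set e := (ℝ ∙ (x - (!₂[‖x‖, 0] : Plane)))ᗮ.reflection with he
  have hex : e x = !₂[‖x‖, 0] := Submodule.reflection_sub hn
  rw [N2W, N0W_eq, N0W_eq, ← (e.measurePreserving).setIntegral_preimage_emb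
    e.toHomeomorph.measurableEmbedding]
  congr 1
  have hpre : e ⁻¹' (Metric.closedBall (0 : Plane) ‖x‖)ᶜ = (Metric.closedBall (0 : Plane) ‖x‖)ᶜ := by
    ext v
    simp
  rw [hpre]
  refine integral_congr_ae (.of_forall fun v => ?_)
  simp only [decay]
  rw [← hex, ← map_sub, e.norm_map]

lemma N5_norm (x : Plane) : N5 p ‖x‖ = p.lamW * (∫ v in (Metric.closedBall (0 : Plane) ‖x‖)ᶜ,
      decay p (p.gamCS / p.powW) (v - x)) +
    p.lamL * ∫ v, decay p (p.gamED / p.powL) (v - x) := by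
  rw [N5, N2W_norm, N0W_eq, ← N3L_eq]
  rfl

lemma N4_norm (x y : Plane) : N4 p ‖x‖ y = p.lamW * (∫ v in (Metric.closedBall (0 : Plane) ‖x‖)ᶜ,
      decay p (p.gamL / p.powW) (v - y)) +
    p.lamL * ∫ v, decay p (p.gamL / p.powL) (v - y) := by
  rw [N4, N0W_eq, ← N3L_eq]

lemma N6_eq (x y : Plane) : N6 p x y = p.lamW * (∫ v in (Metric.closedBall (0 : Plane) ‖x‖)ᶜ,
      decay p (p.gamL / p.powW) (v - y) * decay p (p.gamCS / p.powW) (v - x)) +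
    p.lamL * ∫ v, decay p (p.gamL / p.powL) (v - y) * decay p (p.gamED / p.powL) (v - x) := by
  rw [N6, C0W_eq, C0L_zero_eq]

variable {p} in
lemma integral_decay_pos {θ : ℝ} (hθ : 0 < θ) (x : Plane) : 0 < ∫ v, decay p θ (v - x) := by
  rw [integral_pos_iff_support_of_nonneg (fun v => decay_nonneg _ _ _) (integrable_decay_sub hθ x)]
  have : Function.support (fun v => decay p θ (v - x)) = Set.univ :=
    Function.support_eq_univ fun v => (decay_pos _ _ _).ne'
  rw [this]
  simp

-- The second factor is strictly less than `1` except at the single point `x`, and the first is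
-- positive everywhere.
variable {p} in
lemma integral_decay_mul_lt {θ₁ θ₂ : ℝ} (h₁ : 0 < θ₁) (h₂ : 0 < θ₂) (y x : Plane) :
    ∫ v, decay p θ₁ (v - y) * decay p θ₂ (v - x) < ∫ v, decay p θ₁ (v - y) := by
  rw [← sub_pos, ← integral_sub (integrable_decay_sub h₁ y) (integrable_decay_mul h₁ h₂ y x),
    integral_pos_iff_support_of_nonneg]
  · refine lt_of_lt_of_le ?_ (measure_mono (s := {x}ᶜ) fun v hv => ?_)
    · rw [measure_compl (measurableSet_singleton x) (by simp)]
      simp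
    · have h3 := decay_lt_one (p := p) h₂ (sub_ne_zero.2 hv)
      have h4 := decay_pos p θ₁ (v - y)
      have : 0 < decay p θ₁ (v - y) - decay p θ₁ (v - y) * decay p θ₂ (v - x) := by nlinarith
      exact this.ne'
  · intro v
    have h3 := decay_le_one (p := p) h₂ (v - x)
    have h4 := decay_pos p θ₁ (v - y)
    simp only [Pi.zero_apply]
    nlinarith
  · exact (integrable_decay_sub h₁ y).sub (integrable_decay_mul h₁ h₂ y x)

variable {p} in
lemma setIntegral_decay_mul_le {θ₁ θ₂ : ℝ} (h₁ : 0 < θ₁) (h₂ : 0 < θ₂) (y x : Plane)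
    (s : Set Plane) :
    ∫ v in s, decay p θ₁ (v - y) * decay p θ₂ (v - x) ≤ ∫ v in s, decay p θ₁ (v - y) :=
  integral_mono (integrable_decay_mul h₁ h₂ y x).integrableOn (integrable_decay_sub h₁ y).integrableOn
    fun _ => mul_le_of_le_one_right (decay_nonneg _ _ _) (decay_le_one h₂ _)

/-- The AP parts are compared weakly; strictness comes from the eNB parts, which are integrals over
the whole plane. With `N6_lt_N5` this excludes zero denominators in `M`. -/
lemma N6_lt_N4 (x y : Plane) : N6 p x y < N4 p ‖x‖ y := by
  rw [N6_eq, N4_norm]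
  exact add_lt_add_of_le_of_lt
    (mul_le_mul_of_nonneg_left (setIntegral_decay_mul_le (div_pos p.gamL_pos p.powW_pos)
      (div_pos p.gamCS_pos p.powW_pos) _ _ _) p.lamW_pos.le)
    (mul_lt_mul_of_pos_left (integral_decay_mul_lt (div_pos p.gamL_pos p.powL_pos)
      (div_pos p.gamED_pos p.powL_pos) _ _) p.lamL_pos)

lemma N6_lt_N5 (x y : Plane) : N6 p x y < N5 p ‖x‖ := by
  rw [N6_eq, N5_norm]
  simp_rw [mul_comm (decay p _ (_ - y))]
  exact add_lt_add_of_le_of_lt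
    (mul_le_mul_of_nonneg_left (setIntegral_decay_mul_le (div_pos p.gamCS_pos p.powW_pos)
      (div_pos p.gamL_pos p.powW_pos) _ _ _) p.lamW_pos.le)
    (mul_lt_mul_of_pos_left (integral_decay_mul_lt (div_pos p.gamED_pos p.powL_pos)
      (div_pos p.gamL_pos p.powL_pos) _ _) p.lamL_pos)

lemma N5_pos (x : Plane) : 0 < N5 p ‖x‖ := by
  rw [N5_norm]
  exact add_pos_of_nonneg_of_pos (mul_nonneg p.lamW_pos.le
    (integral_nonneg fun _ => decay_nonneg _ _ _))
    (mul_pos p.lamL_pos (integral_decay_pos (div_pos p.gamED_pos p.powL_pos) _))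

lemma N4_pos (x y : Plane) : 0 < N4 p ‖x‖ y := by
  rw [N4_norm]
  exact add_pos_of_nonneg_of_pos (mul_nonneg p.lamW_pos.le
    (integral_nonneg fun _ => decay_nonneg _ _ _))
    (mul_pos p.lamL_pos (integral_decay_pos (div_pos p.gamL_pos p.powL_pos) _))

lemma continuous_N5 : Continuous fun q : Plane × Plane => N5 p ‖q.1‖ := by
  have h := continuous_setIntegral_decay (β := Plane × Plane) p (div_pos p.gamCS_pos p.powW_pos)
    (r := fun q => ‖q.1‖) (z := fun q => q.1) (K := fun _ _ => 1) (by fun_prop) (by fun_prop)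
    (by fun_prop) (by simp)
  simp only [mul_one] at h
  simp_rw [N5, N2W_norm, N0W_eq]
  exact (h.const_mul _).add continuous_const

lemma continuous_N4 : Continuous fun q : Plane × Plane => N4 p ‖q.1‖ q.2 := by
  have h := continuous_setIntegral_decay (β := Plane × Plane) p (div_pos p.gamL_pos p.powW_pos)
    (r := fun q => ‖q.1‖) (z := fun q => q.2) (K := fun _ _ => 1) (by fun_prop) (by fun_prop)
    (by fun_prop) (by simp)
  simp only [mul_one] at h
  simp_rw [N4, N0W_eq]
  exact (h.const_mul _).add continuous_const

lemma continuous_N6 : Continuous fun q : Plane × Plane => N6 p q.1 q.2 := by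
  have hle : ∀ {θ : ℝ}, 0 < θ → ∀ u, |decay p θ u| ≤ 1 := fun hθ u => by
    rw [abs_of_nonneg (decay_nonneg _ _ _)]
    exact decay_le_one hθ u
  have h := continuous_setIntegral_decay (β := Plane × Plane) p (div_pos p.gamL_pos p.powW_pos)
    (r := fun q => ‖q.1‖) (z := fun q => q.2)
    (K := fun q v => decay p (p.gamCS / p.powW) (v - q.1)) (by fun_prop) (by fun_prop)
    (by fun_prop) (fun q v => hle (div_pos p.gamCS_pos p.powW_pos) _)
  have h' := continuous_setIntegral_decay (β := Plane × Plane) p (div_pos p.gamL_pos p.powL_pos)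
    (r := fun _ => ‖(0 : Plane)‖) (z := fun q => q.2 - q.1)
    (K := fun q v => decay p (p.gamED / p.powL) (v - 0)) (by fun_prop) (by fun_prop)
    (by fun_prop) (fun q v => hle (div_pos p.gamED_pos p.powL_pos) _)
  simp_rw [N6, C0W_eq, C0L_eq]
  exact (h.const_mul _).add (h'.const_mul _)

end SpecialFunctions

/-! ### The density of the Campbell measure in closed form -/

section Exposure

variable (p : Params)

lemma integral_viol {D : Set Plane} (b : Prop) (t s : ℝ) {a₁ a₂ : Plane → ℝ}
    (i₁ : Integrable a₁) (i₂ : Integrable a₂) (i₁₂ : Integrable fun v => a₂ v * a₁ v) :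
    IntegrableOn (fun v => viol b t s (a₁ v) (a₂ v)) D ∧
    ∫ v in D, viol b t s (a₁ v) (a₂ v) = t * (∫ v in D, a₁ v) + (open scoped Classical in
      if b then s * (∫ v in D, a₂ v) - min t s * (∫ v in D, a₂ v * a₁ v) else 0) := by
  unfold viol
  have j₁ := (i₁.const_mul t).integrableOn (s := D)
  by_cases hb : b
  · have j₂ := (i₂.const_mul s).integrableOn (s := D)
    have j₁₂ := (i₁₂.const_mul (min t s)).integrableOn (s := D)
    simp only [hb, if_true, mul_comm (a₁ _) (a₂ _)]
    have j : IntegrableOn (fun v => s * a₂ v - min t s * (a₂ v * a₁ v)) D := j₂.sub j₁₂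
    refine ⟨j₁.add j, ?_⟩
    rw [integral_add j₁ j, integral_sub j₂ j₁₂, integral_const_mul, integral_const_mul,
      integral_const_mul]
  · simp only [hb, if_false, add_zero]
    exact ⟨j₁, integral_const_mul _ _⟩

/-- Replaces the silencing probabilities by kernels equal to them almost everywhere, so that the
default value at distance zero disappears. The second conclusion is what `negExp_ofReal` needs. -/
lemma lintegral_viol {D : Set Plane} {lam : ℝ} (hlam : 0 ≤ lam) (b : Prop) {t s : ℝ}
    {q₁ q₂ a₁ a₂ : Plane → ℝ} (h₁ : q₁ =ᵐ[volume] a₁) (h₂ : q₂ =ᵐ[volume] a₂)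
    (h0 : ∀ v, 0 ≤ viol b t s (q₁ v) (q₂ v))
    (i₁ : Integrable a₁) (i₂ : Integrable a₂) (i₁₂ : Integrable fun v => a₂ v * a₁ v) :
    ∫⁻ v in D, ENNReal.ofReal (viol b t s (q₁ v) (q₂ v)) ∂intensity lam =
      ENNReal.ofReal (t * (lam * ∫ v in D, a₁ v) + (open scoped Classical in
        if b then s * (lam * ∫ v in D, a₂ v) - min t s * (lam * ∫ v in D, a₂ v * a₁ v) else 0)) ∧
    0 ≤ t * (lam * ∫ v in D, a₁ v) + (open scoped Classical in
        if b then s * (lam * ∫ v in D, a₂ v) - min t s * (lam * ∫ v in D, a₂ v * a₁ v) else 0) := by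
  obtain ⟨hi, he⟩ := integral_viol (D := D) b t s i₁ i₂ i₁₂
  have hae : (fun v => viol b t s (q₁ v) (q₂ v)) =ᵐ[volume.restrict D]
      fun v => viol b t s (a₁ v) (a₂ v) := by
    filter_upwards [ae_restrict_of_ae h₁, ae_restrict_of_ae h₂] with v e₁ e₂
    rw [e₁, e₂]
  have h0' : 0 ≤ᵐ[volume.restrict D] fun v => viol b t s (a₁ v) (a₂ v) := by
    filter_upwards [hae] with v hv
    rw [← hv]
    exact h0 v
  have hr : lam * ∫ v in D, viol b t s (a₁ v) (a₂ v) =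
      t * (lam * ∫ v in D, a₁ v) + (open scoped Classical in
        if b then s * (lam * ∫ v in D, a₂ v) - min t s * (lam * ∫ v in D, a₂ v * a₁ v) else 0) := by
    rw [he]
    split_ifs <;> ring
  rw [← hr]
  refine ⟨?_, mul_nonneg hlam (integral_nonneg_of_ae h0')⟩
  rw [intensity, Measure.restrict_smul, lintegral_smul_measure, ENNReal.ofReal_mul hlam,
    ofReal_integral_eq_lintegral_ofReal hi h0', smul_eq_mul]
  congr 1
  refine lintegral_congr_ae ?_
  filter_upwards [hae] with v hv
  rw [hv]

open scoped Classical in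
/-- The mean number of transmitters outside the disc through `x` that silence the tagged AP at `x`
or, if `b`, the eNB at `y`. -/
def exposure (b : Prop) (t s : ℝ) (x y : Plane) : ℝ :=
  t * N5 p ‖x‖ + if b then s * N4 p ‖x‖ y - min t s * N6 p x y else 0

lemma blockProb_sub_ae_eq (θ : ℝ) (x : Plane) :
    (fun v => blockProb p θ ‖v - x‖) =ᵐ[volume] fun v => decay p θ (v - x) := by
  have : ∀ᵐ v : Plane, v ∉ ({x} : Set Plane) := measure_eq_zero_iff_ae_notMem.1 (by simp)
  filter_upwards [this] with v hv
  exact blockProb_eq_decay p θ (sub_ne_zero.2 hv)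

/-- The probability that the disc through `x` contains no AP. -/
def voidProb (x : Plane) : ℝ≥0∞ := negExp (intensity p.lamW (Metric.closedBall 0 ‖x‖))

lemma voidProb_ne_zero (x : Plane) : voidProb p x ≠ 0 :=
  (negExp_pos (intensity_ne_top _ measure_closedBall_lt_top.ne)).ne'

/-- Inside the disc through `x` the AP integrand is `1`, which gives the void probability. The AP
integral outside it and the eNB integral over the plane add up to the exposure. -/
lemma timedDensity_eq (b : Prop) {t s : ℝ} (ht : 0 ≤ t) (hs : 0 ≤ s) (x y : Plane) :
    timedDensity p b t s x y = voidProb p x *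
      (pairWeight p b t s x y * ENNReal.ofReal (Real.exp (-exposure p b t s x y))) := by
  have hW := p.powW_pos
  have hL := p.powL_pos
  have hcs := div_pos p.gamCS_pos hW
  have hed := div_pos p.gamED_pos hL
  have hgW := div_pos p.gamL_pos hW
  have hgL := div_pos p.gamL_pos hL
  obtain ⟨eW, nW⟩ := lintegral_viol (D := (Metric.closedBall (0 : Plane) ‖x‖)ᶜ) p.lamW_pos.le b
    (t := t) (s := s) (blockProb_sub_ae_eq p (p.gamCS / p.powW) x)
    (q₂ := fun v => blockProb p (p.gamL / p.powW) ‖y - v‖)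
    (by simpa only [norm_sub_rev y] using blockProb_sub_ae_eq p (p.gamL / p.powW) y)
    (violW_nonneg p b ht hs x y) (integrable_decay_sub hcs x) (integrable_decay_sub hgW y)
    (integrable_decay_mul hgW hcs y x)
  obtain ⟨eL, nL⟩ := lintegral_viol (D := Set.univ) p.lamL_pos.le b
    (t := t) (s := s) (blockProb_sub_ae_eq p (p.gamED / p.powL) x)
    (blockProb_sub_ae_eq p (p.gamL / p.powL) y)
    (violL_nonneg p b ht hs x y) (integrable_decay_sub hed x) (integrable_decay_sub hgL y)
    (integrable_decay_mul hgL hed y x)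
  have hsplit : ∫⁻ v, (if ‖v‖ ≤ ‖x‖ then 1 else ENNReal.ofReal (violW p b t s x y v))
        ∂intensity p.lamW = intensity p.lamW (Metric.closedBall 0 ‖x‖) +
      ∫⁻ v in (Metric.closedBall (0 : Plane) ‖x‖)ᶜ, ENNReal.ofReal (violW p b t s x y v)
        ∂intensity p.lamW := by
    rw [← lintegral_add_compl _ (Metric.isClosed_closedBall (x := (0 : Plane))
      (ε := ‖x‖)).measurableSet]
    congr 1
    · rw [← setLIntegral_one]
      refine setLIntegral_congr_fun Metric.isClosed_closedBall.measurableSet fun v hv => ?_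
      simp [mem_closedBall_zero_iff.1 hv]
    · refine setLIntegral_congr_fun Metric.isClosed_closedBall.measurableSet.compl fun v hv => ?_
      have : ¬ ‖v‖ ≤ ‖x‖ := fun h => hv (mem_closedBall_zero_iff.2 h)
      simp [this]
  rw [timedDensity, hsplit, negExp_add]
  change _ * (_ * negExp (∫⁻ v in (Metric.closedBall (0 : Plane) ‖x‖)ᶜ, ENNReal.ofReal
    (viol b t s _ _) ∂intensity p.lamW)) * negExp (∫⁻ v, ENNReal.ofReal (viol b t s _ _)
      ∂intensity p.lamL) = _
  rw [setLIntegral_univ] at eL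
  rw [eW, eL, negExp_ofReal nW, negExp_ofReal nL, voidProb]
  have hexp : Real.exp (-exposure p b t s x y) =
      Real.exp (-(t * (p.lamW * ∫ v in (Metric.closedBall (0 : Plane) ‖x‖)ᶜ,
          decay p (p.gamCS / p.powW) (v - x)) + (open scoped Classical in
        if b then s * (p.lamW * ∫ v in (Metric.closedBall (0 : Plane) ‖x‖)ᶜ,
          decay p (p.gamL / p.powW) (v - y)) - min t s * (p.lamW *
          ∫ v in (Metric.closedBall (0 : Plane) ‖x‖)ᶜ, decay p (p.gamL / p.powW) (v - y) *
            decay p (p.gamCS / p.powW) (v - x)) else 0))) *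
      Real.exp (-(t * (p.lamL * ∫ v in Set.univ,
          decay p (p.gamED / p.powL) (v - x)) + (open scoped Classical in
        if b then s * (p.lamL * ∫ v in Set.univ,
          decay p (p.gamL / p.powL) (v - y)) - min t s * (p.lamL *
          ∫ v in Set.univ, decay p (p.gamL / p.powL) (v - y) *
            decay p (p.gamED / p.powL) (v - x)) else 0))) := by
    rw [← Real.exp_add, exposure, N5_norm, N4_norm, N6_eq]
    simp only [setIntegral_univ]
    congr 1
    split_ifs <;> ring
  rw [hexp, ENNReal.ofReal_mul (Real.exp_pos _).le]
  ring

end Exposure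

/-! ### Integrals over the two timers. -/

section Square

/-- Integration over the triangle below the diagonal of the unit square. -/
lemma lintegral_triangle {A B : ℝ → ℝ} (hA : Continuous A) (hB : Continuous B) (hA0 : ∀ t, 0 ≤ A t)
    (hB0 : ∀ t, 0 ≤ B t) :
    ∫⁻ t, ∫⁻ s, (if s < t then ENNReal.ofReal (A t * B s) else 0) ∂unif ∂unif =
      ENNReal.ofReal (∫ t in (0 : ℝ)..1, A t * ∫ s in (0 : ℝ)..t, B s) := by
  have hprim : Continuous fun t : ℝ => ∫ s in (0 : ℝ)..t, B s :=
    intervalIntegral.continuous_primitive (fun _ _ => hB.intervalIntegrable _ _) 0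
  have h1 : ∀ t ∈ Set.Icc (0 : ℝ) 1, ∫⁻ s, (if s < t then ENNReal.ofReal (A t * B s) else 0) ∂unif =
      ENNReal.ofReal (A t * ∫ s in (0 : ℝ)..t, B s) := by
    intro t ht
    have h2 : Set.Iio t ∩ Set.Icc (0 : ℝ) 1 = Set.Ico 0 t := by
      ext u
      simp only [Set.mem_inter_iff, Set.mem_Iio, Set.mem_Icc, Set.mem_Ico]
      exact ⟨fun h => ⟨h.2.1, h.1⟩, fun h => ⟨h.2, h.1, h.2.le.trans ht.2⟩⟩
    have h3 : (fun s => if s < t then ENNReal.ofReal (A t * B s) else 0) =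
        (Set.Iio t).indicator fun s => ENNReal.ofReal (A t * B s) := rfl
    rw [h3, lintegral_indicator measurableSet_Iio, unif,
      Measure.restrict_restrict measurableSet_Iio, h2, ← intervalIntegral.integral_const_mul,
      intervalIntegral.integral_of_le ht.1, setLIntegral_congr Ico_ae_eq_Ioc,
      ofReal_integral_eq_lintegral_ofReal]
    · exact ((continuous_const.mul hB).integrableOn_Icc).mono_set Set.Ioc_subset_Icc_self
    · exact .of_forall fun s => mul_nonneg (hA0 _) (hB0 _)
  have h4 : ∫⁻ t, ∫⁻ s, (if s < t then ENNReal.ofReal (A t * B s) else 0) ∂unif ∂unif =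
      ∫⁻ t in Set.Icc (0 : ℝ) 1, ENNReal.ofReal (A t * ∫ s in (0 : ℝ)..t, B s) :=
    setLIntegral_congr_fun measurableSet_Icc h1
  have h5 : IntegrableOn (fun t => A t * ∫ s in (0 : ℝ)..t, B s) (Set.Icc 0 1) :=
    (hA.mul hprim).integrableOn_Icc
  rw [h4, intervalIntegral.integral_of_le zero_le_one, ← integral_Icc_eq_integral_Ioc,
    ofReal_integral_eq_lintegral_ofReal h5]
  filter_upwards [ae_restrict_mem measurableSet_Icc] with t ht
  exact mul_nonneg (hA0 t) (intervalIntegral.integral_nonneg ht.1 fun s _ => hB0 s)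

lemma integral_triangle_nonneg {A B : ℝ → ℝ} (hA0 : ∀ t, 0 ≤ A t) (hB0 : ∀ t, 0 ≤ B t) :
    0 ≤ ∫ t in (0 : ℝ)..1, A t * ∫ s in (0 : ℝ)..t, B s :=
  intervalIntegral.integral_nonneg zero_le_one fun t ht =>
    mul_nonneg (hA0 t) (intervalIntegral.integral_nonneg ht.1 fun s _ => hB0 s)

/-- Integration over the unit square of a function that has product form on either side of the
diagonal. -/
lemma lintegral_square {F : ℝ → ℝ → ℝ≥0∞} {A₁ B₁ A₂ B₂ : ℝ → ℝ}
    (hF : Measurable fun z : ℝ × ℝ => F z.1 z.2)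
    (hA₁ : Continuous A₁) (hB₁ : Continuous B₁) (hA₂ : Continuous A₂) (hB₂ : Continuous B₂)
    (hA₁0 : ∀ t, 0 ≤ A₁ t) (hB₁0 : ∀ t, 0 ≤ B₁ t) (hA₂0 : ∀ t, 0 ≤ A₂ t) (hB₂0 : ∀ t, 0 ≤ B₂ t)
    (h₁ : ∀ t ∈ Set.Icc (0 : ℝ) 1, ∀ s ∈ Set.Icc (0 : ℝ) 1, s < t →
      F t s = ENNReal.ofReal (A₁ t * B₁ s))
    (h₂ : ∀ t ∈ Set.Icc (0 : ℝ) 1, ∀ s ∈ Set.Icc (0 : ℝ) 1, t < s →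
      F t s = ENNReal.ofReal (A₂ s * B₂ t)) :
    ∫⁻ z, F z.1 z.2 ∂(unif.prod unif) =
      ENNReal.ofReal ((∫ t in (0 : ℝ)..1, A₁ t * ∫ s in (0 : ℝ)..t, B₁ s) +
        ∫ s in (0 : ℝ)..1, A₂ s * ∫ t in (0 : ℝ)..s, B₂ t) := by
  have hI : ∀ᵐ t ∂unif, t ∈ Set.Icc (0 : ℝ) 1 := ae_restrict_mem measurableSet_Icc
  -- Equal timers have probability zero, so only the two open triangles matter.
  have hne : ∀ t : ℝ, ∀ᵐ s ∂unif, s ≠ t := fun t =>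
    ae_restrict_of_ae (measure_eq_zero_iff_ae_notMem.1 (by simp : volume ({t} : Set ℝ) = 0))
  have m₁ : Measurable fun z : ℝ × ℝ =>
      if z.2 < z.1 then ENNReal.ofReal (A₁ z.1 * B₁ z.2) else 0 :=
    Measurable.ite (measurableSet_lt (by fun_prop) (by fun_prop)) (by fun_prop) measurable_const
  have m₂ : Measurable fun z : ℝ × ℝ =>
      if z.2 < z.1 then ENNReal.ofReal (A₂ z.1 * B₂ z.2) else 0 :=
    Measurable.ite (measurableSet_lt (by fun_prop) (by fun_prop)) (by fun_prop) measurable_const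
  have m₂' : Measurable fun z : ℝ × ℝ =>
      if z.1 < z.2 then ENNReal.ofReal (A₂ z.2 * B₂ z.1) else 0 := m₂.comp measurable_swap
  have e : ∫⁻ t, ∫⁻ s, F t s ∂unif ∂unif =
      ∫⁻ t, ((∫⁻ s, (if s < t then ENNReal.ofReal (A₁ t * B₁ s) else 0) ∂unif) +
        ∫⁻ s, (if t < s then ENNReal.ofReal (A₂ s * B₂ t) else 0) ∂unif) ∂unif := by
    refine lintegral_congr_ae ?_
    filter_upwards [hI] with t ht
    have m₁t : Measurable fun s => if s < t then ENNReal.ofReal (A₁ t * B₁ s) else 0 :=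
      m₁.comp measurable_prodMk_left
    rw [← lintegral_add_left m₁t]
    refine lintegral_congr_ae ?_
    filter_upwards [hI, hne t] with s hs hst
    rcases lt_or_gt_of_ne hst with h | h
    · simp [h, h.not_gt, h₁ t ht s hs h]
    · simp [h, h.not_gt, h₂ t ht s hs h]
  rw [lintegral_prod _ hF.aemeasurable, e, lintegral_add_left m₁.lintegral_prod_right',
    lintegral_triangle hA₁ hB₁ hA₁0 hB₁0,
    ENNReal.ofReal_add (integral_triangle_nonneg hA₁0 hB₁0) (integral_triangle_nonneg hA₂0 hB₂0),
    ← lintegral_triangle hA₂ hB₂ hA₂0 hB₂0]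
  congr 1
  exact lintegral_lintegral_swap m₂'.aemeasurable

lemma integral_exp_neg_mul {c : ℝ} (hc : c ≠ 0) (t : ℝ) :
    ∫ s in (0 : ℝ)..t, Real.exp (-(c * s)) = (1 - Real.exp (-(c * t))) / c := by
  have h : ∀ s ∈ Set.uIcc 0 t,
      HasDerivAt (fun s => -Real.exp (-(c * s)) / c) (Real.exp (-(c * s))) s := by
    intro s _
    have := (((hasDerivAt_id s).const_mul c).fun_neg.exp.fun_neg).div_const c
    refine this.congr_deriv ?_
    simp only [id]
    field_simp
  rw [intervalIntegral.integral_eq_sub_of_hasDerivAt h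
    (Continuous.intervalIntegrable (by fun_prop) _ _)]
  simp
  ring

lemma integral_id_mul_exp_neg_mul {c : ℝ} (hc : c ≠ 0) :
    ∫ s in (0 : ℝ)..1, Real.exp (-(c * s)) * s =
      (1 - Real.exp (-c)) / c ^ 2 - Real.exp (-c) / c := by
  have h : ∀ s ∈ Set.uIcc (0 : ℝ) 1, HasDerivAt
      (fun s => -Real.exp (-(c * s)) * (s / c + 1 / c ^ 2)) (Real.exp (-(c * s)) * s) s := by
    intro s _
    have h1 := ((hasDerivAt_id s).const_mul c).fun_neg.exp.fun_neg
    have h2 := ((hasDerivAt_id s).div_const c).add_const (1 / c ^ 2)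
    refine (h1.mul h2).congr_deriv ?_
    simp only [id]
    field_simp
    ring
  rw [intervalIntegral.integral_eq_sub_of_hasDerivAt h
    (Continuous.intervalIntegrable (by fun_prop) _ _)]
  simp
  ring

/-- The inner integral leaves a difference of two exponentials in `t`. The triangle integral is the
form in which `M` arises, and it makes nonnegativity evident. -/
lemma funM_eq_integral {n₁ n₂ n₃ : ℝ} (h₁ : 0 < n₁) (h₂ : n₃ < n₂) :
    ∫ t in (0 : ℝ)..1, Real.exp (-(n₁ * t)) * ∫ s in (0 : ℝ)..t, Real.exp (-((n₂ - n₃) * s)) =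
      funM n₁ n₂ n₃ := by
  have hd : n₂ - n₃ ≠ 0 := (sub_pos.2 h₂).ne'
  have hs : n₁ + (n₂ - n₃) ≠ 0 := by linarith
  have h : ∀ t, Real.exp (-(n₁ * t)) * ∫ s in (0 : ℝ)..t, Real.exp (-((n₂ - n₃) * s)) =
      (Real.exp (-(n₁ * t)) - Real.exp (-((n₁ + (n₂ - n₃)) * t))) / (n₂ - n₃) := by
    intro t
    rw [integral_exp_neg_mul hd, mul_div_assoc', mul_sub, ← Real.exp_add]
    ring_nf
  simp_rw [h]
  rw [intervalIntegral.integral_div, intervalIntegral.integral_sub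
    (Continuous.intervalIntegrable (by fun_prop) _ _)
    (Continuous.intervalIntegrable (by fun_prop) _ _), integral_exp_neg_mul h₁.ne',
    integral_exp_neg_mul hs, funM]
  ring_nf

lemma funM_nonneg {n₁ n₂ n₃ : ℝ} (h₁ : 0 < n₁) (h₂ : n₃ < n₂) : 0 ≤ funM n₁ n₂ n₃ := by
  rw [← funM_eq_integral h₁ h₂]
  exact integral_triangle_nonneg (fun _ => (Real.exp_pos _).le) fun _ => (Real.exp_pos _).le

end Square

/-! ### The densities as `V` and `U`, and the regularity of their quotient. -/

section ClosedForm

variable (p : Params)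

lemma measurable_pairWeight_mul (b : Prop) (x y : Plane) : Measurable fun z : ℝ × ℝ =>
    pairWeight p b z.1 z.2 x y * ENNReal.ofReal (Real.exp (-exposure p b z.1 z.2 x y)) := by
  have h : Measurable fun z : ℝ × ℝ => exposure p b z.1 z.2 x y := by
    unfold exposure
    split_ifs <;> fun_prop
  exact (measurable_pairWeight p b measurable_fst measurable_snd measurable_const
    measurable_const).mul h.neg.exp.ennreal_ofReal

lemma campbellDensity_eq (b : Prop) (x y : Plane) : campbellDensity p b x y = voidProb p x *
    ∫⁻ z, pairWeight p b z.1 z.2 x y * ENNReal.ofReal (Real.exp (-exposure p b z.1 z.2 x y))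
      ∂(unif.prod unif) := by
  rw [← lintegral_const_mul _ (measurable_pairWeight_mul p b x y), campbellDensity]
  refine lintegral_congr_ae ?_
  have h0 : ∀ᵐ t ∂unif, 0 ≤ t := (ae_restrict_mem measurableSet_Icc).mono fun t ht => ht.1
  filter_upwards [Measure.quasiMeasurePreserving_fst.ae h0,
    Measure.quasiMeasurePreserving_snd.ae h0] with z h₁ h₂
  exact timedDensity_eq p b h₁ h₂ x y

/-- For `s < t` the exponent is `t N₅ + s (N₄ - N₆)`, and within the pair only the eNB can silence
the AP, so the weight is `1 - q₂`; for `t < s` the roles are exchanged. Coincident locations are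
excluded because `blockProb` is `0` there while `decay` is `1`. -/
theorem campbellDensity_true {x y : Plane} (hxy : y ≠ x) :
    campbellDensity p True x y = voidProb p x *
      ENNReal.ofReal (funV p (y - x) (p.gamL / p.powW) (p.gamED / p.powL) (N4 p ‖x‖ y) (N5 p ‖x‖)
        (N6 p x y)) := by
  set q₁ := decay p (p.gamL / p.powW) (y - x) with hq₁
  set q₂ := decay p (p.gamED / p.powL) (y - x) with hq₂
  have h₁ : 0 ≤ 1 - q₁ := sub_nonneg.2 (decay_le_one (div_pos p.gamL_pos p.powW_pos) _)
  have h₂ : 0 ≤ 1 - q₂ := sub_nonneg.2 (decay_le_one (div_pos p.gamED_pos p.powL_pos) _)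
  rw [campbellDensity_eq, lintegral_square (F := fun t s => pairWeight p True t s x y *
      ENNReal.ofReal (Real.exp (-exposure p True t s x y))) (measurable_pairWeight_mul p True x y)
    (A₁ := fun t => (1 - q₂) * Real.exp (-(N5 p ‖x‖ * t)))
    (B₁ := fun s => Real.exp (-((N4 p ‖x‖ y - N6 p x y) * s)))
    (A₂ := fun s => (1 - q₁) * Real.exp (-(N4 p ‖x‖ y * s)))
    (B₂ := fun t => Real.exp (-((N5 p ‖x‖ - N6 p x y) * t)))
    (by fun_prop) (by fun_prop) (by fun_prop) (by fun_prop)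
    (fun t => mul_nonneg h₂ (Real.exp_pos _).le) (fun t => (Real.exp_pos _).le)
    (fun t => mul_nonneg h₁ (Real.exp_pos _).le) (fun t => (Real.exp_pos _).le)]
  · congr 2
    simp_rw [mul_assoc]
    rw [intervalIntegral.integral_const_mul, intervalIntegral.integral_const_mul,
      funM_eq_integral (N5_pos p x) (N6_lt_N4 p x y),
      funM_eq_integral (N4_pos p x y) (N6_lt_N5 p x y), funV, add_comm]
    rfl
  · intro t _ s _ hst
    simp only [pairWeight, pairViol, exposure, hst, hst.not_gt, and_false, and_true, if_false,
      if_true, sub_zero, ENNReal.ofReal_one, one_mul, min_eq_right hst.le]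
    rw [blockProb_eq_decay p _ (sub_ne_zero.2 hxy), ← ENNReal.ofReal_mul h₂, mul_assoc,
      ← Real.exp_add]
    congr 3
    ring
  · intro t _ s _ hts
    simp only [pairWeight, pairViol, exposure, hts, hts.not_gt, and_false, and_true, if_false,
      if_true, sub_zero, ENNReal.ofReal_one, mul_one, min_eq_left hts.le]
    rw [blockProb_eq_decay p _ (sub_ne_zero.2 hxy), ← ENNReal.ofReal_mul h₁, mul_assoc,
      ← Real.exp_add]
    congr 3
    ring

/-- The exponent is `t N₅` on both triangles, and the eNB timer matters only through the weight `1 -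
q₂` on `s < t`. The result is the integral of `e^{-N₅ t}` minus `q₂` times that of `t e^{-N₅ t}`. -/
theorem campbellDensity_false {x y : Plane} (hxy : y ≠ x) :
    campbellDensity p False x y = voidProb p x *
      ENNReal.ofReal (funU p (y - x) (p.gamED / p.powL) (N5 p ‖x‖)) := by
  set q₂ := decay p (p.gamED / p.powL) (y - x) with hq₂
  have h₂ : 0 ≤ 1 - q₂ := sub_nonneg.2 (decay_le_one (div_pos p.gamED_pos p.powL_pos) _)
  have hN := (N5_pos p x).ne'
  rw [campbellDensity_eq, lintegral_square (F := fun t s => pairWeight p False t s x y *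
      ENNReal.ofReal (Real.exp (-exposure p False t s x y))) (measurable_pairWeight_mul p False x y)
    (A₁ := fun t => (1 - q₂) * Real.exp (-(N5 p ‖x‖ * t))) (B₁ := fun _ => 1) (A₂ := fun _ => 1)
    (B₂ := fun t => Real.exp (-(N5 p ‖x‖ * t)))
    (by fun_prop) (by fun_prop) (by fun_prop) (by fun_prop)
    (fun t => mul_nonneg h₂ (Real.exp_pos _).le) (fun t => zero_le_one)
    (fun t => zero_le_one) (fun t => (Real.exp_pos _).le)]
  · congr 2
    simp_rw [one_mul, integral_exp_neg_mul hN, mul_assoc]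
    rw [intervalIntegral.integral_const_mul, intervalIntegral.integral_div,
      intervalIntegral.integral_sub (Continuous.intervalIntegrable (by fun_prop) _ _)
      (Continuous.intervalIntegrable (by fun_prop) _ _), integral_exp_neg_mul hN]
    simp only [intervalIntegral.integral_const, sub_zero, smul_eq_mul, mul_one]
    rw [integral_id_mul_exp_neg_mul hN, funU]
    change _ = _ - q₂ * _
    field_simp
    ring
  · intro t _ s _ hst
    simp only [pairWeight, pairViol, exposure, hst, false_and, true_and, if_false,
      if_true, sub_zero, ENNReal.ofReal_one, one_mul, add_zero, mul_one]
    rw [blockProb_eq_decay p _ (sub_ne_zero.2 hxy), ← ENNReal.ofReal_mul h₂, mul_comm t]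
  · intro t _ s _ hts
    simp only [pairWeight, pairViol, exposure, hts.not_gt, false_and, and_false, if_false,
      sub_zero, ENNReal.ofReal_one, one_mul, add_zero, mul_comm t]

/-- The two brackets are the integrals of `e^{-nt}` and `t e^{-nt}` over `[0, 1]`. The second is
positive and smaller than the first, by `1 + x < e^x` at `x = n` and `x = -n`, and its coefficient
is at most `1`. -/
lemma funU_pos {θ n : ℝ} (hθ : 0 < θ) (hn : 0 < n) (u : Plane) : 0 < funU p u θ n := by
  have h1 : 0 < (1 - Real.exp (-n)) / n ^ 2 - Real.exp (-n) / n := by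
    have h2 : 1 - Real.exp (-n) - n * Real.exp (-n) = (Real.exp n - (n + 1)) * Real.exp (-n) := by
      rw [sub_mul, ← Real.exp_add, add_neg_cancel, Real.exp_zero]
      ring
    have h3 : (1 - Real.exp (-n)) / n ^ 2 - Real.exp (-n) / n =
        (1 - Real.exp (-n) - n * Real.exp (-n)) / n ^ 2 := by
      field_simp
    rw [h3, h2]
    exact div_pos (mul_pos (sub_pos.2 (Real.add_one_lt_exp hn.ne')) (Real.exp_pos _)) (by positivity)
  have h4 : 0 < (1 - Real.exp (-n)) / n - ((1 - Real.exp (-n)) / n ^ 2 - Real.exp (-n) / n) := by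
    have h5 : (1 - Real.exp (-n)) / n - ((1 - Real.exp (-n)) / n ^ 2 - Real.exp (-n) / n) =
        (Real.exp (-n) - (-n + 1)) / n ^ 2 := by
      field_simp
      ring
    rw [h5]
    exact div_pos (sub_pos.2 (Real.add_one_lt_exp (neg_ne_zero.2 hn.ne'))) (by positivity)
  have h6 := mul_le_mul_of_nonneg_right (decay_le_one (p := p) hθ u) h1.le
  unfold decay at h6
  unfold funU
  linarith

lemma funV_nonneg {θ₁ θ₂ n₁ n₂ n₃ : ℝ} (hθ₁ : 0 < θ₁) (hθ₂ : 0 < θ₂) (h₁ : 0 < n₁) (h₂ : 0 < n₂)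
    (h₃₁ : n₃ < n₁) (h₃₂ : n₃ < n₂) (u : Plane) : 0 ≤ funV p u θ₁ θ₂ n₁ n₂ n₃ :=
  add_nonneg (mul_nonneg (sub_nonneg.2 (decay_le_one hθ₁ u)) (funM_nonneg h₁ h₃₂))
    (mul_nonneg (sub_nonneg.2 (decay_le_one hθ₂ u)) (funM_nonneg h₂ h₃₁))

lemma h2L_nonneg (x y : Plane) : 0 ≤ h2L p x y :=
  div_nonneg (funV_nonneg p (div_pos p.gamL_pos p.powW_pos) (div_pos p.gamED_pos p.powL_pos)
    (N4_pos p x y) (N5_pos p x) (N6_lt_N4 p x y) (N6_lt_N5 p x y) _)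
    (funU_pos p (div_pos p.gamED_pos p.powL_pos) (N5_pos p x) _).le

theorem campbellDensity_true_eq_mul {x y : Plane} (hxy : y ≠ x) :
    campbellDensity p True x y =
      campbellDensity p False x y * ENNReal.ofReal (h2L p x y) := by
  have hU := funU_pos p (div_pos p.gamED_pos p.powL_pos) (N5_pos p x) (y - x)
  rw [campbellDensity_true p hxy, campbellDensity_false p hxy, mul_assoc,
    ← ENNReal.ofReal_mul hU.le, h2L, mul_div_cancel₀ _ hU.ne']

lemma campbellDensity_false_ne_zero {x y : Plane} (hxy : y ≠ x) :
    campbellDensity p False x y ≠ 0 := by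
  rw [campbellDensity_false p hxy]
  exact mul_ne_zero (voidProb_ne_zero p x) (ENNReal.ofReal_pos.2
    (funU_pos p (div_pos p.gamED_pos p.powL_pos) (N5_pos p x) _)).ne'

lemma continuous_funM {β : Type*} [TopologicalSpace β] {n₁ n₂ n₃ : β → ℝ} (c₁ : Continuous n₁)
    (c₂ : Continuous n₂) (c₃ : Continuous n₃) (h₁ : ∀ q, 0 < n₁ q) (h₂ : ∀ q, n₃ q < n₂ q) :
    Continuous fun q => funM (n₁ q) (n₂ q) (n₃ q) := by
  have hd : ∀ q, n₂ q - n₃ q ≠ 0 := fun q => (sub_pos.2 (h₂ q)).ne'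
  have hs : ∀ q, n₁ q + n₂ q - n₃ q ≠ 0 := fun q => by
    have := h₁ q
    have := h₂ q
    linarith
  have hn : ∀ q, n₁ q ≠ 0 := fun q => (h₁ q).ne'
  unfold funM
  fun_prop (disch := assumption)

/-- Continuity holds also on the diagonal, where the density formulas are not available; it is what
extends the local limit to every pair of locations. -/
theorem continuous_h2L : Continuous (Function.uncurry (h2L p)) := by
  have c₄ := continuous_N4 p
  have c₅ := continuous_N5 p
  have c₆ := continuous_N6 p
  have h₅ : ∀ q : Plane × Plane, N5 p ‖q.1‖ ≠ 0 := fun q => (N5_pos p q.1).ne'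
  have hm := continuous_funM c₄ c₅ c₆ (fun q => N4_pos p q.1 q.2) fun q => N6_lt_N5 p q.1 q.2
  have hm' := continuous_funM c₅ c₄ c₆ (fun q => N5_pos p q.1) fun q => N6_lt_N4 p q.1 q.2
  have hl := continuous_pathLoss p
  have hU : Continuous fun q : Plane × Plane =>
      funU p (q.2 - q.1) (p.gamED / p.powL) (N5 p ‖q.1‖) := by
    have h₅' : ∀ q : Plane × Plane, N5 p ‖q.1‖ ^ 2 ≠ 0 := fun q => pow_ne_zero 2 (h₅ q)
    unfold funU
    fun_prop (disch := assumption)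
  have hV : Continuous fun q : Plane × Plane =>
      funV p (q.2 - q.1) (p.gamL / p.powW) (p.gamED / p.powL) (N4 p ‖q.1‖ q.2) (N5 p ‖q.1‖)
        (N6 p q.1 q.2) := by
    unfold funV
    fun_prop
  exact hV.div hU fun q => (funU_pos p (div_pos p.gamED_pos p.powL_pos) (N5_pos p q.1) _).ne'

lemma pairWeight_le_one (b : Prop) (t s : ℝ) (x y : Plane) : pairWeight p b t s x y ≤ 1 := by
  have h : ∀ (c : Prop) (θ : ℝ), ENNReal.ofReal (1 - pairViol c (blockProb p θ ‖y - x‖)) ≤ 1 := by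
    intro c θ
    rw [ENNReal.ofReal_le_one, sub_le_self_iff, pairViol]
    split_ifs
    · exact blockProb_nonneg _ _ _
    · exact le_rfl
  exact mul_le_one' (h _ _) (h _ _)

lemma campbellDensity_le_one (b : Prop) (x y : Plane) : campbellDensity p b x y ≤ 1 := by
  have h : ∫⁻ z, timedDensity p b z.1 z.2 x y ∂(unif.prod unif) ≤ ∫⁻ _, 1 ∂(unif.prod unif) :=
    lintegral_mono fun z => mul_le_one' (mul_le_one' (pairWeight_le_one p b _ _ _ _)
      (negExp_le_one _)) (negExp_le_one _)
  simpa [campbellDensity] using h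

lemma measurable_campbellDensity (b : Prop) :
    Measurable fun q : Plane × Plane => campbellDensity p b q.1 q.2 :=
  (measurable_timedDensity p b).lintegral_prod_right'

end ClosedForm

/-! ### The Palm conditional probability and its local version. -/

section Palm

variable {Ω : Type*} [MeasurableSpace Ω] {P : Measure Ω} [IsProbabilityMeasure P]
  {p : Params} {N : Network Ω}

/-- Averages of a continuous function over shrinking balls converge to its value at the centre. -/
lemma tendsto_withDensity_ball_div {E : Type*} [PseudoMetricSpace E] [MeasurableSpace E]
    [OpensMeasurableSpace E] {ν : Measure E} {f : E → ℝ} {c : E} (hf : ContinuousAt f c)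
    (h0 : ∀ ε > 0, ν (Metric.ball c ε) ≠ 0) (htop : ∀ ε > 0, ν (Metric.ball c ε) ≠ ∞)
    (hf0 : ∀ q, 0 ≤ f q) :
    Tendsto (fun ε : ℝ => ((ν.withDensity fun q => ENNReal.ofReal (f q)) (Metric.ball c ε) /
      ν (Metric.ball c ε)).toReal) (𝓝[>] 0) (𝓝 (f c)) := by
  rw [Metric.tendsto_nhds]
  intro δ hδ
  obtain ⟨r, hr, hball⟩ := Metric.continuousAt_iff.1 hf (δ / 2) (half_pos hδ)
  filter_upwards [Ioo_mem_nhdsGT hr] with ε hε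
  have hb : ∀ q ∈ Metric.ball c ε, |f q - f c| < δ / 2 := fun q hq =>
    hball (lt_trans hq hε.2)
  have hm : MeasurableSet (Metric.ball c ε) := Metric.isOpen_ball.measurableSet
  rw [withDensity_apply _ hm]
  have hup : ∫⁻ q in Metric.ball c ε, ENNReal.ofReal (f q) ∂ν ≤
      ENNReal.ofReal (f c + δ / 2) * ν (Metric.ball c ε) := by
    rw [← setLIntegral_const]
    exact setLIntegral_mono' hm fun q hq =>
      ENNReal.ofReal_le_ofReal (by linarith [(abs_lt.1 (hb q hq)).2])
  have hlow : ENNReal.ofReal (f c - δ / 2) * ν (Metric.ball c ε) ≤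
      ∫⁻ q in Metric.ball c ε, ENNReal.ofReal (f q) ∂ν := by
    rw [← setLIntegral_const]
    exact setLIntegral_mono' hm fun q hq =>
      ENNReal.ofReal_le_ofReal (by linarith [(abs_lt.1 (hb q hq)).1])
  have hup' := ENNReal.div_le_of_le_mul hup
  have hlow' := (ENNReal.le_div_iff_mul_le (.inl (h0 ε hε.1)) (.inl (htop ε hε.1))).2 hlow
  set R := (∫⁻ q in Metric.ball c ε, ENNReal.ofReal (f q) ∂ν) / ν (Metric.ball c ε)
  have hR : R ≠ ∞ := ne_top_of_le_ne_top ENNReal.ofReal_ne_top hup'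
  have h1 : R.toReal ≤ f c + δ / 2 :=
    ENNReal.toReal_le_of_le_ofReal (by linarith [hf0 c]) hup'
  have h2 : f c - δ / 2 ≤ R.toReal := (ENNReal.ofReal_le_iff_le_toReal hR).1 hlow'
  rw [Real.dist_eq, abs_lt]
  constructor <;> linarith

lemma campbellBoth_eq (N : Network Ω) (p : Params) (P : Measure Ω) :
    N.campbellBoth p P = N.campbell p P True := by
  simp [Network.campbellBoth, Network.campbell, Network.Coexist]

lemma campbellTagged_eq (N : Network Ω) (p : Params) (P : Measure Ω) :
    N.campbellTagged p P = N.campbell p P False := by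
  simp [Network.campbellTagged, Network.campbell, Network.Coexist]

/-- The fibres of the diagonal are single points, hence null. This disposes of the locations
excluded from the closed forms. -/
lemma intensity_prod_diagonal (a b : ℝ) :
    ∀ᵐ q ∂((intensity a).prod (intensity b)), q.2 ≠ q.1 := by
  have hm : MeasurableSet {q : Plane × Plane | q.2 = q.1} :=
    measurableSet_eq_fun measurable_snd measurable_fst
  refine measure_eq_zero_iff_ae_notMem.1 ((Measure.measure_prod_null hm).2 (.of_forall fun x => ?_))
  have : Prod.mk x ⁻¹' {q : Plane × Plane | q.2 = q.1} = {x} := by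
    ext
    simp
  simp [this, intensity]

theorem campbellBoth_eq_withDensity (hN : N.IsModel p 0 1 P) :
    N.campbellBoth p P = (N.campbellTagged p P).withDensity
      fun q => ENNReal.ofReal (h2L p q.1 q.2) := by
  have hh : Measurable fun q : Plane × Plane => ENNReal.ofReal (h2L p q.1 q.2) :=
    (continuous_h2L p).measurable.ennreal_ofReal
  rw [campbellBoth_eq, campbellTagged_eq, campbell_eq_withDensity hN, campbell_eq_withDensity hN,
    ← withDensity_mul _ (measurable_campbellDensity p False) hh]
  refine withDensity_congr_ae ?_
  filter_upwards [intensity_prod_diagonal p.lamW p.lamL] with q hq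
  exact campbellDensity_true_eq_mul p hq

lemma intensity_ball_ne_zero {lam : ℝ} (hlam : 0 < lam) (x : Plane) {ε : ℝ} (hε : 0 < ε) :
    intensity lam (Metric.ball x ε) ≠ 0 := by
  rw [intensity, Measure.smul_apply, smul_eq_mul]
  exact mul_ne_zero (ENNReal.ofReal_pos.2 hlam).ne' (Metric.measure_ball_pos _ _ hε).ne'

/-- The density is nonzero off the null diagonal and at most `1`, while discs have positive finite
intensity. -/
lemma campbellTagged_ball (hN : N.IsModel p 0 1 P) (x y : Plane) {ε : ℝ} (hε : 0 < ε) :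
    N.campbellTagged p P (Metric.ball x ε ×ˢ Metric.ball y ε) ≠ 0 ∧
      N.campbellTagged p P (Metric.ball x ε ×ˢ Metric.ball y ε) ≠ ∞ := by
  rw [campbellTagged_eq, campbell_eq_withDensity hN]
  have hm : MeasurableSet (Metric.ball x ε ×ˢ Metric.ball y ε) :=
    Metric.isOpen_ball.measurableSet.prod Metric.isOpen_ball.measurableSet
  constructor
  · rw [Ne, withDensity_apply_eq_zero (measurable_campbellDensity p False),
      Set.inter_comm, measure_inter_conull, Measure.prod_prod]
    · exact mul_ne_zero (intensity_ball_ne_zero p.lamW_pos x hε)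
        (intensity_ball_ne_zero p.lamL_pos y hε)
    · refine measure_mono_null (fun q hq => ?_)
        (ae_iff.1 (intensity_prod_diagonal p.lamW p.lamL))
      exact fun h => hq (campbellDensity_false_ne_zero p h)
  · rw [withDensity_apply _ hm]
    refine ne_top_of_le_ne_top ?_ (lintegral_mono fun q => campbellDensity_le_one p False q.1 q.2)
    rw [setLIntegral_one, Measure.prod_prod]
    exact ENNReal.mul_ne_top (intensity_ne_top _ measure_ball_lt_top.ne)
      (intensity_ne_top _ measure_ball_lt_top.ne)

theorem isPalmCondProb_h2L (hN : N.IsModel p 0 1 P) : N.IsPalmCondProb p P (h2L p) :=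
  ⟨(continuous_h2L p).measurable, h2L_nonneg p, campbellBoth_eq_withDensity hN⟩

theorem hasLocalCondProb_h2L (hN : N.IsModel p 0 1 P) (x y : Plane) :
    N.HasLocalCondProb p P x y (h2L p x y) := by
  refine ⟨fun ε hε => campbellTagged_ball hN x y hε, ?_⟩
  rw [campbellBoth_eq_withDensity hN]
  -- In the sup metric a product of discs of equal radius is a ball, so the averaging lemma applies
  -- in the product space.
  simp_rw [ball_prod_same]
  refine tendsto_withDensity_ball_div (c := (x, y)) (f := fun q : Plane × Plane => h2L p q.1 q.2)
    (continuous_h2L p).continuousAt (fun ε hε => ?_) (fun ε hε => ?_) fun q => h2L_nonneg p _ _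
  · rw [← ball_prod_same]
    exact (campbellTagged_ball hN x y hε).1
  · rw [← ball_prod_same]
    exact (campbellTagged_ball hN x y hε).2

end Palm

end Coexistence

end

theorem mainTheorem7 {Ω : Type*} [MeasurableSpace Ω] (P : Measure Ω) [IsProbabilityMeasure P]
    (p : Coexistence.Params) (N : Coexistence.Network Ω) (hN : N.IsModel p 0 1 P) :
    N.IsPalmCondProb p P (Coexistence.h2L p) ∧
    ∀ (r₀ : ℝ), 0 ≤ r₀ → ∀ y : Coexistence.Plane,
      N.HasLocalCondProb p P !₂[r₀, 0] y
        (Coexistence.funV p (y - !₂[r₀, 0]) (p.gamL / p.powW) (p.gamED / p.powL)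
            (Coexistence.N4 p r₀ y) (Coexistence.N5 p r₀) (Coexistence.N6 p !₂[r₀, 0] y)
          / Coexistence.funU p (y - !₂[r₀, 0]) (p.gamED / p.powL) (Coexistence.N5 p r₀)) := by
  refine ⟨Coexistence.isPalmCondProb_h2L hN, fun r₀ hr₀ y => ?_⟩
  have hn : ‖(!₂[r₀, 0] : Coexistence.Plane)‖ = r₀ := by
    simp [EuclideanSpace.norm_eq, Fin.sum_univ_two, Real.sqrt_sq hr₀]
  have h := Coexistence.hasLocalCondProb_h2L hN !₂[r₀, 0] y
  rwa [Coexistence.h2L, hn] at h
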